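/- Let $d\ge 1$, $\beta>0$, and let $1<p<\infty$ if $d\in\{1,2\}$ and $1<p<\frac{d+2}{d-2}$ if $d\ge 3$. Let $V:\mathbb R^d\to[0,\infty)$ be measurable with $V(\mathbf x)\to\infty$ as $|\mathbf x|\to\infty$, and put $X=\{\phi\in H^1(\mathbb R^d;\mathbb C):\int V|\phi|^2<\infty\}$; assume $X\ne\{0\}$ (which is automatic if $V$ is locally integrable). Let $L_z=i(x_2\partial_{x_1}-x_1\partial_{x_2})$ if $d\ge2$ and $L_z=0$ if $d=1$. Let $\Omega\in\mathbb R$ satisfy $\Omega=0$ or $0<|\Omega|<\Omega_{\max}$, where $$\Omega_{\max}=\sup\Big\{\gamma>0:\ \lim_{|\mathbf x|\to\infty}\Big(V(\mathbf x)-\tfrac{\gamma^2}{2}(x_1^2+x_2^2)\Big)=\infty\Big\}\le\infty,$$ and for $d=1$ the term $x_1^2+x_2^2$ is read as $0$. For $\phi\in X$ and $\omega\in\mathbb R$ let $$S_{\Omega,\omega}(\phi)=\int_{\mathbb R^d}\Big(\tfrac12|\nabla\phi|^2+V|\phi|^2-\Omega\,\overline\phi\,L_z\phi+\tfrac{2\beta}{p+1}|\phi|^{p+1}+\omega|\phi|^2\Big)\,d\mathbf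 x,$$ $$\lambda_0(\Omega)=\inf_{0\ne\phi\in X}\frac{\int_{\mathbb R^d}\big(\frac12|\nabla\phi|^2+V|\phi|^2-\Omega\,\overline\phi\,L_z\phi\big)\,d\mathbf x}{\|\phi\|_{L^2}^2}.$$ For $\omega<-\lambda_0(\Omega)$, let $\mathcal A_{\Omega,\omega}$ be the set of action ground states, that is, of those $\phi$ which minimize $S_{\Omega,\omega}$ among all nonzero weak solutions $\phi\in X$ (tested against all functions in $X$) of $$-\tfrac12\Delta\phi+V\phi+\beta|\phi|^{p-1}\phi-\Omega L_z\phi+\omega\phi=0,$$ and let $$\mathcal N_{\Omega,\omega}=\{\|\phi\|_{L^2}^2:\phi\in\mathcal A_{\Omega,\omega}\},\quad m_*(\omega)=\inf\mathcal N_{\Omega,\omega},\quad m^*(\omega)=\sup\mathcal N_{\Omega,\omega},\quad \mathcal I(\omega)=[m_*(\omega),m^*(\omega)].$$ Then $\lambda_0(\Omega)$ is finite and, for every $\omega<-\lambda_0(\Omega)$, the set $\mathcal N_{\Omega,\omega}$ is nonempty and bounded, so that $\mathcal I(\omega)$ is a well-defined compact interval. The intervals are pairwise disjoint: $\mathcal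 I(\omega_1)\cap\mathcal I(\omega_2)=\emptyset$ whenever $\omega_1\ne\omega_2$ are both less than $-\lambda_0(\Omega)$. Moreover, $$\bigcup_{\omega\in(-\infty,-\lambda_0(\Omega))}\mathcal I(\omega)=(0,\infty).$$ -/

import Mathlib

open MeasureTheory Filter Topology
open scoped ComplexConjugate

noncomputable section

namespace RotNLS

/-- The Euclidean space `ℝ^d`. -/
abbrev E (d : ℕ) : Type := EuclideanSpace ℝ (Fin d)

variable {d : ℕ}

/-! ### The space `X = H¹(ℝ^d) ∩ L²_V(ℝ^d)` -/

/-- `g` is a weak partial derivative of `φ` in the `j`-th coordinate direction: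
`∫ η g = - ∫ (∂_j η) φ` for all test functions `η ∈ C_c^∞(ℝ^d)`. -/
def HasWeakPartial (j : Fin d) (φ g : E d → ℂ) : Prop :=
  LocallyIntegrable g ∧
    ∀ η : E d → ℝ, ContDiff ℝ (⊤ : ℕ∞) η → HasCompactSupport η →
      ∫ x, η x • g x = - ∫ x, (fderiv ℝ η x (EuclideanSpace.single j 1)) • φ x

/-- Weak partial derivatives are unique up to null sets, so that the choice made in `weakPartial`
does not matter. -/
theorem HasWeakPartial.ae_eq {j : Fin d} {φ g g' : E d → ℂ}
    (h : HasWeakPartial j φ g) (h' : HasWeakPartial j φ g') : g =ᵐ[volume] g' :=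
  ae_eq_of_integral_contDiff_smul_eq h.1 h'.1
    fun η hη hc => (h.2 η hη hc).trans (h'.2 η hη hc).symm

open Classical in
/-- The weak partial derivative `∂_j φ` (a representative of it; zero if there is none). -/
def weakPartial (j : Fin d) (φ : E d → ℂ) : E d → ℂ :=
  if h : ∃ g, HasWeakPartial j φ g then h.choose else 0

theorem HasWeakPartial.weakPartial_ae_eq {j : Fin d} {φ g : E d → ℂ}
    (h : HasWeakPartial j φ g) : weakPartial j φ =ᵐ[volume] g := by
  have hex : ∃ g, HasWeakPartial j φ g := ⟨g, h⟩
  have : weakPartial j φ = hex.choose := dif_pos hex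
  rw [this]
  exact hex.choose_spec.ae_eq h

/-- `φ ∈ H¹(ℝ^d)`, complex-valued. -/
def MemH1 (φ : E d → ℂ) : Prop :=
  MemLp φ 2 volume ∧ ∀ j : Fin d, ∃ g : E d → ℂ, MemLp g 2 volume ∧ HasWeakPartial j φ g

/-- `φ ∈ X = H¹(ℝ^d) ∩ L²_V(ℝ^d)`. -/
def MemX (V : E d → ℝ) (φ : E d → ℂ) : Prop :=
  MemH1 φ ∧ Integrable (fun x => V x * ‖φ x‖ ^ 2) volume

/-! ### Functionals -/

/-- The mass `‖φ‖_{L²}²`. -/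
def mass (φ : E d → ℂ) : ℝ := ∫ x, ‖φ x‖ ^ 2

/-- `L_z φ = i (x₂ ∂₁ φ - x₁ ∂₂ φ)` if `d ≥ 2`, and `L_z φ = 0` if `d = 1`. -/
def Lz (φ : E d → ℂ) (x : E d) : ℂ :=
  if h : 2 ≤ d then
    Complex.I * ((x ⟨1, by omega⟩ : ℂ) * weakPartial ⟨0, by omega⟩ φ x
      - (x ⟨0, by omega⟩ : ℂ) * weakPartial ⟨1, by omega⟩ φ x)
  else 0

/-- `x₁² + x₂²` if `d ≥ 2`; there is no rotation plane if `d = 1`, and the value is `0` then. -/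
def planeSq (x : E d) : ℝ :=
  if h : 2 ≤ d then x ⟨0, by omega⟩ ^ 2 + x ⟨1, by omega⟩ ^ 2 else 0

/-- The rotational energy `L_Ω(φ) = -Ω ∫ conj φ · L_z φ`; the integral is real on `X`. -/
def rotEnergy (Ω : ℝ) (φ : E d → ℂ) : ℝ := -Ω * (∫ x, conj (φ x) * Lz φ x).re

/-- The quadratic part `∫ (½|∇φ|² + V|φ|² - Ω conj φ L_z φ)` of the energy. -/
def quadEnergy (V : E d → ℝ) (Ω : ℝ) (φ : E d → ℂ) : ℝ :=
  (1 / 2) * (∫ x, ∑ j : Fin d, ‖weakPartial j φ x‖ ^ 2) + (∫ x, V x * ‖φ x‖ ^ 2) + rotEnergy Ω φ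

/-- The energy `E(φ) = quadratic part + 2β/(p+1) ‖φ‖_{L^{p+1}}^{p+1}`. -/
def energy (p β : ℝ) (V : E d → ℝ) (Ω : ℝ) (φ : E d → ℂ) : ℝ :=
  quadEnergy V Ω φ + (2 * β / (p + 1)) * ∫ x, ‖φ x‖ ^ (p + 1)

/-- The action `S_{Ω,ω}(φ) = E(φ) + ω ‖φ‖_{L²}²`. -/
def action (p β : ℝ) (V : E d → ℝ) (Ω ω : ℝ) (φ : E d → ℂ) : ℝ :=
  energy p β V Ω φ + ω * mass φ

/-- `Ω_max`, the supremum (in `[-∞, ∞]`, with `sup ∅ = -∞`) of all `γ > 0` such that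
`V(x) - γ²/2 (x₁² + x₂²) → ∞` as `|x| → ∞`. -/
def OmegaMax (V : E d → ℝ) : EReal :=
  ⨆ γ ∈ {γ : ℝ | 0 < γ ∧
    Tendsto (fun x => V x - γ ^ 2 / 2 * planeSq x) (cocompact (E d)) atTop}, (γ : EReal)

/-- The Rayleigh quotients of `R = -½Δ + V - Ω L_z` on `X \ {0}`. -/
def rayleighQuotients (V : E d → ℝ) (Ω : ℝ) : Set ℝ :=
  {r | ∃ φ : E d → ℂ, MemX V φ ∧ ¬ φ =ᵐ[volume] 0 ∧ r = quadEnergy V Ω φ / mass φ}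

/-- `λ₀(Ω)`, the infimum of the Rayleigh quotients. -/
def lambda0 (V : E d → ℝ) (Ω : ℝ) : ℝ := sInf (rayleighQuotients V Ω)

/-! ### Action ground states -/

/-- `φ ∈ X` is a nonzero weak solution of the stationary equation
`-½Δφ + Vφ + β|φ|^{p-1}φ - Ω L_z φ + ωφ = 0`, tested against all of `X`. -/
def IsStationary (p β : ℝ) (V : E d → ℝ) (Ω ω : ℝ) (φ : E d → ℂ) : Prop :=
  MemX V φ ∧ ¬ φ =ᵐ[volume] 0 ∧
    ∀ v : E d → ℂ, MemX V v →
      (1 / 2 : ℂ) * (∫ x, ∑ j : Fin d, weakPartial j φ x * conj (weakPartial j v x))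
        + (∫ x, (V x : ℂ) * φ x * conj (v x))
        + (β : ℂ) * (∫ x, ((‖φ x‖ ^ (p - 1) : ℝ) : ℂ) * φ x * conj (v x))
        - (Ω : ℂ) * (∫ x, Lz φ x * conj (v x))
        + (ω : ℂ) * (∫ x, φ x * conj (v x)) = 0

/-- The set `𝒜_{Ω,ω}` of action ground states: the nonzero stationary solutions of least action. -/
def actionGroundStates (p β : ℝ) (V : E d → ℝ) (Ω ω : ℝ) : Set (E d → ℂ) :=
  {φ | IsStationary p β V Ω ω φ ∧
    ∀ ψ : E d → ℂ, IsStationary p β V Ω ω ψ → action p β V Ω ω φ ≤ action p β V Ω ω ψ}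

/-- The set `𝒩_{Ω,ω}` of the masses of action ground states. -/
def groundMasses (p β : ℝ) (V : E d → ℝ) (Ω ω : ℝ) : Set ℝ :=
  mass '' actionGroundStates p β V Ω ω

/-- `m^*(ω) = sup 𝒩_{Ω,ω}`. -/
def mUpper (p β : ℝ) (V : E d → ℝ) (Ω ω : ℝ) : ℝ := sSup (groundMasses p β V Ω ω)

/-- `m_*(ω) = inf 𝒩_{Ω,ω}`. -/
def mLower (p β : ℝ) (V : E d → ℝ) (Ω ω : ℝ) : ℝ := sInf (groundMasses p β V Ω ω)

/-- The closed interval `I(ω) = [m_*(ω), m^*(ω)]`. -/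
def massInterval (p β : ℝ) (V : E d → ℝ) (Ω ω : ℝ) : Set ℝ :=
  Set.Icc (mLower p β V Ω ω) (mUpper p β V Ω ω)

end RotNLS

end

/-!
The action is `S_ω = E + ω M`, affine in `ω`, where `M` is the mass. For `ω < -λ₀` its infimum over
`X` is negative and attained, a minimizer solves the Euler–Lagrange equation, and hence the action
ground states are exactly the global minimizers of `S_ω` on `X`
(`Admissible.actionGroundStates_eq`). Everything then follows from the concavity of
`ω ↦ min S_ω`, whose supergradients are the masses of minimizers, together with one compactness
statement (`Admissible.exists_minimizer_of_seq`): a minimizing sequence of `S_ω` has a subsequence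
along which the masses converge to the mass of a minimizer.

*Disjointness.* Comparing minimizers for `ω₁ < ω₂` shows that masses are nonincreasing in `ω`. If
two of them agreed, one function would minimize both actions, and subtracting its two
Euler–Lagrange equations would make it zero. By compactness `m_*` and `m^*` are attained, so that
`m^*(ω₂) < m_*(ω₁)`.

*Covering.* Given `m > 0`, let `ω₀` be the supremum of those `ω < -λ₀` which have a minimizer of
mass at least `m`. There are such `ω`, since masses grow without bound as `ω → -∞`. Approaching
`ω₀` from both sides, compactness yields minimizers at `ω₀` of mass `≥ m` and of mass `≤ m`.
Moreover `ω₀ ≠ -λ₀`, because at `ω = -λ₀` the only minimizer is `0`. Thus `m ∈ I(ω₀)`.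

*Compactness.* For `|Ω| < Ω_max` the centrifugal potential is at most `θ² (V + C)` with `θ < 1`, so
that the energy density is bounded below by a multiple of `|∇φ|² + V|φ|²` up to `C|φ|²`, and the
nonlinearity together with `V → ∞` absorbs `(C - ω)|φ|²`. Sublevel sets of the action are therefore
bounded in `X`, and bounded sequences in `X` have `L²`-Cauchy subsequences
(`exists_subseq_cauchy`): a weakly convergent sequence becomes strongly convergent on balls after
averaging over small balls, averaging costs little by the translation estimate
`‖φ(· + h) - φ‖ ≲ |h| ‖∇φ‖`, and `V → ∞` controls the tails. As the action is convex up to a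
multiple of the mass, the parallelogram identity upgrades this to convergence of the gradients, and
Fatou's lemma shows that the limit is a minimizer.

*Integrability.* That `|φ|^{p+1}` is integrable on `X` is the subcritical Sobolev embedding, needed
only qualitatively (`MemH1.memLp_rpow`). It comes from the same averages: if `φ ∈ H¹ ∩ L^r`, then
`φ` is in weak `L^{2 + 2r/d}`, and iterating this gain reaches every subcritical exponent.

*The Euler–Lagrange equation.* The rotational term has the right derivative because `L_z` is
symmetric on `X`. This is integration by parts against a radial cutoff, where no error term arises
as `L_z` annihilates radial functions (`integral_cutoff_Lz`).
-/

noncomputable section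

namespace RotNLS

variable {d : ℕ}

/-! ### The mass as squared `L²` norm -/

lemma integrable_normSq {f : E d → ℂ} (hf : MemLp f 2 volume) :
    Integrable (fun x => ‖f x‖ ^ 2) volume :=
  (memLp_two_iff_integrable_sq_norm hf.1).1 hf

lemma mass_nonneg (f : E d → ℂ) : 0 ≤ mass f := integral_nonneg fun _ => by positivity

lemma mass_congr {f g : E d → ℂ} (h : f =ᵐ[volume] g) : mass f = mass g :=
  integral_congr_ae (h.mono fun x hx => by simp only [hx])

lemma mass_eq_toReal_sq {f : E d → ℂ} (hf : MemLp f 2 volume) :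
    mass f = (eLpNorm f 2 volume).toReal ^ 2 := by
  rw [hf.eLpNorm_eq_integral_rpow_norm (by norm_num) (by norm_num)]
  have h0 : (0 : ℝ) ≤ ∫ x, ‖f x‖ ^ 2 := mass_nonneg f
  simp only [ENNReal.toReal_ofNat, Real.rpow_ofNat]
  rw [ENNReal.toReal_ofReal (by positivity), ← Real.rpow_natCast, ← Real.rpow_mul h0]
  norm_num [mass]

lemma mass_eq_norm_toLp_sq {f : E d → ℂ} (hf : MemLp f 2 volume) :
    mass f = ‖hf.toLp f‖ ^ 2 := by
  rw [mass_eq_toReal_sq hf, Lp.norm_toLp]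

lemma ofReal_mass {f : E d → ℂ} (hf : MemLp f 2 volume) :
    ENNReal.ofReal (mass f) = ∫⁻ x, ‖f x‖ₑ ^ (2 : ℝ) := by
  rw [mass, ofReal_integral_eq_lintegral_ofReal (integrable_normSq hf)
    (ae_of_all _ fun _ => by positivity)]
  refine lintegral_congr fun x => ?_
  rw [ENNReal.rpow_ofNat, ENNReal.ofReal_pow (norm_nonneg _), ofReal_norm]

lemma ae_eq_zero_iff_mass {f : E d → ℂ} (hf : MemLp f 2 volume) :
    f =ᵐ[volume] 0 ↔ mass f = 0 := by
  rw [mass, integral_eq_zero_iff_of_nonneg (fun _ => by positivity) (integrable_normSq hf)]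
  constructor <;> intro h <;> filter_upwards [h] with x hx <;> simpa using hx

lemma mass_pos {f : E d → ℂ} (hf : MemLp f 2 volume) (h : ¬ f =ᵐ[volume] 0) : 0 < mass f :=
  (mass_nonneg f).lt_of_ne fun h' => h ((ae_eq_zero_iff_mass hf).2 h'.symm)

lemma mass_const_smul (c : ℂ) (f : E d → ℂ) : mass (c • f) = ‖c‖ ^ 2 * mass f := by
  simp only [mass, Pi.smul_apply, smul_eq_mul, norm_mul, mul_pow, integral_const_mul]

lemma mass_add_le {f g : E d → ℂ} (hf : MemLp f 2 volume) (hg : MemLp g 2 volume) :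
    mass (f + g) ≤ 2 * mass f + 2 * mass g := by
  simp only [mass]
  rw [← integral_const_mul, ← integral_const_mul, ← integral_add
    ((integrable_normSq hf).const_mul _) ((integrable_normSq hg).const_mul _)]
  refine integral_mono (integrable_normSq (hf.add hg))
    (((integrable_normSq hf).const_mul _).add ((integrable_normSq hg).const_mul _)) fun x => ?_
  have h1 := norm_add_le (f x) (g x)
  simp only [Pi.add_apply]
  nlinarith [sq_nonneg (‖f x‖ - ‖g x‖), norm_nonneg (f x + g x), norm_nonneg (f x),
    norm_nonneg (g x)]

lemma mass_neg (f : E d → ℂ) : mass (-f) = mass f := by simp [mass]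

/-- Cauchy–Schwarz. -/
lemma norm_integral_mul_sq_le {f g : E d → ℂ} (hf : MemLp f 2 volume) (hg : MemLp g 2 volume) :
    ‖∫ x, f x * g x‖ ^ 2 ≤ mass f * mass g := by
  have h2 : ENNReal.ofReal (2 : ℝ) = 2 := by norm_num
  have h := integral_mul_norm_le_Lp_mul_Lq (μ := (volume : Measure (E d)))
    Real.HolderConjugate.two_two (f := f) (g := g) (by rwa [h2]) (by rwa [h2])
  have h1 : ‖∫ x, f x * g x‖ ≤ ∫ x, ‖f x‖ * ‖g x‖ := by
    simpa only [norm_mul] using norm_integral_le_integral_norm (fun x => f x * g x)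
  have h3 := h1.trans h
  simp only [Real.rpow_ofNat] at h3
  calc ‖∫ x, f x * g x‖ ^ 2 ≤ (mass f ^ (1 / 2 : ℝ) * mass g ^ (1 / 2 : ℝ)) ^ 2 := by
        gcongr; exact h3
    _ = mass f * mass g := by
        rw [mul_pow, ← Real.rpow_natCast, ← Real.rpow_natCast, ← Real.rpow_mul (mass_nonneg f),
          ← Real.rpow_mul (mass_nonneg g)]
        norm_num

lemma integrable_mul_of_memLp {f g : E d → ℂ} (hf : MemLp f 2 volume) (hg : MemLp g 2 volume) :
    Integrable (fun x => f x * g x) volume := hf.integrable_mul hg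

lemma mass_ofReal (η : E d → ℝ) : mass (fun x => (η x : ℂ)) = ∫ x, η x ^ 2 := by
  simp [mass]

lemma norm_integral_smul_sq_le {η : E d → ℝ} {g : E d → ℂ} (hη : MemLp η 2 volume)
    (hg : MemLp g 2 volume) : ‖∫ x, η x • g x‖ ^ 2 ≤ (∫ x, η x ^ 2) * mass g := by
  rw [← mass_ofReal]
  exact norm_integral_mul_sq_le (hη.ofReal (K := ℂ)) hg

lemma tendsto_integral_mul {f : ℕ → E d → ℂ} {f' g : E d → ℂ} (hf : ∀ n, MemLp (f n) 2 volume)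
    (hf' : MemLp f' 2 volume) (hg : MemLp g 2 volume)
    (h : Tendsto (fun n => mass (f n - f')) atTop (𝓝 0)) :
    Tendsto (fun n => ∫ x, g x * f n x) atTop (𝓝 (∫ x, g x * f' x)) := by
  rw [tendsto_iff_norm_sub_tendsto_zero]
  have h1 : Tendsto (fun n => √(mass g * mass (f n - f'))) atTop (𝓝 0) := by
    simpa using (h.const_mul (mass g)).sqrt
  refine squeeze_zero (fun _ => norm_nonneg _) (fun n => ?_) h1
  refine Real.le_sqrt_of_sq_le ?_
  rw [← integral_sub (integrable_mul_of_memLp hg (hf n)) (integrable_mul_of_memLp hg hf')]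
  simpa only [Pi.sub_apply, mul_sub] using norm_integral_mul_sq_le hg ((hf n).sub hf')

lemma tendsto_eLpNorm_of_mass {f : ℕ → E d → ℂ} {f' : E d → ℂ} (hf : ∀ n, MemLp (f n) 2 volume)
    (hf' : MemLp f' 2 volume) (h : Tendsto (fun n => mass (f n - f')) atTop (𝓝 0)) :
    Tendsto (fun n => eLpNorm (f n - f') 2 volume) atTop (𝓝 0) := by
  have h1 := ENNReal.tendsto_ofReal h.sqrt
  simp only [Real.sqrt_zero, ENNReal.ofReal_zero] at h1
  refine h1.congr fun n => ?_
  rw [mass_eq_toReal_sq ((hf n).sub hf'), Real.sqrt_sq ENNReal.toReal_nonneg,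
    ENNReal.ofReal_toReal ((hf n).sub hf').2.ne]

/-- Completeness of `L²`, in terms of functions. -/
lemma exists_tendsto_of_cauchy {f : ℕ → E d → ℂ} (hf : ∀ n, MemLp (f n) 2 volume)
    (h : ∀ ε > 0, ∃ N, ∀ m ≥ N, ∀ n ≥ N, mass (f m - f n) < ε) :
    ∃ f' : E d → ℂ, MemLp f' 2 volume ∧ Tendsto (fun n => mass (f n - f')) atTop (𝓝 0) := by
  have key : ∀ m n, mass (f m - f n) = ‖(hf m).toLp _ - (hf n).toLp _‖ ^ 2 := fun m n => by
    rw [mass_eq_norm_toLp_sq ((hf m).sub (hf n)), MemLp.toLp_sub]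
  have hc : CauchySeq fun n => (hf n).toLp (f n) := by
    rw [Metric.cauchySeq_iff]
    intro ε hε
    obtain ⟨N, hN⟩ := h (ε ^ 2) (by positivity)
    refine ⟨N, fun m hm n hn => ?_⟩
    have := hN m hm n hn
    rw [key] at this
    rw [dist_eq_norm]
    exact lt_of_pow_lt_pow_left₀ 2 hε.le this
  obtain ⟨F, hF⟩ := cauchySeq_tendsto_of_complete hc
  refine ⟨F, Lp.memLp F, ?_⟩
  have h2 : ∀ n, mass (f n - (F : E d → ℂ)) = ‖(hf n).toLp _ - F‖ ^ 2 := fun n => by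
    rw [mass_eq_norm_toLp_sq ((hf n).sub (Lp.memLp F)), MemLp.toLp_sub (hf n) (Lp.memLp F),
      Lp.toLp_coeFn]
  simp only [h2]
  simpa using ((tendsto_iff_norm_sub_tendsto_zero.1 hF).pow 2)

lemma tendsto_mass {f : ℕ → E d → ℂ} {f' : E d → ℂ} (hf : ∀ n, MemLp (f n) 2 volume)
    (hf' : MemLp f' 2 volume) (h : Tendsto (fun n => mass (f n - f')) atTop (𝓝 0)) :
    Tendsto (fun n => mass (f n)) atTop (𝓝 (mass f')) := by
  have key : ∀ n, mass (f n - f') = ‖(hf n).toLp _ - hf'.toLp _‖ ^ 2 := fun n => by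
    rw [mass_eq_norm_toLp_sq ((hf n).sub hf'), MemLp.toLp_sub]
  have h1 : Tendsto (fun n => ‖(hf n).toLp _ - hf'.toLp _‖) atTop (𝓝 0) := by
    have := h.sqrt
    simp only [key, Real.sqrt_zero] at this
    exact this.congr fun n => Real.sqrt_sq (norm_nonneg _)
  have h2 := (tendsto_iff_norm_sub_tendsto_zero.2 h1).norm.pow 2
  rw [mass_eq_norm_toLp_sq hf']
  exact h2.congr fun n => (mass_eq_norm_toLp_sq (hf n)).symm

lemma exists_subseq_tendsto_ae {f : ℕ → E d → ℂ} {f' : E d → ℂ}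
    (hf : ∀ n, MemLp (f n) 2 volume) (hf' : MemLp f' 2 volume)
    (h : Tendsto (fun n => mass (f n - f')) atTop (𝓝 0)) :
    ∃ σ : ℕ → ℕ, StrictMono σ ∧ ∀ᵐ x, Tendsto (fun n => f (σ n) x) atTop (𝓝 (f' x)) :=
  (tendstoInMeasure_of_tendsto_eLpNorm (by norm_num) (fun n => (hf n).1) hf'.1
    (tendsto_eLpNorm_of_mass hf hf' h)).exists_seq_tendsto_ae

/-- Real test functions are dense in `L²(ℝ^d; ℝ)`. -/
lemma exists_testFunction_near {g : E d → ℝ} (hg : MemLp g 2 volume) {ε : ℝ} (hε : 0 < ε) :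
    ∃ η : E d → ℝ, ContDiff ℝ (⊤ : ℕ∞) η ∧ HasCompactSupport η ∧ MemLp η 2 volume ∧
      ∫ x, (g x - η x) ^ 2 ≤ ε := by
  obtain ⟨η, h1, h2, h3⟩ := hg.exist_eLpNorm_sub_le (by norm_num) (by norm_num)
    (Real.sqrt_pos.2 hε)
  have h4 : MemLp η 2 volume := h2.continuous.memLp_of_hasCompactSupport h1
  refine ⟨η, h2, h1, h4, ?_⟩
  have h5 : MemLp (fun x => ((g x - η x : ℝ) : ℂ)) 2 volume := (hg.sub h4).ofReal
  rw [← mass_ofReal, mass_eq_toReal_sq h5]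
  have h6 : eLpNorm (fun x => ((g x - η x : ℝ) : ℂ)) 2 volume = eLpNorm (g - η) 2 volume :=
    eLpNorm_congr_norm_ae (ae_of_all _ fun x => by rw [Complex.norm_real]; rfl)
  rw [h6]
  calc _ ≤ (√ε) ^ 2 := by
        gcongr
        exact ENNReal.toReal_le_of_le_ofReal (Real.sqrt_nonneg _) h3
    _ = ε := Real.sq_sqrt hε.le

/-! ### Weak derivatives -/

lemma locallyIntegrable_of_memLp {f : E d → ℂ} (hf : MemLp f 2 volume) :
    LocallyIntegrable f volume := hf.locallyIntegrable (by norm_num)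

lemma continuous_fderiv_apply {η : E d → ℝ} (hη : ContDiff ℝ (⊤ : ℕ∞) η) (v : E d) :
    Continuous fun x => fderiv ℝ η x v :=
  (hη.continuous_fderiv (by simp)).clm_apply continuous_const

lemma hasCompactSupport_fderiv_apply {η : E d → ℝ} (hc : HasCompactSupport η) (v : E d) :
    HasCompactSupport fun x => fderiv ℝ η x v := hc.fderiv_apply ℝ v

lemma integrable_test_smul {f : E d → ℂ} (hf : LocallyIntegrable f volume) {η : E d → ℝ}
    (hη : Continuous η) (hc : HasCompactSupport η) : Integrable (fun x => η x • f x) volume :=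
  hf.integrable_smul_left_of_hasCompactSupport hη hc

lemma memLp_test {η : E d → ℝ} (hη : Continuous η) (hc : HasCompactSupport η) :
    MemLp η 2 volume := hη.memLp_of_hasCompactSupport hc

lemma HasWeakPartial.add {j : Fin d} {φ ψ g k : E d → ℂ} (hφ : LocallyIntegrable φ volume)
    (hψ : LocallyIntegrable ψ volume) (h : HasWeakPartial j φ g) (h' : HasWeakPartial j ψ k) :
    HasWeakPartial j (φ + ψ) (g + k) := by
  refine ⟨h.1.add h'.1, fun η hη hc => ?_⟩
  have c1 := continuous_fderiv_apply hη (EuclideanSpace.single j 1)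
  have c2 := hasCompactSupport_fderiv_apply hc (EuclideanSpace.single j 1)
  simp only [Pi.add_apply, smul_add]
  rw [integral_add (integrable_test_smul h.1 hη.continuous hc)
    (integrable_test_smul h'.1 hη.continuous hc), integral_add (integrable_test_smul hφ c1 c2)
    (integrable_test_smul hψ c1 c2), h.2 η hη hc, h'.2 η hη hc]
  ring

lemma HasWeakPartial.const_smul {j : Fin d} {φ g : E d → ℂ} (c : ℂ)
    (h : HasWeakPartial j φ g) : HasWeakPartial j (c • φ) (c • g) := by
  refine ⟨h.1.smul c, fun η hη hc => ?_⟩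
  simp only [Pi.smul_apply, smul_comm _ c, integral_smul]
  rw [h.2 η hη hc, smul_neg]

lemma HasWeakPartial.congr {j : Fin d} {φ ψ g k : E d → ℂ} (h : HasWeakPartial j φ g)
    (h1 : φ =ᵐ[volume] ψ) (h2 : g =ᵐ[volume] k) : HasWeakPartial j ψ k := by
  refine ⟨h.1.congr h2, fun η hη hc => ?_⟩
  have e1 : ∫ x, η x • k x = ∫ x, η x • g x :=
    integral_congr_ae (h2.symm.mono fun x hx => by simp only [hx])
  have e2 : ∫ x, fderiv ℝ η x (EuclideanSpace.single j 1) • φ x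
      = ∫ x, fderiv ℝ η x (EuclideanSpace.single j 1) • ψ x :=
    integral_congr_ae (h1.mono fun x hx => by simp only [hx])
  rw [e1, h.2 η hη hc, e2]

lemma HasWeakPartial.of_tendsto {j : Fin d} {f g : ℕ → E d → ℂ} {φ k : E d → ℂ}
    (hf : ∀ n, MemLp (f n) 2 volume) (hg : ∀ n, MemLp (g n) 2 volume)
    (hφ : MemLp φ 2 volume) (hk : MemLp k 2 volume) (h : ∀ n, HasWeakPartial j (f n) (g n))
    (h1 : Tendsto (fun n => mass (f n - φ)) atTop (𝓝 0))
    (h2 : Tendsto (fun n => mass (g n - k)) atTop (𝓝 0)) : HasWeakPartial j φ k := by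
  refine ⟨locallyIntegrable_of_memLp hk, fun η hη hc => ?_⟩
  have m1 : MemLp (fun x => (η x : ℂ)) 2 volume := (memLp_test hη.continuous hc).ofReal
  have m2 : MemLp (fun x => (fderiv ℝ η x (EuclideanSpace.single j 1) : ℂ)) 2 volume :=
    (memLp_test (continuous_fderiv_apply hη _) (hasCompactSupport_fderiv_apply hc _)).ofReal
  have t1 := tendsto_integral_mul hg hk m1 h2
  have t2 := (tendsto_integral_mul hf hφ m2 h1).neg
  refine tendsto_nhds_unique t1 (t2.congr fun n => ?_)
  exact ((h n).2 η hη hc).symm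

lemma MemH1.hasWeakPartial {φ : E d → ℂ} (h : MemH1 φ) (j : Fin d) :
    HasWeakPartial j φ (weakPartial j φ) := by
  obtain ⟨g, _, hg⟩ := h.2 j
  exact hg.congr (ae_eq_refl _) hg.weakPartial_ae_eq.symm

lemma MemH1.memLp_weakPartial {φ : E d → ℂ} (h : MemH1 φ) (j : Fin d) :
    MemLp (weakPartial j φ) 2 volume := by
  obtain ⟨g, hg', hg⟩ := h.2 j
  exact hg'.ae_eq hg.weakPartial_ae_eq.symm

lemma MemH1.add {φ ψ : E d → ℂ} (hφ : MemH1 φ) (hψ : MemH1 ψ) : MemH1 (φ + ψ) :=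
  ⟨hφ.1.add hψ.1, fun j => ⟨_, (hφ.memLp_weakPartial j).add (hψ.memLp_weakPartial j),
    HasWeakPartial.add (locallyIntegrable_of_memLp hφ.1) (locallyIntegrable_of_memLp hψ.1)
      (hφ.hasWeakPartial j) (hψ.hasWeakPartial j)⟩⟩

lemma MemH1.const_smul {φ : E d → ℂ} (c : ℂ) (hφ : MemH1 φ) : MemH1 (c • φ) :=
  ⟨hφ.1.const_smul c, fun j => ⟨_, (hφ.memLp_weakPartial j).const_smul c,
    (hφ.hasWeakPartial j).const_smul c⟩⟩

lemma MemH1.sub {φ ψ : E d → ℂ} (hφ : MemH1 φ) (hψ : MemH1 ψ) : MemH1 (φ - ψ) := by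
  simpa [sub_eq_add_neg] using hφ.add (hψ.const_smul (-1))

lemma weakPartial_add {φ ψ : E d → ℂ} (hφ : MemH1 φ) (hψ : MemH1 ψ) (j : Fin d) :
    weakPartial j (φ + ψ) =ᵐ[volume] weakPartial j φ + weakPartial j ψ :=
  (HasWeakPartial.add (locallyIntegrable_of_memLp hφ.1) (locallyIntegrable_of_memLp hψ.1)
      (hφ.hasWeakPartial j) (hψ.hasWeakPartial j)).weakPartial_ae_eq

lemma weakPartial_const_smul {φ : E d → ℂ} (hφ : MemH1 φ) (c : ℂ) (j : Fin d) :
    weakPartial j (c • φ) =ᵐ[volume] c • weakPartial j φ :=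
  ((hφ.hasWeakPartial j).const_smul c).weakPartial_ae_eq

lemma weakPartial_sub {φ ψ : E d → ℂ} (hφ : MemH1 φ) (hψ : MemH1 ψ) (j : Fin d) :
    weakPartial j (φ - ψ) =ᵐ[volume] weakPartial j φ - weakPartial j ψ := by
  have h := HasWeakPartial.add (locallyIntegrable_of_memLp hφ.1)
    (locallyIntegrable_of_memLp (hψ.1.const_smul (-1))) (hφ.hasWeakPartial j)
    ((hψ.hasWeakPartial j).const_smul (-1))
  simpa [sub_eq_add_neg] using h.weakPartial_ae_eq

/-- The product rule with a test function. -/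
lemma MemH1.hasWeakPartial_mul {φ : E d → ℂ} (hφ : MemH1 φ) {w : E d → ℝ}
    (hw : ContDiff ℝ (⊤ : ℕ∞) w) (hwc : HasCompactSupport w) (j : Fin d) :
    HasWeakPartial j (fun x => w x • φ x)
      (fun x => w x • weakPartial j φ x + fderiv ℝ w x (EuclideanSpace.single j 1) • φ x) := by
  have l1 := locallyIntegrable_of_memLp hφ.1
  have l2 := (hφ.hasWeakPartial j).1
  have c1 := continuous_fderiv_apply hw (EuclideanSpace.single j 1)
  have c2 := hasCompactSupport_fderiv_apply hwc (EuclideanSpace.single j 1)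
  refine ⟨((integrable_test_smul l2 hw.continuous hwc).add
    (integrable_test_smul l1 c1 c2)).locallyIntegrable, fun η hη hc => ?_⟩
  have h := (hφ.hasWeakPartial j).2 (fun x => η x * w x) (hη.mul hw) (hc.mul_right)
  have hd : ∀ x, fderiv ℝ (fun x => η x * w x) x (EuclideanSpace.single j 1)
      = η x * fderiv ℝ w x (EuclideanSpace.single j 1)
        + w x * fderiv ℝ η x (EuclideanSpace.single j 1) := fun x => by
    rw [fderiv_fun_mul (hη.differentiable (by simp) x) (hw.differentiable (by simp) x)]
    simp
  have i1 : Integrable (fun x => (η x * w x) • weakPartial j φ x) volume :=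
    integrable_test_smul l2 (hη.continuous.mul hw.continuous) hc.mul_right
  have i2 : Integrable (fun x => (η x * fderiv ℝ w x (EuclideanSpace.single j 1)) • φ x) volume :=
    integrable_test_smul l1 (hη.continuous.mul c1) hc.mul_right
  have i3 : Integrable (fun x => (w x * fderiv ℝ η x (EuclideanSpace.single j 1)) • φ x) volume :=
    integrable_test_smul l1 (hw.continuous.mul (continuous_fderiv_apply hη _)) hwc.mul_right
  simp only [hd, add_smul] at h
  rw [integral_add i2 i3] at h
  simp only [smul_add, smul_smul]
  rw [integral_add i1 i2, h]
  simp only [mul_comm (w _)]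
  ring

lemma MemH1.mul_test {φ : E d → ℂ} (hφ : MemH1 φ) {w : E d → ℝ}
    (hw : ContDiff ℝ (⊤ : ℕ∞) w) (hwc : HasCompactSupport w) :
    MemH1 (fun x => w x • φ x) := by
  have key : ∀ (u : E d → ℝ), Continuous u → HasCompactSupport u → ∀ f : E d → ℂ,
      MemLp f 2 volume → MemLp (fun x => u x • f x) 2 volume := fun u hu huc f hf => by
    obtain ⟨C, hC⟩ := hu.bounded_above_of_compact_support huc
    refine (hf.norm.const_mul C).of_le (hu.aestronglyMeasurable.smul hf.1)
      (ae_of_all _ fun x => ?_)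
    rw [norm_smul, norm_mul, norm_norm]
    gcongr
    exact (hC x).trans (Real.le_norm_self C)
  exact ⟨key w hw.continuous hwc φ hφ.1, fun j => ⟨_, (key w hw.continuous hwc _
    (hφ.memLp_weakPartial j)).add (key _ (continuous_fderiv_apply hw _)
      (hasCompactSupport_fderiv_apply hwc _) φ hφ.1), hφ.hasWeakPartial_mul hw hwc j⟩⟩

/-! ### Translations of `H¹` functions -/

/-- The weak directional derivative `h · ∇φ`. -/
def dirPartial (h : E d) (φ : E d → ℂ) : E d → ℂ := fun x => ∑ j, h j • weakPartial j φ x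

lemma MemH1.memLp_dirPartial {φ : E d → ℂ} (hφ : MemH1 φ) (h : E d) :
    MemLp (dirPartial h φ) 2 volume :=
  memLp_finsetSum _ fun j _ => (hφ.memLp_weakPartial j).const_smul (h j)

lemma MemH1.mass_dirPartial_le {φ : E d → ℂ} (hφ : MemH1 φ) (h : E d) :
    mass (dirPartial h φ) ≤ ‖h‖ ^ 2 * ∑ j, mass (weakPartial j φ) := by
  simp only [mass]
  rw [← integral_finsetSum _ fun j _ => integrable_normSq (hφ.memLp_weakPartial j),
    ← integral_const_mul]
  refine integral_mono (integrable_normSq (hφ.memLp_dirPartial h))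
    ((integrable_finsetSum _ fun j _ =>
      integrable_normSq (hφ.memLp_weakPartial j)).const_mul _) fun x => ?_
  rw [EuclideanSpace.norm_sq_eq]
  calc ‖∑ j, h j • weakPartial j φ x‖ ^ 2 ≤ (∑ j, ‖h j‖ * ‖weakPartial j φ x‖) ^ 2 := by
        gcongr
        refine (norm_sum_le _ _).trans_eq ?_
        simp only [norm_smul]
    _ ≤ _ := Finset.sum_mul_sq_le_sq_mul_sq _ _ _

lemma integral_test_smul_dirPartial {φ : E d → ℂ} (hφ : MemH1 φ) (h : E d) {η : E d → ℝ}
    (hη : ContDiff ℝ (⊤ : ℕ∞) η) (hc : HasCompactSupport η) :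
    ∫ x, η x • dirPartial h φ x = - ∫ x, fderiv ℝ η x h • φ x := by
  have hh : ∀ x, fderiv ℝ η x h = ∑ j, h j * fderiv ℝ η x (EuclideanSpace.single j 1) := by
    intro x
    conv_lhs => rw [← (EuclideanSpace.basisFun (Fin d) ℝ).sum_repr h]
    simp [map_sum]
  have l1 := locallyIntegrable_of_memLp hφ.1
  simp only [hh, dirPartial, Finset.smul_sum, Finset.sum_smul, mul_smul, smul_comm (η _)]
  rw [integral_finsetSum, integral_finsetSum, ← Finset.sum_neg_distrib]
  · refine Finset.sum_congr rfl fun j _ => ?_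
    rw [integral_smul, integral_smul, (hφ.hasWeakPartial j).2 η hη hc, smul_neg]
  · exact fun j _ => (integrable_test_smul l1 (continuous_fderiv_apply hη _)
      (hasCompactSupport_fderiv_apply hc _)).smul (h j)
  · exact fun j _ => (integrable_test_smul (hφ.hasWeakPartial j).1 hη.continuous hc).smul (h j)

/-- Differentiating the pairing of an `H¹` function with a moving test function. -/
lemma MemH1.hasDerivAt_pairing {φ : E d → ℂ} (hφ : MemH1 φ) (h : E d) {η : E d → ℝ}
    (hη : ContDiff ℝ (⊤ : ℕ∞) η) (hc : HasCompactSupport η) (s : ℝ) :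
    HasDerivAt (fun s : ℝ => ∫ x, η (x - s • h) • φ x)
      (∫ x, η (x - s • h) • dirPartial h φ x) s := by
  set g : E d → ℝ := fun x => η (-x) with hg
  have hgd : ContDiff ℝ (⊤ : ℕ∞) g := hη.comp contDiff_neg
  have hgc : HasCompactSupport g := hc.comp_homeomorph (Homeomorph.neg (E d))
  let L : ℂ →L[ℝ] ℝ →L[ℝ] ℂ := (ContinuousLinearMap.lsmul ℝ ℝ).flip
  have l1 := locallyIntegrable_of_memLp hφ.1
  have hF := hgc.hasFDerivAt_convolution_right L l1 (hgd.of_le (by simp)) (s • h)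
  have hline : HasDerivAt (fun s : ℝ => s • h) h s := by
    simpa using (hasDerivAt_id s).smul_const h
  have hD := hF.comp_hasDerivAt s hline
  rw [convolution_precompR_apply L l1 (hgc.fderiv ℝ) (hgd.continuous_fderiv (by simp))] at hD
  have e1 : ((convolution φ g L volume) ∘ fun s : ℝ => s • h)
      = fun s : ℝ => ∫ x, η (x - s • h) • φ x := by
    funext t
    simp [convolution_def, L, hg]
  rw [e1] at hD
  have hη' : ContDiff ℝ (⊤ : ℕ∞) fun x => η (x - s • h) := hη.comp (contDiff_id.sub contDiff_const)
  have hc' : HasCompactSupport fun x => η (x - s • h) := by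
    simpa [sub_eq_add_neg, Function.comp_def] using
      hc.comp_homeomorph (Homeomorph.addRight (-(s • h)))
  refine hD.congr_deriv ?_
  rw [integral_test_smul_dirPartial hφ h hη' hc', convolution_def, ← integral_neg]
  refine integral_congr_ae (ae_of_all _ fun x => ?_)
  have e2 : fderiv ℝ g (s • h - x) h = - fderiv ℝ η (x - s • h) h := by
    have h1 : HasFDerivAt η (fderiv ℝ η (-(s • h - x))) (-(s • h - x)) :=
      (hη.differentiable (by simp) _).hasFDerivAt
    have h2 := (h1.comp (s • h - x) (hasFDerivAt_id (s • h - x)).neg).fderiv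
    have h3 : fderiv ℝ g (s • h - x) = _ := h2
    rw [h3]
    simp
  have e3 : fderiv ℝ (fun x => η (x - s • h)) x h = fderiv ℝ η (x - s • h) h := by
    rw [fderiv_comp_sub]
  simp only [e3]
  change fderiv ℝ g (s • h - x) h • φ x = _
  rw [e2, neg_smul]

lemma memLp_comp_sub {F : Type*} [NormedAddCommGroup F] {f : E d → F} {p : ENNReal}
    (hf : MemLp f p volume) (v : E d) : MemLp (fun x => f (x - v)) p volume :=
  hf.comp_measurePreserving (measurePreserving_sub_right volume v)

lemma memLp_comp_add {F : Type*} [NormedAddCommGroup F] {f : E d → F} {p : ENNReal}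
    (hf : MemLp f p volume) (v : E d) : MemLp (fun x => f (x + v)) p volume :=
  hf.comp_measurePreserving (measurePreserving_add_right volume v)

lemma integrable_real_smul {ρ : E d → ℝ} {f : E d → ℂ} (hρ : MemLp ρ 2 volume)
    (hf : MemLp f 2 volume) : Integrable (fun x => ρ x • f x) volume :=
  integrable_mul_of_memLp (hρ.ofReal (K := ℂ)) hf

lemma norm_integral_translate_smul_sq_le {ρ : E d → ℝ} {f : E d → ℂ} (hρ : MemLp ρ 2 volume)
    (hf : MemLp f 2 volume) (v : E d) :
    ‖∫ x, ρ (x - v) • f x‖ ^ 2 ≤ (∫ x, ρ x ^ 2) * mass f := by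
  rw [← integral_sub_right_eq_self (fun x => ρ x ^ 2) v]
  exact norm_integral_smul_sq_le (memLp_comp_sub hρ v) hf

/-- A sequence of real test functions converging in `L²` to a given real function. -/
lemma exists_testSeq {ρ : E d → ℝ} (hρ : MemLp ρ 2 volume) :
    ∃ η : ℕ → E d → ℝ, (∀ n, ContDiff ℝ (⊤ : ℕ∞) (η n)) ∧ (∀ n, HasCompactSupport (η n)) ∧
      Tendsto (fun n => ∫ x, (η n x - ρ x) ^ 2) atTop (𝓝 0) := by
  choose η h1 h2 _ h4 using fun n : ℕ =>
    exists_testFunction_near hρ (ε := 1 / ((n : ℝ) + 1)) (by positivity)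
  refine ⟨η, h1, h2, squeeze_zero (fun n => integral_nonneg fun _ => by positivity)
    (fun n => ?_) tendsto_one_div_add_atTop_nhds_zero_nat⟩
  simpa only [sub_sq_comm] using h4 n

lemma MemH1.hasDerivAt_pairing_real {φ : E d → ℂ} (hφ : MemH1 φ) (h : E d) {ρ : E d → ℝ}
    (hρ : MemLp ρ 2 volume) (s : ℝ) :
    HasDerivAt (fun s : ℝ => ∫ x, ρ (x - s • h) • φ x)
      (∫ x, ρ (x - s • h) • dirPartial h φ x) s := by
  obtain ⟨η, h1, h2, h3⟩ := exists_testSeq hρ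
  have hη : ∀ n, MemLp (η n) 2 volume := fun n => memLp_test (h1 n).continuous (h2 n)
  -- the pairings with the approximating test functions converge uniformly in the translation
  have key : ∀ f : E d → ℂ, MemLp f 2 volume → ∀ n (t : ℝ),
      ‖(∫ x, ρ (x - t • h) • f x) - ∫ x, η n (x - t • h) • f x‖
        ≤ √((∫ x, (η n x - ρ x) ^ 2) * mass f) := fun f hf n t => by
    refine Real.le_sqrt_of_sq_le ?_
    rw [norm_sub_rev, ← integral_sub]
    · have := norm_integral_translate_smul_sq_le ((hη n).sub hρ) hf (t • h)
      simpa only [Pi.sub_apply, sub_smul] using this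
    · exact integrable_real_smul (memLp_comp_sub (hη n) (t • h)) hf
    · exact integrable_real_smul (memLp_comp_sub hρ (t • h)) hf
  have lim : ∀ f : E d → ℂ, Tendsto (fun n => √((∫ x, (η n x - ρ x) ^ 2) * mass f))
      atTop (𝓝 0) := fun f => by simpa using (h3.mul_const (mass f)).sqrt
  refine hasDerivAt_of_tendstoUniformly (l := atTop)
    (f := fun n (s : ℝ) => ∫ x, η n (x - s • h) • φ x)
    (f' := fun n (s : ℝ) => ∫ x, η n (x - s • h) • dirPartial h φ x)
    (g' := fun (s : ℝ) => ∫ x, ρ (x - s • h) • dirPartial h φ x) ?_ ?_ ?_ s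
  · rw [Metric.tendstoUniformly_iff]
    intro ε hε
    filter_upwards [(lim (dirPartial h φ)).eventually_lt_const hε] with n hn t
    rw [dist_eq_norm]
    exact (key _ (hφ.memLp_dirPartial h) n t).trans_lt hn
  · exact Eventually.of_forall fun n t => hφ.hasDerivAt_pairing h (h1 n) (h2 n) t
  · intro t
    rw [tendsto_iff_norm_sub_tendsto_zero]
    refine squeeze_zero (fun _ => norm_nonneg _) (fun n => ?_) (lim φ)
    rw [norm_sub_rev]
    exact key _ hφ.1 n t

lemma MemH1.hasDerivAt_pairing_complex {φ : E d → ℂ} (hφ : MemH1 φ) (h : E d) {g : E d → ℂ}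
    (hg : MemLp g 2 volume) (s : ℝ) :
    HasDerivAt (fun s : ℝ => ∫ x, g (x - s • h) * φ x)
      (∫ x, g (x - s • h) * dirPartial h φ x) s := by
  have h1 : MemLp (fun x => (g x).re) 2 volume := hg.re
  have h2 : MemLp (fun x => (g x).im) 2 volume := hg.im
  have key : ∀ f : E d → ℂ, MemLp f 2 volume → ∀ t : ℝ, ∫ x, g (x - t • h) * f x
      = (∫ x, (g (x - t • h)).re • f x) + Complex.I * ∫ x, (g (x - t • h)).im • f x :=
    fun f hf t => by
      rw [← integral_const_mul, ← integral_add]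
      · refine integral_congr_ae (ae_of_all _ fun x => ?_)
        simp only [Complex.real_smul]
        conv_lhs => rw [← Complex.re_add_im (g (x - t • h))]
        ring
      · exact integrable_real_smul (memLp_comp_sub h1 (t • h)) hf
      · exact (integrable_real_smul (memLp_comp_sub h2 (t • h)) hf).const_mul _
  simp only [key _ hφ.1, key _ (hφ.memLp_dirPartial h)]
  exact (hφ.hasDerivAt_pairing_real h h1 s).add
    ((hφ.hasDerivAt_pairing_real h h2 s).const_mul Complex.I)

lemma dirPartial_single (j : Fin d) (φ : E d → ℂ) :
    dirPartial (EuclideanSpace.single j 1) φ = weakPartial j φ := by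
  funext x
  rw [dirPartial, Finset.sum_eq_single j]
  · simp
  · intro i _ hij
    simp [hij]
  · simp

/-- Integration by parts for two `H¹` functions: both sides are derivatives at `0` of
`s ↦ ∫ g(x - s e_j) f(x) dx`. -/
lemma MemH1.integral_mul_weakPartial {f g : E d → ℂ} (hf : MemH1 f) (hg : MemH1 g) (j : Fin d) :
    ∫ x, g x * weakPartial j f x = - ∫ x, weakPartial j g x * f x := by
  set e : E d := EuclideanSpace.single j 1
  have h1 := hf.hasDerivAt_pairing_complex e hg.1 0
  have h2 := hg.hasDerivAt_pairing_complex e hf.1 (-0)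
  have h3 := h2.scomp (0 : ℝ) (hasDerivAt_neg (0 : ℝ))
  have e1 : ((fun s : ℝ => ∫ x, f (x - s • e) * g x) ∘ fun s : ℝ => -s)
      = fun s : ℝ => ∫ x, g (x - s • e) * f x := by
    funext s
    simp only [Function.comp]
    rw [← integral_sub_right_eq_self _ (s • e)]
    refine integral_congr_ae (ae_of_all _ fun x => ?_)
    simp only [neg_smul, sub_neg_eq_add, sub_add_cancel]
    ring
  have h4 : HasDerivAt (fun s : ℝ => ∫ x, g (x - s • e) * f x) _ 0 := e1 ▸ h3
  have h5 := h1.unique h4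
  simp only [neg_zero, zero_smul, sub_zero, e, dirPartial_single] at h5
  rw [h5]
  simp only [neg_smul, one_smul, mul_comm]

/-- An `L²` function is controlled by its pairings with real test functions. -/
lemma mass_le_of_test {u : E d → ℂ} (hu : MemLp u 2 volume) {K : ℝ} (hK : 0 ≤ K)
    (h : ∀ η : E d → ℝ, ContDiff ℝ (⊤ : ℕ∞) η → HasCompactSupport η →
      ‖∫ x, η x • u x‖ ^ 2 ≤ (∫ x, η x ^ 2) * K) : mass u ≤ 2 * K := by
  have ext : ∀ ρ : E d → ℝ, MemLp ρ 2 volume → ‖∫ x, ρ x • u x‖ ^ 2 ≤ (∫ x, ρ x ^ 2) * K := by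
    intro ρ hρ
    obtain ⟨η, h1, h2, h3⟩ := exists_testSeq hρ
    have hη : ∀ n, MemLp (η n) 2 volume := fun n => memLp_test (h1 n).continuous (h2 n)
    have h3' : Tendsto (fun n => mass ((fun x => (η n x : ℂ)) - fun x => (ρ x : ℂ)))
        atTop (𝓝 0) := by
      refine h3.congr fun n => ?_
      rw [← mass_ofReal]
      simp [mass]
    have t1 := tendsto_integral_mul (fun n => (hη n).ofReal (K := ℂ)) (hρ.ofReal (K := ℂ)) hu h3'
    have t2 := tendsto_mass (fun n => (hη n).ofReal (K := ℂ)) (hρ.ofReal (K := ℂ)) h3'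
    have t3 := le_of_tendsto_of_tendsto' (t1.norm.pow 2) (t2.mul_const K) fun n => by
      have := h (η n) (h1 n) (h2 n)
      rw [← mass_ofReal] at this
      simp only [Complex.real_smul, mul_comm] at this ⊢
      exact this
    rw [← mass_ofReal]
    simp only [Complex.real_smul, mul_comm] at t3 ⊢
    exact t3
  have bound : ∀ (ρ : E d → ℝ), MemLp ρ 2 volume → ∫ x, ρ x ^ 2 ≤ ‖∫ x, ρ x • u x‖ →
      ∫ x, ρ x ^ 2 ≤ K := fun ρ hρ hle => by
    have h0 : 0 ≤ ∫ x, ρ x ^ 2 := integral_nonneg fun _ => by positivity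
    have h1 := ext ρ hρ
    rcases h0.eq_or_lt with h2 | h2
    · rwa [← h2]
    · nlinarith [norm_nonneg (∫ x, ρ x • u x)]
  have hre : MemLp (fun x => (u x).re) 2 volume := hu.re
  have him : MemLp (fun x => (u x).im) 2 volume := hu.im
  have ire := integrable_real_smul hre hu
  have iim := integrable_real_smul him hu
  have b1 := bound _ hre (by
    refine le_trans (le_of_eq ?_) (Complex.re_le_norm _)
    refine Eq.trans ?_ (integral_re ire)
    simp [sq])
  have b2 := bound _ him (by
    refine le_trans (le_of_eq ?_) (Complex.im_le_norm _)
    refine Eq.trans ?_ (integral_im iim)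
    simp [sq])
  have : mass u = (∫ x, (u x).re ^ 2) + ∫ x, (u x).im ^ 2 := by
    rw [← integral_add hre.integrable_sq him.integrable_sq]
    refine integral_congr_ae (ae_of_all _ fun x => ?_)
    simp only [Complex.sq_norm, Complex.normSq_apply]
    ring
  linarith

/-- The translation estimate for `H¹` functions. -/
lemma MemH1.mass_translate_sub_le {φ : E d → ℂ} (hφ : MemH1 φ) (h : E d) :
    mass (fun x => φ (x + h) - φ x) ≤ 2 * (‖h‖ ^ 2 * ∑ j, mass (weakPartial j φ)) := by
  have hu : MemLp (fun x => φ (x + h) - φ x) 2 volume := (memLp_comp_add hφ.1 h).sub hφ.1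
  refine (mass_le_of_test hu (mass_nonneg _) fun η hη hc => ?_).trans
    (mul_le_mul_of_nonneg_left (hφ.mass_dirPartial_le h) (by norm_num))
  have hη2 := memLp_test hη.continuous hc
  have e1 : ∫ x, η x • (φ (x + h) - φ x)
      = (∫ x, η (x - (1 : ℝ) • h) • φ x) - ∫ x, η (x - (0 : ℝ) • h) • φ x := by
    rw [← integral_add_right_eq_self (fun x => η (x - (1 : ℝ) • h) • φ x) h]
    simp only [one_smul, zero_smul, sub_zero, add_sub_cancel_right, smul_sub]
    exact integral_sub (integrable_real_smul hη2 (memLp_comp_add hφ.1 h))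
      (integrable_real_smul hη2 hφ.1)
  have h2 := norm_image_sub_le_of_norm_deriv_le_segment_01'
    (C := √((∫ x, η x ^ 2) * mass (dirPartial h φ)))
    (fun s _ => (hφ.hasDerivAt_pairing h hη hc s).hasDerivWithinAt)
    (fun s _ => Real.le_sqrt_of_sq_le
      (norm_integral_translate_smul_sq_le hη2 (hφ.memLp_dirPartial h) (s • h)))
  rw [← e1] at h2
  calc _ ≤ √((∫ x, η x ^ 2) * mass (dirPartial h φ)) ^ 2 := by gcongr
    _ = _ := Real.sq_sqrt (mul_nonneg (integral_nonneg fun _ => by positivity) (mass_nonneg _))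

/-! ### Averages over balls -/

/-- The average of `f` over the ball of radius `δ` around `x`. -/
def ballAvg (δ : ℝ) (f : E d → ℂ) (x : E d) : ℂ := ⨍ z in Metric.ball (0 : E d) δ, f (x + z)

lemma enorm_integral_rpow_le {α : Type*} [MeasurableSpace α] {ν : Measure α}
    [IsProbabilityMeasure ν] {f : α → ℂ} (hf : AEStronglyMeasurable f ν) {r : ℝ} (hr : 1 ≤ r) :
    ‖∫ x, f x ∂ν‖ₑ ^ r ≤ ∫⁻ x, ‖f x‖ₑ ^ r ∂ν := by
  have hr0 : 0 < r := by linarith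
  have h1 : ‖∫ x, f x ∂ν‖ₑ ≤ eLpNorm f 1 ν := by
    rw [eLpNorm_one_eq_lintegral_enorm]
    exact enorm_integral_le_lintegral_enorm f
  have h2 : eLpNorm f 1 ν ≤ eLpNorm f (ENNReal.ofReal r) ν :=
    eLpNorm_le_eLpNorm_of_exponent_le (by simp [hr]) hf
  rw [eLpNorm_eq_lintegral_rpow_enorm_toReal (p := ENNReal.ofReal r) (by simpa using hr0) (by simp),
    ENNReal.toReal_ofReal hr0.le] at h2
  calc _ ≤ ((∫⁻ x, ‖f x‖ₑ ^ r ∂ν) ^ (1 / r)) ^ r := by gcongr; exact h1.trans h2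
    _ = _ := by rw [← ENNReal.rpow_mul, one_div_mul_cancel hr0.ne', ENNReal.rpow_one]

lemma volume_ball_ne_zero {δ : ℝ} (hδ : 0 < δ) : volume (Metric.ball (0 : E d) δ) ≠ 0 :=
  (Metric.measure_ball_pos volume 0 hδ).ne'

lemma volume_ball_ne_top (δ : ℝ) : volume (Metric.ball (0 : E d) δ) ≠ ⊤ := measure_ball_lt_top.ne

lemma aestronglyMeasurable_shift {f : E d → ℂ} (hf : AEStronglyMeasurable f volume) (x : E d) :
    AEStronglyMeasurable (fun z => f (x + z)) volume :=
  hf.comp_quasiMeasurePreserving (measurePreserving_add_left volume x).quasiMeasurePreserving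

/-- Jensen's inequality for averages over balls. -/
lemma enorm_average_rpow_le {δ : ℝ} (hδ : 0 < δ) {f : E d → ℂ}
    (hf : AEStronglyMeasurable f volume) {r : ℝ} (hr : 1 ≤ r) :
    ‖⨍ z in Metric.ball (0 : E d) δ, f z‖ₑ ^ r
      ≤ (volume (Metric.ball (0 : E d) δ))⁻¹ * ∫⁻ z in Metric.ball (0 : E d) δ, ‖f z‖ₑ ^ r := by
  have hp : IsProbabilityMeasure ((volume (Metric.ball (0 : E d) δ))⁻¹ •
      (volume : Measure (E d)).restrict (Metric.ball 0 δ)) :=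
    ⟨by simp [ENNReal.inv_mul_cancel (volume_ball_ne_zero (d := d) hδ) (volume_ball_ne_top δ)]⟩
  have := enorm_integral_rpow_le (ν := (volume (Metric.ball (0 : E d) δ))⁻¹ •
    (volume : Measure (E d)).restrict (Metric.ball 0 δ)) (f := f)
    (hf.restrict.smul_measure _) hr
  rw [lintegral_smul_measure] at this
  simpa [average] using this

lemma aestronglyMeasurable_shift_prod {f : E d → ℂ} (hf : AEStronglyMeasurable f volume)
    (s : Set (E d)) : AEStronglyMeasurable (fun p : E d × E d => f (p.1 + p.2))
      ((volume : Measure (E d)).prod (volume.restrict s)) := by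
  have h1 : Measure.QuasiMeasurePreserving (fun p : E d × E d => p.1 + p.2)
      ((volume : Measure (E d)).prod volume) volume :=
    Measure.quasiMeasurePreserving_snd.comp
      (measurePreserving_prod_add (volume : Measure (E d)) volume).quasiMeasurePreserving
  have h2 := hf.comp_quasiMeasurePreserving h1
  have h3 : (volume : Measure (E d)).prod (volume.restrict s)
      = (volume.prod volume).restrict (Set.univ ×ˢ s) := by
    rw [← Measure.prod_restrict, Measure.restrict_univ]
  rw [h3]
  exact h2.restrict

lemma aestronglyMeasurable_ballAvg {f : E d → ℂ} (hf : AEStronglyMeasurable f volume) (δ : ℝ) :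
    AEStronglyMeasurable (ballAvg δ f) volume := by
  have := (aestronglyMeasurable_shift_prod hf (Metric.ball 0 δ)).integral_prod_right'
  have e : ballAvg δ f = fun x => (volume.real (Metric.ball (0 : E d) δ))⁻¹ •
      ∫ z in Metric.ball 0 δ, f (x + z) := funext fun x => setAverage_eq _ _ _
  rw [e]
  exact AEStronglyMeasurable.const_smul this (volume.real (Metric.ball (0 : E d) δ))⁻¹

lemma enorm_ballAvg_rpow_le {δ : ℝ} (hδ : 0 < δ) {f : E d → ℂ}
    (hf : AEStronglyMeasurable f volume) {r : ℝ} (hr : 1 ≤ r) (x : E d) :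
    ‖ballAvg δ f x‖ₑ ^ r
      ≤ (volume (Metric.ball (0 : E d) δ))⁻¹ * ∫⁻ z, ‖f z‖ₑ ^ r := by
  refine (enorm_average_rpow_le hδ (aestronglyMeasurable_shift hf x) hr).trans ?_
  refine mul_le_mul' le_rfl ?_
  rw [← lintegral_add_left_eq_self (fun z => ‖f z‖ₑ ^ r) x]
  exact setLIntegral_le_lintegral _ _

lemma ballAvg_sub {δ : ℝ} {f g : E d → ℂ} (hf : MemLp f 2 volume) (hg : MemLp g 2 volume)
    (x : E d) : ballAvg δ (f - g) x = ballAvg δ f x - ballAvg δ g x := by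
  have key : ∀ f : E d → ℂ, MemLp f 2 volume →
      IntegrableOn (fun z => f (x + z)) (Metric.ball 0 δ) volume := fun f hf => by
    have h := hf.comp_measurePreserving (measurePreserving_add_left volume x)
    have h' : MemLp (fun z => f (x + z)) 2 volume := h
    have : IsFiniteMeasure (volume.restrict (Metric.ball (0 : E d) δ)) :=
      ⟨by simpa using (volume_ball_ne_top (d := d) δ).lt_top⟩
    exact (h'.restrict _).integrable (by norm_num)
  simp only [ballAvg, setAverage_eq, Pi.sub_apply]
  rw [integral_sub (key f hf) (key g hg), smul_sub]

/-- An `H¹` function is close in `L²` to its averages over small balls. -/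
lemma MemH1.lintegral_sub_ballAvg_le {φ : E d → ℂ} (hφ : MemH1 φ) {δ : ℝ} (hδ : 0 < δ) :
    ∫⁻ x, ‖φ x - ballAvg δ φ x‖ₑ ^ (2 : ℝ)
      ≤ ENNReal.ofReal (2 * (δ ^ 2 * ∑ j, mass (weakPartial j φ))) := by
  set B := Metric.ball (0 : E d) δ
  set K := ENNReal.ofReal (2 * (δ ^ 2 * ∑ j, mass (weakPartial j φ)))
  have hB0 : volume B ≠ 0 := volume_ball_ne_zero hδ
  have hBt : volume B ≠ ⊤ := volume_ball_ne_top δ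
  have hsub : ∀ x, MemLp (fun z => φ (x + z)) 2 volume := fun x =>
    hφ.1.comp_measurePreserving (measurePreserving_add_left volume x)
  have : IsFiniteMeasure (volume.restrict B) := ⟨by simpa using hBt.lt_top⟩
  have h1 : ∀ x, ‖φ x - ballAvg δ φ x‖ₑ ^ (2 : ℝ)
      ≤ (volume B)⁻¹ * ∫⁻ z in B, ‖φ x - φ (x + z)‖ₑ ^ (2 : ℝ) := fun x => by
    have e : φ x - ballAvg δ φ x = ⨍ z in B, (φ x - φ (x + z)) := by
      rw [ballAvg, setAverage_eq, setAverage_eq, integral_sub (integrable_const _)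
        (((hsub x).restrict _).integrable (by norm_num)), smul_sub]
      congr 1
      have hr : volume.real B ≠ 0 := (ENNReal.toReal_pos hB0 hBt).ne'
      simp [hr]
    rw [e]
    exact enorm_average_rpow_le hδ
      (aestronglyMeasurable_const.sub (aestronglyMeasurable_shift hφ.1.1 x)) (by norm_num)
  have hm : AEStronglyMeasurable (fun p : E d × E d => φ p.1 - φ (p.1 + p.2))
      ((volume : Measure (E d)).prod (volume.restrict B)) :=
    hφ.1.1.comp_fst.sub (aestronglyMeasurable_shift_prod hφ.1.1 B)
  calc ∫⁻ x, ‖φ x - ballAvg δ φ x‖ₑ ^ (2 : ℝ)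
      ≤ ∫⁻ x, (volume B)⁻¹ * ∫⁻ z in B, ‖φ x - φ (x + z)‖ₑ ^ (2 : ℝ) := lintegral_mono h1
    _ = (volume B)⁻¹ * ∫⁻ x, ∫⁻ z in B, ‖φ x - φ (x + z)‖ₑ ^ (2 : ℝ) :=
        lintegral_const_mul' _ _ (ENNReal.inv_ne_top.2 hB0)
    _ = (volume B)⁻¹ * ∫⁻ z in B, ∫⁻ x, ‖φ x - φ (x + z)‖ₑ ^ (2 : ℝ) := by
        rw [lintegral_lintegral_swap]
        exact hm.enorm.pow_const _
    _ ≤ (volume B)⁻¹ * ∫⁻ _z in B, K := by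
        gcongr (volume B)⁻¹ * ?_
        refine setLIntegral_mono measurable_const fun z hz => ?_
        have h2 : MemLp (fun x => φ (x + z) - φ x) 2 volume := (memLp_comp_add hφ.1 z).sub hφ.1
        simp only [enorm_sub_rev (φ _) (φ (_ + z))]
        rw [← ofReal_mass h2]
        refine ENNReal.ofReal_le_ofReal ((hφ.mass_translate_sub_le z).trans ?_)
        have : ‖z‖ ≤ δ := by simpa [B] using (mem_ball_zero_iff.1 hz).le
        have : 0 ≤ ∑ j, mass (weakPartial j φ) := Finset.sum_nonneg fun j _ => mass_nonneg _
        gcongr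
    _ = K := by
        rw [setLIntegral_const, mul_comm K, ← mul_assoc, ENNReal.inv_mul_cancel hB0 hBt, one_mul]

/-! ### The Sobolev embedding -/

lemma volume_ball_eq {δ : ℝ} (hδ : 0 < δ) : volume (Metric.ball (0 : E d) δ)
    = ENNReal.ofReal (δ ^ d * volume.real (Metric.ball (0 : E d) 1)) := by
  rw [Measure.addHaar_ball_of_pos volume (0 : E d) hδ, ENNReal.ofReal_mul (by positivity),
    finrank_euclideanSpace_fin, ofReal_measureReal (volume_ball_ne_top 1)]

/-- Distribution function bound: an `H¹` function in `L^r` is in weak `L^{2 + 2r/d}`. At level `t`,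
the average over balls of radius `δ ∼ t^{-r/d}` is at most `t / 2`, so that `|φ|` exceeds `t` only
where `φ` differs from its average by `t / 2`. -/
lemma MemH1.exists_volume_lt_le (hd : 1 ≤ d) {φ : E d → ℂ} (hφ : MemH1 φ) {r : ℝ} (hr : 2 ≤ r)
    (hφr : MemLp φ (ENNReal.ofReal r) volume) :
    ∃ C : ℝ, 0 ≤ C ∧ ∀ t : ℝ, 0 < t →
      volume {x | t < ‖φ x‖} ≤ ENNReal.ofReal (C * t ^ (-(2 + 2 * r / d))) := by
  have hr0 : 0 < r := by linarith
  have hd0 : (0 : ℝ) < d := by exact_mod_cast hd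
  set κ := volume.real (Metric.ball (0 : E d) 1)
  have hκ : 0 < κ := ENNReal.toReal_pos (volume_ball_ne_zero one_pos) (volume_ball_ne_top 1)
  have hfin : ∫⁻ z, ‖φ z‖ₑ ^ r ≠ ⊤ := by
    have := lintegral_rpow_enorm_lt_top_of_eLpNorm_lt_top (by simpa using hr0) (by simp) hφr.2
    rw [ENNReal.toReal_ofReal hr0.le] at this
    exact this.ne
  set K := (∫⁻ z, ‖φ z‖ₑ ^ r).toReal
  have hK : ∫⁻ z, ‖φ z‖ₑ ^ r = ENNReal.ofReal K := (ENNReal.ofReal_toReal hfin).symm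
  have hK0 : 0 ≤ K := ENNReal.toReal_nonneg
  set G := ∑ j, mass (weakPartial j φ)
  have hG : 0 ≤ G := Finset.sum_nonneg fun j _ => mass_nonneg _
  -- `A` is chosen so that averages over balls of radius `A t ^ (-r / d)` are at most `t / 2`
  set A := K * 2 ^ r / κ + 1
  have hA : 1 ≤ A := by
    have : 0 ≤ K * 2 ^ r / κ := by positivity
    linarith
  refine ⟨8 * A ^ 2 * G, by positivity, fun t ht => ?_⟩
  set δ := A * t ^ (-(r / d))
  have hδ : 0 < δ := by positivity
  have hδd : δ ^ d = A ^ d * t ^ (-r) := by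
    rw [mul_pow, ← Real.rpow_mul_natCast ht.le]
    congr 2
    field_simp
  have havg : ∀ x, ‖ballAvg δ φ x‖ ≤ t / 2 := fun x => by
    have h1 := enorm_ballAvg_rpow_le hδ hφ.1.1 (by linarith : (1 : ℝ) ≤ r) x
    rw [hK, volume_ball_eq hδ, ← ENNReal.ofReal_inv_of_pos (by positivity),
      ← ENNReal.ofReal_mul (by positivity), ← ofReal_norm,
      ENNReal.ofReal_rpow_of_nonneg (norm_nonneg _) hr0.le,
      ENNReal.ofReal_le_ofReal_iff (by positivity)] at h1
    refine (Real.rpow_le_rpow_iff (norm_nonneg _) (by positivity) hr0).1 (h1.trans ?_)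
    rw [inv_mul_le_iff₀ (by positivity), hδd, Real.rpow_neg ht.le,
      Real.div_rpow ht.le (by norm_num)]
    have h2 : A ^ d * (t ^ r)⁻¹ * κ * (t ^ r / 2 ^ r) = A ^ d * κ / 2 ^ r := by
      have : 0 < t ^ r := by positivity
      field_simp
    rw [h2, le_div_iff₀ (by positivity)]
    calc K * 2 ^ r = (A - 1) * κ := by simp only [A]; field_simp; ring
      _ ≤ A * κ := by gcongr; linarith
      _ ≤ A ^ d * κ := by gcongr; exact le_self_pow₀ hA (by omega)
  have hsub : {x | t < ‖φ x‖} ⊆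
      {x | ENNReal.ofReal ((t / 2) ^ 2) ≤ ‖φ x - ballAvg δ φ x‖ₑ ^ (2 : ℝ)} := by
    intro x hx
    have h1 := norm_sub_norm_le (φ x) (ballAvg δ φ x)
    have h2 := havg x
    simp only [Set.mem_ofPred_eq] at hx ⊢
    rw [ENNReal.rpow_ofNat, ← ofReal_norm, ← ENNReal.ofReal_pow (norm_nonneg _)]
    refine ENNReal.ofReal_le_ofReal ?_
    gcongr
    linarith
  have hch := mul_meas_ge_le_lintegral₀ (μ := (volume : Measure (E d)))
    ((hφ.1.1.sub (aestronglyMeasurable_ballAvg hφ.1.1 δ)).enorm.pow_const (2 : ℝ))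
    (ENNReal.ofReal ((t / 2) ^ 2))
  have h3 := hch.trans (hφ.lintegral_sub_ballAvg_le hδ)
  rw [mul_comm, ← ENNReal.le_div_iff_mul_le (Or.inl (by simpa using ht.ne')) (Or.inl (by simp)),
    ← ENNReal.ofReal_div_of_pos (by positivity)] at h3
  refine (measure_mono hsub).trans (h3.trans (ENNReal.ofReal_le_ofReal (le_of_eq ?_)))
  have h4 : t ^ (-(2 + 2 * r / d)) = (t ^ (-(r / d))) ^ 2 * (t ^ 2)⁻¹ := by
    rw [← Real.rpow_mul_natCast ht.le, ← Real.rpow_natCast, ← Real.rpow_neg ht.le,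
      ← Real.rpow_add ht]
    congr 1
    push_cast
    ring
  rw [h4]
  simp only [δ]
  field_simp
  ring

/-- Interpolation between `L²` and weak `L^s`. -/
lemma memLp_of_volume_lt_le {φ : E d → ℂ} (hφ : MemLp φ 2 volume) {C s q : ℝ}
    (h : ∀ t : ℝ, 0 < t → volume {x | t < ‖φ x‖} ≤ ENNReal.ofReal (C * t ^ (-s))) (hq : 2 ≤ q)
    (hqs : q < s) : MemLp φ (ENNReal.ofReal q) volume := by
  have hq0 : 0 < q := by linarith
  refine ⟨hφ.1, ?_⟩
  have hcake : ∀ r : ℝ, 0 < r → ∫⁻ x, ‖φ x‖ₑ ^ r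
      = ENNReal.ofReal r * ∫⁻ t in Set.Ioi 0,
        volume {x | t < ‖φ x‖} * ENNReal.ofReal (t ^ (r - 1)) := fun r hr => by
    rw [← lintegral_rpow_eq_lintegral_meas_lt_mul volume (ae_of_all _ fun x => norm_nonneg (φ x))
      hφ.1.norm.aemeasurable hr]
    refine lintegral_congr fun x => ?_
    rw [← ofReal_norm, ENNReal.ofReal_rpow_of_nonneg (norm_nonneg _) hr.le]
  have h2 : ∫⁻ t in Set.Ioi (0 : ℝ), volume {x | t < ‖φ x‖} * ENNReal.ofReal (t ^ ((2 : ℝ) - 1))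
      < ⊤ := by
    have h3 := hcake 2 (by norm_num)
    rw [← ofReal_mass hφ] at h3
    by_contra hcon
    rw [not_lt, top_le_iff] at hcon
    rw [hcon, ENNReal.mul_top (by simp)] at h3
    exact ENNReal.ofReal_ne_top h3
  rw [eLpNorm_lt_top_iff_lintegral_rpow_enorm_lt_top (by simpa using hq0) (by simp),
    ENNReal.toReal_ofReal hq0.le, hcake q hq0]
  refine ENNReal.mul_lt_top (by simp) ?_
  -- levels below `1` are controlled by the `L²` norm, levels above `1` by the weak bound
  rw [← Set.Ioc_union_Ioi_eq_Ioi (zero_le_one' ℝ)]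
  refine (lintegral_union_le _ _ _).trans_lt (ENNReal.add_lt_top.2 ⟨?_, ?_⟩)
  · refine lt_of_le_of_lt ?_ h2
    refine le_trans (setLIntegral_mono' measurableSet_Ioc fun t ht => ?_)
      (lintegral_mono_set fun t ht => ht.1)
    refine mul_le_mul' le_rfl (ENNReal.ofReal_le_ofReal ?_)
    exact Real.rpow_le_rpow_of_exponent_ge ht.1 ht.2 (by linarith)
  · have hint : IntegrableOn (fun t : ℝ => C * t ^ (q - 1 - s)) (Set.Ioi 1) volume :=
      (integrableOn_Ioi_rpow_of_lt (by linarith) one_pos).const_mul C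
    refine lt_of_le_of_lt (setLIntegral_mono' measurableSet_Ioi fun t ht => ?_)
      hint.lintegral_lt_top
    have ht0 : (0 : ℝ) < t := one_pos.trans ht
    refine (mul_le_mul' (h t ht0) le_rfl).trans ?_
    rw [← ENNReal.ofReal_mul' (by positivity), mul_assoc, ← Real.rpow_add ht0]
    refine ENNReal.ofReal_le_ofReal (le_of_eq ?_)
    congr 2
    ring

/-- The subcritical Sobolev embedding, in qualitative form, by iterating the gain of
integrability `r ↦ 2 + 2r/d`. -/
lemma MemH1.memLp_rpow (hd : 1 ≤ d) {φ : E d → ℂ} (hφ : MemH1 φ) {q : ℝ} (hq : 2 ≤ q)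
    (hqd : ((d : ℝ) - 2) * q < 2 * d) : MemLp φ (ENNReal.ofReal q) volume := by
  have hd0 : (0 : ℝ) < d := by exact_mod_cast hd
  -- the gain `2 + 2 r / d - r` is affine in `r`, so it is at least its minimum at `r = 2` and `r = q`
  set m : ℝ := min (4 / d) ((2 * d - (d - 2) * q) / d) with hm
  have hm0 : 0 < m := lt_min (by positivity) (div_pos (by linarith) hd0)
  have gain : ∀ r, 2 ≤ r → r ≤ q → r + m ≤ 2 + 2 * r / d := fun r h1 h2 => by
    have m1 : m * d ≤ 4 := by
      have := min_le_left (4 / (d : ℝ)) ((2 * d - (d - 2) * q) / d)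
      rwa [← hm, le_div_iff₀ hd0] at this
    have m2 : m * d ≤ 2 * d - (d - 2) * q := by
      have := min_le_right (4 / (d : ℝ)) ((2 * d - (d - 2) * q) / d)
      rwa [← hm, le_div_iff₀ hd0] at this
    have : (r + m) * d ≤ 2 * d + 2 * r := by
      rcases le_total 2 (d : ℝ) with h | h <;> nlinarith
    calc r + m = (r + m) * d / d := by field_simp
      _ ≤ (2 * d + 2 * r) / d := by gcongr
      _ = _ := by field_simp
  have ind : ∀ k : ℕ, MemLp φ (ENNReal.ofReal (min q (2 + k * (m / 2)))) volume := by
    intro k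
    induction k with
    | zero => simpa [hq] using hφ.1
    | succ k ih =>
      have h0 : (0 : ℝ) ≤ k * (m / 2) := by positivity
      set r := min q (2 + k * (m / 2)) with hr
      have hr2 : 2 ≤ r := le_min hq (by linarith)
      obtain ⟨C, _, hC⟩ := hφ.exists_volume_lt_le hd hr2 ih
      refine memLp_of_volume_lt_le hφ.1 hC (le_min hq (by push_cast; linarith)) ?_
      refine lt_of_lt_of_le ?_ (gain r hr2 (min_le_left _ _))
      push_cast
      rcases min_choice q (2 + k * (m / 2)) with h | h
      · rw [hr, h]
        exact (min_le_left _ _).trans_lt (by linarith)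
      · rw [hr, h]
        exact (min_le_right _ _).trans_lt (by linarith)
  obtain ⟨k, hk⟩ := exists_nat_ge ((q - 2) / (m / 2))
  have := ind k
  rwa [min_eq_left] at this
  rw [div_le_iff₀ (by linarith)] at hk
  linarith

/-! ### The space `X` -/

lemma aestronglyMeasurable_weight {V : E d → ℝ} (hVm : AEMeasurable V volume) {φ : E d → ℂ}
    (hφ : AEStronglyMeasurable φ volume) :
    AEStronglyMeasurable (fun x => V x * ‖φ x‖ ^ 2) volume :=
  hVm.aestronglyMeasurable.mul (hφ.norm.pow 2)

lemma norm_add_sq_le_two (a b : ℂ) : ‖a + b‖ ^ 2 ≤ 2 * ‖a‖ ^ 2 + 2 * ‖b‖ ^ 2 := by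
  have h1 := norm_add_le a b
  nlinarith [sq_nonneg (‖a‖ - ‖b‖), norm_nonneg (a + b), norm_nonneg a, norm_nonneg b]

lemma MemX.add {V : E d → ℝ} (hVm : AEMeasurable V volume) (hV0 : ∀ x, 0 ≤ V x) {φ ψ : E d → ℂ}
    (hφ : MemX V φ) (hψ : MemX V ψ) : MemX V (φ + ψ) := by
  refine ⟨hφ.1.add hψ.1, ((hφ.2.const_mul 2).add (hψ.2.const_mul 2)).mono'
    (aestronglyMeasurable_weight hVm (hφ.1.add hψ.1).1.1) (ae_of_all _ fun x => ?_)⟩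
  rw [Real.norm_of_nonneg (mul_nonneg (hV0 x) (by positivity))]
  have := mul_le_mul_of_nonneg_left (norm_add_sq_le_two (φ x) (ψ x)) (hV0 x)
  simp only [Pi.add_apply]
  linarith

lemma MemX.const_smul {V : E d → ℝ} {φ : E d → ℂ} (c : ℂ) (hφ : MemX V φ) : MemX V (c • φ) := by
  refine ⟨hφ.1.const_smul c, ?_⟩
  have := hφ.2.const_mul (‖c‖ ^ 2)
  refine this.congr (ae_of_all _ fun x => ?_)
  simp only [Pi.smul_apply, smul_eq_mul, norm_mul]
  ring

lemma MemX.sub {V : E d → ℝ} (hVm : AEMeasurable V volume) (hV0 : ∀ x, 0 ≤ V x) {φ ψ : E d → ℂ}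
    (hφ : MemX V φ) (hψ : MemX V ψ) : MemX V (φ - ψ) := by
  simpa [sub_eq_add_neg] using hφ.add hVm hV0 (hψ.const_smul (-1))

lemma mass_sub_le_add {f g : E d → ℂ} (hf : MemLp f 2 volume) (hg : MemLp g 2 volume) :
    mass (f - g) ≤ 2 * mass f + 2 * mass g := by
  have := mass_add_le hf hg.neg
  rwa [mass_neg, ← sub_eq_add_neg] at this

lemma integral_weight_sub_le {V : E d → ℝ} (hVm : AEMeasurable V volume) (hV0 : ∀ x, 0 ≤ V x)
    {φ ψ : E d → ℂ} (hφ : MemX V φ) (hψ : MemX V ψ) :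
    ∫ x, V x * ‖(φ - ψ) x‖ ^ 2 ≤ 2 * (∫ x, V x * ‖φ x‖ ^ 2) + 2 * ∫ x, V x * ‖ψ x‖ ^ 2 := by
  rw [← integral_const_mul, ← integral_const_mul, ← integral_add (hφ.2.const_mul 2)
    (hψ.2.const_mul 2)]
  refine integral_mono (hφ.sub hVm hV0 hψ).2 ((hφ.2.const_mul 2).add (hψ.2.const_mul 2)) fun x => ?_
  have := mul_le_mul_of_nonneg_left (norm_add_sq_le_two (φ x) (-ψ x)) (hV0 x)
  rw [norm_neg, ← sub_eq_add_neg] at this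
  simp only [Pi.sub_apply]
  linarith

lemma sum_mass_weakPartial_sub_le {φ ψ : E d → ℂ} (hφ : MemH1 φ) (hψ : MemH1 ψ) :
    ∑ j, mass (weakPartial j (φ - ψ))
      ≤ 2 * (∑ j, mass (weakPartial j φ)) + 2 * ∑ j, mass (weakPartial j ψ) := by
  rw [Finset.mul_sum, Finset.mul_sum, ← Finset.sum_add_distrib]
  refine Finset.sum_le_sum fun j _ => ?_
  rw [mass_congr (weakPartial_sub hφ hψ j)]
  exact mass_sub_le_add (hφ.memLp_weakPartial j) (hψ.memLp_weakPartial j)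

/-! ### Compactness of `X` in `L²` -/

lemma memLp_two_of_lintegral {f : E d → ℂ} (hf : AEStronglyMeasurable f volume) {K : ℝ}
    (hK : 0 ≤ K) (h : ∫⁻ x, ‖f x‖ₑ ^ (2 : ℝ) ≤ ENNReal.ofReal K) :
    MemLp f 2 volume ∧ mass f ≤ K := by
  have h1 : MemLp f 2 volume := by
    refine ⟨hf, ?_⟩
    rw [eLpNorm_lt_top_iff_lintegral_rpow_enorm_lt_top (by norm_num) (by norm_num)]
    exact h.trans_lt (by simp)
  refine ⟨h1, ?_⟩
  rwa [← ofReal_mass h1, ENNReal.ofReal_le_ofReal_iff hK] at h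

lemma MemH1.mass_sub_ballAvg_le {φ : E d → ℂ} (hφ : MemH1 φ) {δ : ℝ} (hδ : 0 < δ) :
    MemLp (φ - ballAvg δ φ) 2 volume ∧
      mass (φ - ballAvg δ φ) ≤ 2 * (δ ^ 2 * ∑ j, mass (weakPartial j φ)) :=
  memLp_two_of_lintegral (hφ.1.1.sub (aestronglyMeasurable_ballAvg hφ.1.1 δ))
    (mul_nonneg (by norm_num) (mul_nonneg (by positivity)
      (Finset.sum_nonneg fun j _ => mass_nonneg _)))
    (hφ.lintegral_sub_ballAvg_le hδ)

/-- Bounded sequences in `L²` have weakly convergent subsequences. -/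
lemma exists_subseq_weak {f : ℕ → E d → ℂ} (hf : ∀ n, MemLp (f n) 2 volume) {M : ℝ}
    (hM : ∀ n, mass (f n) ≤ M) : ∃ σ : ℕ → ℕ, StrictMono σ ∧
      ∀ ψ : E d → ℂ, MemLp ψ 2 volume →
        ∃ l : ℂ, Tendsto (fun n => ∫ x, ψ x * f (σ n) x) atTop (𝓝 l) := by
  -- the inner product is conjugate linear on the left, so that pairing with `conj f` gives `∫ ψ f`
  have hc : ∀ n, MemLp (fun x => conj (f n x)) 2 volume := fun n => (hf n).star
  have hmc : ∀ n, mass (fun x => conj (f n x)) = mass (f n) := fun n => by simp [mass]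
  let T : ℕ → WeakDual ℂ (Lp ℂ 2 (volume : Measure (E d))) := fun n =>
    StrongDual.toWeakDual (innerSL ℂ ((hc n).toLp _))
  have hT : ∀ n, T n ∈ WeakDual.toStrongDual ⁻¹'
      Metric.closedBall (0 : StrongDual ℂ (Lp ℂ 2 (volume : Measure (E d)))) √M := fun n => by
    simp only [Set.mem_preimage, mem_closedBall_zero_iff]
    change ‖innerSL ℂ ((hc n).toLp _)‖ ≤ √M
    rw [innerSL_apply_norm]
    refine Real.le_sqrt_of_sq_le ?_
    rw [← mass_eq_norm_toLp_sq, hmc]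
    exact hM n
  have : Fact ((2 : ENNReal) ≠ ⊤) := ⟨by norm_num⟩
  obtain ⟨L, -, σ, hσ, hL⟩ := WeakDual.isSeqCompact_closedBall ℂ _ 0 √M hT
  refine ⟨σ, hσ, fun ψ hψ => ⟨L (hψ.toLp ψ), ?_⟩⟩
  have h1 := (WeakDual.eval_continuous (𝕜 := ℂ) (hψ.toLp ψ)).continuousAt.tendsto.comp hL
  refine h1.congr fun n => ?_
  change inner ℂ ((hc (σ n)).toLp _) (hψ.toLp ψ) = _
  rw [L2.inner_def]
  refine integral_congr_ae ?_
  filter_upwards [(hc (σ n)).coeFn_toLp, hψ.coeFn_toLp] with x h1 h2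
  rw [h1, h2]
  simp [mul_comm]

lemma memLp_indicator_ball (δ : ℝ) (x : E d) :
    MemLp (fun y => (Metric.ball (0 : E d) δ).indicator (fun _ => (1 : ℂ)) (y - x)) 2 volume :=
  memLp_comp_sub (memLp_indicator_const 2 measurableSet_ball 1
    (Or.inr (volume_ball_ne_top δ))) x

lemma ballAvg_eq_pairing (δ : ℝ) (f : E d → ℂ) (x : E d) :
    ballAvg δ f x = (volume.real (Metric.ball (0 : E d) δ))⁻¹ •
      ∫ y, (Metric.ball (0 : E d) δ).indicator (fun _ => (1 : ℂ)) (y - x) * f y := by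
  rw [ballAvg, setAverage_eq, ← integral_indicator measurableSet_ball,
    ← integral_sub_right_eq_self _ x]
  congr 2
  funext y
  by_cases h : y - x ∈ Metric.ball (0 : E d) δ <;> simp [h]

lemma norm_ballAvg_sq_le {δ : ℝ} (hδ : 0 < δ) {f : E d → ℂ} (hf : MemLp f 2 volume) (x : E d) :
    ‖ballAvg δ f x‖ ^ 2 ≤ (volume.real (Metric.ball (0 : E d) δ))⁻¹ * mass f := by
  have h := enorm_ballAvg_rpow_le hδ hf.1 (by norm_num : (1 : ℝ) ≤ 2) x
  have hκ : 0 < volume.real (Metric.ball (0 : E d) δ) :=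
    ENNReal.toReal_pos (volume_ball_ne_zero hδ) (volume_ball_ne_top δ)
  rw [← ofReal_mass hf, ← ofReal_measureReal (volume_ball_ne_top δ),
    ← ENNReal.ofReal_inv_of_pos hκ, ← ENNReal.ofReal_mul (by positivity), ← ofReal_norm,
    ENNReal.ofReal_rpow_of_nonneg (norm_nonneg _) (by norm_num),
    ENNReal.ofReal_le_ofReal_iff (mul_nonneg (by positivity) (mass_nonneg f))] at h
  simpa using h

/-- Averages over balls of fixed radius turn weakly convergent sequences into sequences which are
Cauchy in `L²` on bounded sets. -/
lemma tendsto_integral_ballAvg_sub {f : ℕ → E d → ℂ} (hf : ∀ n, MemLp (f n) 2 volume) {M : ℝ}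
    (hM : ∀ n, mass (f n) ≤ M) (hw : ∀ ψ : E d → ℂ, MemLp ψ 2 volume →
        ∃ l : ℂ, Tendsto (fun n => ∫ x, ψ x * f n x) atTop (𝓝 l)) {δ : ℝ} (hδ : 0 < δ) (R : ℝ) :
    Tendsto (fun k : ℕ × ℕ => ∫ x in Metric.ball (0 : E d) R,
      ‖ballAvg δ (f k.1 - f k.2) x‖ ^ 2) atTop (𝓝 0) := by
  set κ := (volume.real (Metric.ball (0 : E d) δ))⁻¹
  have hκ : 0 ≤ κ := by positivity
  have : IsFiniteMeasure (volume.restrict (Metric.ball (0 : E d) R)) :=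
    ⟨by simpa using (volume_ball_ne_top (d := d) R).lt_top⟩
  have h0 : ∫ x in Metric.ball (0 : E d) R, (0 : ℝ) = 0 := by simp
  rw [← h0]
  refine tendsto_integral_filter_of_dominated_convergence (fun _ => κ * (4 * M)) ?_ ?_
    (integrable_const _) ?_
  · exact Eventually.of_forall fun k =>
      ((aestronglyMeasurable_ballAvg ((hf k.1).sub (hf k.2)).1 δ).norm.pow 2).restrict
  · refine Eventually.of_forall fun k => ae_of_all _ fun x => ?_
    rw [Real.norm_of_nonneg (by positivity)]
    refine (norm_ballAvg_sq_le hδ ((hf k.1).sub (hf k.2)) x).trans ?_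
    have h1 := mass_sub_le_add (hf k.1) (hf k.2)
    have h2 := hM k.1
    have h3 := hM k.2
    gcongr
    linarith
  · refine ae_of_all _ fun x => ?_
    obtain ⟨l, hl⟩ := hw _ (memLp_indicator_ball δ x)
    have h1 : Tendsto (fun n => ballAvg δ (f n) x) atTop (𝓝 (κ • l)) := by
      simp only [ballAvg_eq_pairing]
      exact hl.const_smul κ
    have h2 : Tendsto (fun k : ℕ × ℕ => ballAvg δ (f k.1) x - ballAvg δ (f k.2) x) atTop
        (𝓝 (κ • l - κ • l)) := by
      rw [← prod_atTop_atTop_eq]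
      exact (h1.comp tendsto_fst).sub (h1.comp tendsto_snd)
    rw [sub_self] at h2
    simpa [ballAvg_sub (hf _) (hf _)] using h2.norm.pow 2

lemma exists_forall_weight_ge {V : E d → ℝ} (hVinf : Tendsto V (cocompact (E d)) atTop) (a : ℝ) :
    ∃ R : ℝ, ∀ x, x ∉ Metric.ball (0 : E d) R → a ≤ V x := by
  have h := hVinf.eventually_ge_atTop a
  rw [Metric.cobounded_eq_cocompact.symm, ← comap_norm_atTop, eventually_comap] at h
  obtain ⟨R, hR⟩ := eventually_atTop.1 h
  exact ⟨R, fun x hx => hR ‖x‖ (by simpa using hx) x rfl⟩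

/-- Sequences bounded in `X` have subsequences which are Cauchy in `L²`. -/
lemma exists_subseq_cauchy {V : E d → ℝ} (hVm : AEMeasurable V volume) (hV0 : ∀ x, 0 ≤ V x)
    (hVinf : Tendsto V (cocompact (E d)) atTop) {f : ℕ → E d → ℂ} (hf : ∀ n, MemX V (f n)) {M : ℝ}
    (h1 : ∀ n, mass (f n) ≤ M) (h2 : ∀ n, ∑ j, mass (weakPartial j (f n)) ≤ M)
    (h3 : ∀ n, ∫ x, V x * ‖f n x‖ ^ 2 ≤ M) :
    ∃ σ : ℕ → ℕ, StrictMono σ ∧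
      ∀ ε > 0, ∃ N, ∀ m ≥ N, ∀ n ≥ N, mass (f (σ m) - f (σ n)) < ε := by
  obtain ⟨σ, hσ, hw⟩ := exists_subseq_weak (fun n => (hf n).1.1) h1
  refine ⟨σ, hσ, fun ε hε => ?_⟩
  have hM : 0 ≤ M := (mass_nonneg _).trans (h1 0)
  -- the radius `δ` of the averages and the level `a` of `V` for the tails each cost at most `ε / 4`
  set δ := √(ε / (128 * (M + 1)))
  have hδ : 0 < δ := Real.sqrt_pos.2 (by positivity)
  have hδ2 : δ ^ 2 * (128 * (M + 1)) = ε := by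
    rw [Real.sq_sqrt (by positivity)]
    field_simp
  set a := 16 * (M + 1) / ε
  have ha : 0 < a := by positivity
  have haε : ε * a = 16 * (M + 1) := by simp only [a]; field_simp
  obtain ⟨R, hR⟩ := exists_forall_weight_ge hVinf a
  have ht := tendsto_integral_ballAvg_sub (fun n => (hf (σ n)).1.1) (fun n => h1 (σ n)) hw hδ R
  have hev := ht.eventually_lt_const (show (0 : ℝ) < ε / 8 by positivity)
  rw [eventually_atTop] at hev
  obtain ⟨⟨N₁, N₂⟩, hN⟩ := hev
  refine ⟨max N₁ N₂, fun m hm n hn => ?_⟩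
  have hA := hN (m, n) ⟨(le_max_left _ _).trans hm, (le_max_right _ _).trans hn⟩
  set g := f (σ m) - f (σ n)
  have hg : MemX V g := (hf _).sub hVm hV0 (hf _)
  change ∫ x in Metric.ball (0 : E d) R, ‖ballAvg δ g x‖ ^ 2 < ε / 8 at hA
  have hgV : ∫ x, V x * ‖g x‖ ^ 2 ≤ 4 * M := by
    have := integral_weight_sub_le hVm hV0 (hf (σ m)) (hf (σ n))
    have := h3 (σ m)
    have := h3 (σ n)
    linarith
  have hgG : ∑ j, mass (weakPartial j g) ≤ 4 * M := by
    have := sum_mass_weakPartial_sub_le (hf (σ m)).1 (hf (σ n)).1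
    have := h2 (σ m)
    have := h2 (σ n)
    linarith
  obtain ⟨hL, hmass⟩ := hg.1.mass_sub_ballAvg_le hδ
  have hL2 : MemLp (ballAvg δ g) 2 volume := by
    have := hg.1.1.sub hL
    rwa [sub_sub_cancel] at this
  have hsplit := integral_add_compl (measurableSet_ball (x := (0 : E d)) (ε := R))
    (integrable_normSq hg.1.1)
  have hout : ∫ x in (Metric.ball (0 : E d) R)ᶜ, ‖g x‖ ^ 2 ≤ ε / 4 := by
    have h4 : a * ∫ x in (Metric.ball (0 : E d) R)ᶜ, ‖g x‖ ^ 2 ≤ 4 * M := by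
      rw [← integral_const_mul]
      refine le_trans ?_ hgV
      refine le_trans (setIntegral_mono_on ((integrable_normSq hg.1.1).const_mul a).integrableOn
        hg.2.integrableOn measurableSet_ball.compl fun x hx => ?_)
        (setIntegral_le_integral hg.2 (ae_of_all _ fun x => mul_nonneg (hV0 x) (by positivity)))
      gcongr
      exact hR x hx
    by_contra hcon
    rw [not_le] at hcon
    have := mul_lt_mul_of_pos_left hcon ha
    nlinarith
  have hin : ∫ x in Metric.ball (0 : E d) R, ‖g x‖ ^ 2
      ≤ 2 * mass (g - ballAvg δ g) + 2 * ∫ x in Metric.ball (0 : E d) R, ‖ballAvg δ g x‖ ^ 2 := by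
    have h5 : ∫ x in Metric.ball (0 : E d) R, ‖(g - ballAvg δ g) x‖ ^ 2
        ≤ mass (g - ballAvg δ g) :=
      setIntegral_le_integral (integrable_normSq hL) (ae_of_all _ fun x => by positivity)
    have h6 : ∫ x in Metric.ball (0 : E d) R, ‖g x‖ ^ 2
        ≤ 2 * (∫ x in Metric.ball (0 : E d) R, ‖(g - ballAvg δ g) x‖ ^ 2)
          + 2 * ∫ x in Metric.ball (0 : E d) R, ‖ballAvg δ g x‖ ^ 2 := by
      rw [← integral_const_mul, ← integral_const_mul, ← integral_add
        ((integrable_normSq hL).const_mul 2).integrableOn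
        ((integrable_normSq hL2).const_mul 2).integrableOn]
      refine integral_mono (integrable_normSq hg.1.1).integrableOn
        (((integrable_normSq hL).const_mul 2).add
          ((integrable_normSq hL2).const_mul 2)).integrableOn fun x => ?_
      simpa using norm_add_sq_le_two ((g - ballAvg δ g) x) (ballAvg δ g x)
    linarith
  have h7 : 2 * mass (g - ballAvg δ g) ≤ ε / 4 := by
    have : 2 * (δ ^ 2 * ∑ j, mass (weakPartial j g)) ≤ 2 * (δ ^ 2 * (4 * M)) := by gcongr
    nlinarith [sq_nonneg δ]
  change mass g < ε
  have : mass g = _ := hsplit.symm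
  linarith

/-! ### The energy density -/

/-- The standing hypotheses, with the condition on `Ω` in the form in which it is used: the
centrifugal potential `Ω² (x₁² + x₂²) / 2` is at most `θ² (V + C)` for some `θ < 1`. -/
structure Admissible (p β : ℝ) (V : E d → ℝ) (Ω θ C : ℝ) : Prop where
  one_le_dim : 1 ≤ d
  one_lt_p : 1 < p
  subcritical : ((d : ℝ) - 2) * (p + 1) < 2 * d
  β_pos : 0 < β
  aemeasurable : AEMeasurable V volume
  nonneg : ∀ x, 0 ≤ V x
  tendsto : Tendsto V (cocompact (E d)) atTop
  θ_nonneg : 0 ≤ θ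
  θ_lt_one : θ < 1
  C_nonneg : 0 ≤ C
  rot_le : ∀ x, Ω ^ 2 * planeSq x ≤ 2 * θ ^ 2 * (V x + C)

/-- The symbol of `L_z`: the value of `L_z φ` at `x` in terms of `b = ∇φ(x)`. -/
def lzSymbol (x : E d) (b : Fin d → ℂ) : ℂ :=
  if h : 2 ≤ d then
    Complex.I * ((x ⟨1, by omega⟩ : ℂ) * b ⟨0, by omega⟩ - (x ⟨0, by omega⟩ : ℂ) * b ⟨1, by omega⟩)
  else 0

/-- The weak gradient. -/
def grad (φ : E d → ℂ) (x : E d) (j : Fin d) : ℂ := weakPartial j φ x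

lemma Lz_eq (φ : E d → ℂ) (x : E d) : Lz φ x = lzSymbol x (grad φ x) := rfl

lemma lzSymbol_add (x : E d) (b b' : Fin d → ℂ) :
    lzSymbol x (b + b') = lzSymbol x b + lzSymbol x b' := by
  unfold lzSymbol
  split_ifs
  · simp only [Pi.add_apply]; ring
  · simp

lemma lzSymbol_smul (x : E d) (c : ℂ) (b : Fin d → ℂ) :
    lzSymbol x (c • b) = c * lzSymbol x b := by
  unfold lzSymbol
  split_ifs
  · simp only [Pi.smul_apply, smul_eq_mul]; ring
  · simp

lemma planeSq_le (x : E d) : planeSq x ≤ ‖x‖ ^ 2 := by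
  unfold planeSq
  split_ifs with h
  · rw [EuclideanSpace.norm_sq_eq]
    have := Finset.sum_le_univ_sum_of_nonneg (s := {(⟨0, by omega⟩ : Fin d), ⟨1, by omega⟩})
      (f := fun i => ‖x i‖ ^ 2) (fun i => by positivity)
    rw [Finset.sum_pair (by simp)] at this
    simpa using this
  · positivity

lemma norm_lzSymbol_sq_le (x : E d) (b : Fin d → ℂ) :
    ‖lzSymbol x b‖ ^ 2 ≤ planeSq x * ∑ j, ‖b j‖ ^ 2 := by
  unfold lzSymbol planeSq
  split_ifs with h
  · set b0 := b ⟨0, by omega⟩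
    set b1 := b ⟨1, by omega⟩
    set x0 := x ⟨0, by omega⟩
    set x1 := x ⟨1, by omega⟩
    have h1 := Finset.sum_le_univ_sum_of_nonneg (s := {(⟨0, by omega⟩ : Fin d), ⟨1, by omega⟩})
      (f := fun i => ‖b i‖ ^ 2) (fun i => by positivity)
    rw [Finset.sum_pair (by simp)] at h1
    have h2 : ‖(x1 : ℂ) * b0 - (x0 : ℂ) * b1‖ ≤ |x1| * ‖b0‖ + |x0| * ‖b1‖ := by
      refine (norm_sub_le _ _).trans_eq ?_
      simp
    rw [norm_mul, Complex.norm_I, one_mul]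
    calc _ ≤ (|x1| * ‖b0‖ + |x0| * ‖b1‖) ^ 2 := by gcongr
      _ ≤ (|x0| ^ 2 + |x1| ^ 2) * (‖b0‖ ^ 2 + ‖b1‖ ^ 2) := by
          nlinarith [sq_nonneg (|x1| * ‖b1‖ - |x0| * ‖b0‖)]
      _ ≤ _ := by rw [sq_abs, sq_abs]; gcongr
  · simp

/-- The density of the rotational energy. -/
def rotDensity (Ω : ℝ) (x : E d) (a : ℂ) (b : Fin d → ℂ) : ℝ := Ω * (conj a * lzSymbol x b).re

/-- The density of the quadratic part of the energy, as a function of `a = φ(x)` and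
`b = ∇φ(x)`. -/
def quadDensity (V : E d → ℝ) (Ω : ℝ) (x : E d) (a : ℂ) (b : Fin d → ℂ) : ℝ :=
  (1 / 2) * ∑ j, ‖b j‖ ^ 2 + V x * ‖a‖ ^ 2 - rotDensity Ω x a b

/-- The density of the action. -/
def actionDensity (p β : ℝ) (V : E d → ℝ) (Ω ω : ℝ) (x : E d) (a : ℂ) (b : Fin d → ℂ) : ℝ :=
  quadDensity V Ω x a b + 2 * β / (p + 1) * ‖a‖ ^ (p + 1) + ω * ‖a‖ ^ 2

lemma parallelogram_complex (a b : ℂ) :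
    ‖(1 / 2 : ℂ) * (a + b)‖ ^ 2 + ‖(1 / 2 : ℂ) * (a - b)‖ ^ 2
      = 1 / 2 * ‖a‖ ^ 2 + 1 / 2 * ‖b‖ ^ 2 := by
  simp only [Complex.sq_norm, Complex.normSq_apply]
  simp
  ring

lemma quadDensity_parallelogram (V : E d → ℝ) (Ω : ℝ) (x : E d) (a a' : ℂ) (b b' : Fin d → ℂ) :
    quadDensity V Ω x ((1 / 2 : ℂ) * (a + a')) ((1 / 2 : ℂ) • (b + b'))
      + quadDensity V Ω x ((1 / 2 : ℂ) * (a - a')) ((1 / 2 : ℂ) • (b - b'))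
      = 1 / 2 * quadDensity V Ω x a b + 1 / 2 * quadDensity V Ω x a' b' := by
  have hsum : ∑ j, ‖((1 / 2 : ℂ) • (b + b')) j‖ ^ 2 + ∑ j, ‖((1 / 2 : ℂ) • (b - b')) j‖ ^ 2
      = 1 / 2 * ∑ j, ‖b j‖ ^ 2 + 1 / 2 * ∑ j, ‖b' j‖ ^ 2 := by
    rw [← Finset.sum_add_distrib, Finset.mul_sum, Finset.mul_sum, ← Finset.sum_add_distrib]
    exact Finset.sum_congr rfl fun j _ => parallelogram_complex (b j) (b' j)
  have ha := parallelogram_complex a a'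
  have hr : rotDensity Ω x ((1 / 2 : ℂ) * (a + a')) ((1 / 2 : ℂ) • (b + b'))
      + rotDensity Ω x ((1 / 2 : ℂ) * (a - a')) ((1 / 2 : ℂ) • (b - b'))
      = 1 / 2 * rotDensity Ω x a b + 1 / 2 * rotDensity Ω x a' b' := by
    have hb : b - b' = b + (-1 : ℂ) • b' := by simp [sub_eq_add_neg]
    simp only [rotDensity, hb, lzSymbol_smul, lzSymbol_add]
    set l := lzSymbol x b
    set l' := lzSymbol x b'
    simp only [map_mul, map_add, map_sub, Complex.mul_re, Complex.mul_im, Complex.add_re,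
      Complex.add_im, Complex.sub_re, Complex.sub_im, Complex.conj_re, Complex.conj_im]
    simp
    ring
  simp only [quadDensity]
  linear_combination (1 / 2) * hsum + V x * ha - hr

lemma integrable_gradSq {φ : E d → ℂ} (hφ : MemH1 φ) :
    Integrable (fun x => ∑ j, ‖grad φ x j‖ ^ 2) volume :=
  integrable_finsetSum _ fun j _ => integrable_normSq (hφ.memLp_weakPartial j)

lemma integral_gradSq {φ : E d → ℂ} (hφ : MemH1 φ) :
    ∫ x, ∑ j, ‖grad φ x j‖ ^ 2 = ∑ j, mass (weakPartial j φ) :=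
  integral_finsetSum _ fun j _ => integrable_normSq (hφ.memLp_weakPartial j)

lemma aestronglyMeasurable_coord (i : Fin d) :
    AEStronglyMeasurable (fun x : E d => (x i : ℂ)) volume :=
  (Complex.continuous_ofReal.comp (by fun_prop)).aestronglyMeasurable

lemma aestronglyMeasurable_Lz {φ : E d → ℂ} (hφ : MemH1 φ) :
    AEStronglyMeasurable (Lz φ) volume := by
  unfold Lz
  split_ifs
  · exact (((aestronglyMeasurable_coord _).mul (hφ.memLp_weakPartial _).1).sub
      ((aestronglyMeasurable_coord _).mul (hφ.memLp_weakPartial _).1)).const_mul _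
  · exact aestronglyMeasurable_const

lemma rotDensity_eq (Ω : ℝ) (φ : E d → ℂ) (x : E d) :
    rotDensity Ω x (φ x) (grad φ x) = ((Ω : ℂ) * (conj (φ x) * Lz φ x)).re := by
  rw [Complex.re_ofReal_mul, rotDensity, Lz_eq]

namespace Admissible

variable {p β : ℝ} {V : E d → ℝ} {Ω θ C : ℝ}

lemma abs_rot_le (H : Admissible p β V Ω θ C) (x : E d) (a : ℂ) (b : Fin d → ℂ) :
    ‖(Ω : ℂ) * (conj a * lzSymbol x b)‖
      ≤ θ * ((1 / 2) * ∑ j, ‖b j‖ ^ 2 + (V x + C) * ‖a‖ ^ 2) := by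
  have hS : 0 ≤ ∑ j, ‖b j‖ ^ 2 := Finset.sum_nonneg fun j _ => by positivity
  have hL := norm_lzSymbol_sq_le x b
  have hP := H.rot_le x
  set S := ∑ j, ‖b j‖ ^ 2
  have hW : 0 ≤ V x + C := add_nonneg (H.nonneg x) H.C_nonneg
  set W := V x + C
  refine abs_le_of_sq_le_sq' ?_ (mul_nonneg H.θ_nonneg (by positivity)) |>.2
  rw [norm_mul, norm_mul, RCLike.norm_conj, mul_pow, mul_pow, Complex.norm_real, Real.norm_eq_abs,
    sq_abs]
  calc Ω ^ 2 * (‖a‖ ^ 2 * ‖lzSymbol x b‖ ^ 2)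
      ≤ Ω ^ 2 * (‖a‖ ^ 2 * (planeSq x * S)) := by gcongr
    _ = (Ω ^ 2 * planeSq x) * (‖a‖ ^ 2 * S) := by ring
    _ ≤ (2 * θ ^ 2 * W) * (‖a‖ ^ 2 * S) := by gcongr
    _ ≤ _ := by nlinarith [mul_nonneg (sq_nonneg θ) (sq_nonneg (1 / 2 * S - W * ‖a‖ ^ 2))]

lemma abs_rotDensity_le (H : Admissible p β V Ω θ C) (x : E d) (a : ℂ) (b : Fin d → ℂ) :
    |rotDensity Ω x a b| ≤ θ * ((1 / 2) * ∑ j, ‖b j‖ ^ 2 + (V x + C) * ‖a‖ ^ 2) := by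
  refine le_trans ?_ (H.abs_rot_le x a b)
  have : rotDensity Ω x a b = ((Ω : ℂ) * (conj a * lzSymbol x b)).re := by
    rw [Complex.re_ofReal_mul, rotDensity]
  rw [this]
  exact Complex.abs_re_le_norm _

lemma quadDensity_ge (H : Admissible p β V Ω θ C) (x : E d) (a : ℂ) (b : Fin d → ℂ) :
    (1 - θ) * ((1 / 2) * ∑ j, ‖b j‖ ^ 2 + V x * ‖a‖ ^ 2) - C * ‖a‖ ^ 2
      ≤ quadDensity V Ω x a b := by
  have h := (abs_le.1 (H.abs_rotDensity_le x a b)).2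
  have h2 : θ * (C * ‖a‖ ^ 2) ≤ C * ‖a‖ ^ 2 := by
    have := mul_nonneg H.C_nonneg (sq_nonneg ‖a‖)
    nlinarith [H.θ_lt_one]
  simp only [quadDensity]
  nlinarith

lemma c0_pos (H : Admissible p β V Ω θ C) : 0 < 2 * β / (p + 1) :=
  div_pos (by linarith [H.β_pos]) (by linarith [H.one_lt_p])

lemma integrable_rot (H : Admissible p β V Ω θ C) {φ ψ : E d → ℂ} (hφ : MemX V φ)
    (hψ : MemH1 ψ) : Integrable (fun x => (Ω : ℂ) * (conj (φ x) * Lz ψ x)) volume := by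
  have hi : Integrable (fun x => θ * ((1 / 2) * ∑ j, ‖grad ψ x j‖ ^ 2
      + (V x + C) * ‖φ x‖ ^ 2)) volume := by
    refine Integrable.const_mul (((integrable_gradSq hψ).const_mul _).add ?_) _
    simp only [add_mul]
    exact hφ.2.add ((integrable_normSq hφ.1.1).const_mul C)
  refine hi.mono' ((hφ.1.1.star.1.mul (aestronglyMeasurable_Lz hψ)).const_mul _)
    (ae_of_all _ fun x => H.abs_rot_le x (φ x) (grad ψ x))

lemma integrable_rotDensity (H : Admissible p β V Ω θ C) {φ : E d → ℂ} (hφ : MemX V φ) :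
    Integrable (fun x => rotDensity Ω x (φ x) (grad φ x)) volume := by
  simp only [rotDensity_eq]
  exact (H.integrable_rot hφ hφ.1).re

lemma rotEnergy_eq (H : Admissible p β V Ω θ C) {φ : E d → ℂ} (hφ : MemX V φ) :
    rotEnergy Ω φ = - ∫ x, rotDensity Ω x (φ x) (grad φ x) := by
  simp only [rotDensity_eq]
  have h := integral_re (H.integrable_rot hφ hφ.1)
  rw [integral_const_mul] at h
  have h' : ∫ x, ((Ω : ℂ) * (conj (φ x) * Lz φ x)).re
      = ((Ω : ℂ) * ∫ x, conj (φ x) * Lz φ x).re := h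
  rw [h', Complex.re_ofReal_mul, rotEnergy, neg_mul]

lemma integrable_quadDensity (H : Admissible p β V Ω θ C) {φ : E d → ℂ} (hφ : MemX V φ) :
    Integrable (fun x => quadDensity V Ω x (φ x) (grad φ x)) volume :=
  (((integrable_gradSq hφ.1).const_mul _).add hφ.2).sub (H.integrable_rotDensity hφ)

lemma quadEnergy_eq (H : Admissible p β V Ω θ C) {φ : E d → ℂ} (hφ : MemX V φ) :
    quadEnergy V Ω φ = ∫ x, quadDensity V Ω x (φ x) (grad φ x) := by
  have i1 : Integrable (fun x => 1 / 2 * ∑ j, ‖grad φ x j‖ ^ 2 + V x * ‖φ x‖ ^ 2) volume :=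
    ((integrable_gradSq hφ.1).const_mul _).add hφ.2
  simp only [quadDensity]
  rw [integral_sub i1 (H.integrable_rotDensity hφ), integral_add ((integrable_gradSq hφ.1).const_mul _) hφ.2, integral_const_mul, quadEnergy,
    H.rotEnergy_eq hφ]
  rfl

lemma memLp_power (H : Admissible p β V Ω θ C) {φ : E d → ℂ} (hφ : MemH1 φ) :
    MemLp φ (ENNReal.ofReal (p + 1)) volume :=
  hφ.memLp_rpow H.one_le_dim (by linarith [H.one_lt_p]) H.subcritical

lemma integrable_power (H : Admissible p β V Ω θ C) {φ : E d → ℂ} (hφ : MemH1 φ) :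
    Integrable (fun x => ‖φ x‖ ^ (p + 1)) volume := by
  have hp : 0 < p + 1 := by linarith [H.one_lt_p]
  have := (H.memLp_power hφ).integrable_norm_rpow (by simpa using hp) (by simp)
  rwa [ENNReal.toReal_ofReal hp.le] at this

lemma integrable_actionDensity (H : Admissible p β V Ω θ C) (ω : ℝ) {φ : E d → ℂ}
    (hφ : MemX V φ) :
    Integrable (fun x => actionDensity p β V Ω ω x (φ x) (grad φ x)) volume :=
  ((H.integrable_quadDensity hφ).add ((H.integrable_power hφ.1).const_mul _)).add
    ((integrable_normSq hφ.1.1).const_mul _)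

lemma action_eq (H : Admissible p β V Ω θ C) (ω : ℝ) {φ : E d → ℂ} (hφ : MemX V φ) :
    action p β V Ω ω φ = ∫ x, actionDensity p β V Ω ω x (φ x) (grad φ x) := by
  have i1 : Integrable (fun x => quadDensity V Ω x (φ x) (grad φ x)
      + 2 * β / (p + 1) * ‖φ x‖ ^ (p + 1)) volume :=
    (H.integrable_quadDensity hφ).add ((H.integrable_power hφ.1).const_mul _)
  simp only [actionDensity]
  rw [integral_add i1 ((integrable_normSq hφ.1.1).const_mul _), integral_add (H.integrable_quadDensity hφ)
    ((H.integrable_power hφ.1).const_mul _), integral_const_mul, integral_const_mul,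
    ← H.quadEnergy_eq hφ]
  rfl

lemma quadEnergy_ge (H : Admissible p β V Ω θ C) {φ : E d → ℂ} (hφ : MemX V φ) :
    (1 - θ) * ((1 / 2) * ∑ j, mass (weakPartial j φ) + ∫ x, V x * ‖φ x‖ ^ 2) - C * mass φ
      ≤ quadEnergy V Ω φ := by
  have i1 := (((integrable_gradSq hφ.1).const_mul (1 / 2)).add hφ.2).const_mul (1 - θ)
  have i2 := (integrable_normSq hφ.1.1).const_mul C
  rw [H.quadEnergy_eq hφ, ← integral_gradSq hφ.1, mass, ← integral_const_mul C,
    ← integral_const_mul (1 / 2), ← integral_add ((integrable_gradSq hφ.1).const_mul (1 / 2)) hφ.2,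
    ← integral_const_mul, ← integral_sub]
  · exact integral_mono (i1.sub i2) (H.integrable_quadDensity hφ) fun x =>
      H.quadDensity_ge x (φ x) (grad φ x)
  · exact i1
  · exact i2

end Admissible

/-! ### Coercivity and convexity of the action -/

lemma exists_mul_sq_le_rpow {p c : ℝ} (hp : 1 < p) (hc : 0 < c) (D : ℝ) :
    ∃ K : ℝ, 0 ≤ K ∧ ∀ s : ℝ, 0 ≤ s → D * s ^ 2 ≤ c * s ^ (p + 1) + K := by
  set s₀ := (|D| / c) ^ (1 / (p - 1))
  have hs₀ : 0 ≤ s₀ := by positivity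
  refine ⟨|D| * s₀ ^ 2, by positivity, fun s hs => ?_⟩
  have h0 : 0 ≤ c * s ^ (p + 1) := by positivity
  rcases le_or_gt s s₀ with h | h
  · have : D * s ^ 2 ≤ |D| * s₀ ^ 2 := by
      have := le_abs_self D
      gcongr
    linarith
  · have hs' : 0 < s := hs₀.trans_lt h
    have h1 : |D| / c ≤ s ^ (p - 1) := by
      calc |D| / c = s₀ ^ (p - 1) := by
            rw [← Real.rpow_mul (by positivity), one_div_mul_cancel (by linarith), Real.rpow_one]
        _ ≤ s ^ (p - 1) := Real.rpow_le_rpow hs₀ h.le (by linarith)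
    have h2 : s ^ (p + 1) = s ^ (p - 1) * s ^ 2 := by
      rw [← Real.rpow_natCast s 2, ← Real.rpow_add hs']
      congr 1
      push_cast
      ring
    rw [div_le_iff₀ hc] at h1
    have h3 : D * s ^ 2 ≤ s ^ (p - 1) * c * s ^ 2 := by
      have := (le_abs_self D).trans h1
      gcongr
    have h4 : 0 ≤ |D| * s₀ ^ 2 := by positivity
    rw [h2]
    linarith

lemma norm_half_add_rpow_le {q : ℝ} (hq : 1 ≤ q) (a b : ℂ) :
    ‖(1 / 2 : ℂ) * (a + b)‖ ^ q ≤ 1 / 2 * ‖a‖ ^ q + 1 / 2 * ‖b‖ ^ q := by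
  have h1 : ‖(1 / 2 : ℂ) * (a + b)‖ ≤ 1 / 2 * ‖a‖ + 1 / 2 * ‖b‖ := by
    rw [norm_mul, ← mul_add]
    have : ‖(1 / 2 : ℂ)‖ = 1 / 2 := by norm_num
    rw [this]
    gcongr
    exact norm_add_le a b
  refine (Real.rpow_le_rpow (norm_nonneg _) h1 (by linarith)).trans ?_
  have := (convexOn_rpow hq).2 (norm_nonneg a) (norm_nonneg b) (by norm_num : (0 : ℝ) ≤ 1 / 2)
    (by norm_num : (0 : ℝ) ≤ 1 / 2) (by norm_num)
  simpa using this

lemma grad_ae_add {φ ψ : E d → ℂ} (hφ : MemH1 φ) (hψ : MemH1 ψ) :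
    ∀ᵐ x, grad (φ + ψ) x = grad φ x + grad ψ x := by
  filter_upwards [ae_all_iff.2 fun j => weakPartial_add hφ hψ j] with x hx
  funext j
  exact hx j

lemma grad_ae_sub {φ ψ : E d → ℂ} (hφ : MemH1 φ) (hψ : MemH1 ψ) :
    ∀ᵐ x, grad (φ - ψ) x = grad φ x - grad ψ x := by
  filter_upwards [ae_all_iff.2 fun j => weakPartial_sub hφ hψ j] with x hx
  funext j
  exact hx j

lemma grad_ae_smul {φ : E d → ℂ} (hφ : MemH1 φ) (c : ℂ) :
    ∀ᵐ x, grad (c • φ) x = c • grad φ x := by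
  filter_upwards [ae_all_iff.2 fun j => weakPartial_const_smul hφ c j] with x hx
  funext j
  exact hx j

lemma mass_weakPartial_half_sub {φ ψ : E d → ℂ} (hφ : MemH1 φ) (hψ : MemH1 ψ) (j : Fin d) : mass (weakPartial j ((1 / 2 : ℂ) • (φ - ψ)))
      = 1 / 4 * mass (weakPartial j φ - weakPartial j ψ) := by
  rw [mass_congr (weakPartial_const_smul (hφ.sub hψ) (1 / 2) j), mass_const_smul,
    mass_congr (weakPartial_sub hφ hψ j)]
  norm_num

/-- Fatou's lemma for a nonnegative sequence with bounded integrals. -/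
lemma integrable_and_integral_le_of_tendsto {F : ℕ → E d → ℝ} {F' : E d → ℝ}
    (hF : ∀ n, Integrable (F n) volume) (h0 : ∀ n x, 0 ≤ F n x)
    (h : ∀ᵐ x, Tendsto (fun n => F n x) atTop (𝓝 (F' x))) {L : ℝ}
    (hL : ∀ᶠ n in atTop, ∫ x, F n x ≤ L) : Integrable F' volume ∧ ∫ x, F' x ≤ L := by
  have hm : AEStronglyMeasurable F' volume :=
    aestronglyMeasurable_of_tendsto_ae atTop (fun n => (hF n).1) h
  have h0' : 0 ≤ᵐ[volume] F' := h.mono fun x hx => ge_of_tendsto' hx fun n => h0 n x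
  have hL0 : 0 ≤ L := by
    obtain ⟨n, hn⟩ := hL.exists
    exact (integral_nonneg (h0 n)).trans hn
  have key : ∫⁻ x, ENNReal.ofReal (F' x) ≤ ENNReal.ofReal L := by
    have e : ∫⁻ x, ENNReal.ofReal (F' x)
        = ∫⁻ x, liminf (fun n => ENNReal.ofReal (F n x)) atTop := by
      refine lintegral_congr_ae (h.mono fun x hx => ?_)
      exact ((ENNReal.tendsto_ofReal hx).liminf_eq).symm
    rw [e]
    refine (lintegral_liminf_le' fun n => (hF n).1.aemeasurable.ennreal_ofReal).trans ?_
    refine liminf_le_of_frequently_le' (hL.mono fun n hn => ?_).frequently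
    rw [← ofReal_integral_eq_lintegral_ofReal (hF n) (ae_of_all _ (h0 n))]
    exact ENNReal.ofReal_le_ofReal hn
  have hint : Integrable F' volume := by
    refine ⟨hm, ?_⟩
    rw [hasFiniteIntegral_iff_ofReal h0']
    exact key.trans_lt ENNReal.ofReal_lt_top
  refine ⟨hint, ?_⟩
  rwa [← ofReal_integral_eq_lintegral_ofReal hint h0', ENNReal.ofReal_le_ofReal_iff hL0] at key

lemma exists_subseq_forall_ae {f : Fin d → ℕ → E d → ℂ} {g : Fin d → E d → ℂ}
    (hf : ∀ j n, MemLp (f j n) 2 volume) (hg : ∀ j, MemLp (g j) 2 volume)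
    (h : ∀ j, Tendsto (fun n => mass (f j n - g j)) atTop (𝓝 0)) (s : Finset (Fin d)) :
    ∃ σ : ℕ → ℕ, StrictMono σ ∧
      ∀ j ∈ s, ∀ᵐ x, Tendsto (fun n => f j (σ n) x) atTop (𝓝 (g j x)) := by
  induction s using Finset.induction_on with
  | empty => exact ⟨id, strictMono_id, by simp⟩
  | insert i s _ ih =>
    obtain ⟨σ, hσ, h1⟩ := ih
    obtain ⟨τ, hτ, h2⟩ := exists_subseq_tendsto_ae (fun n => hf i (σ n)) (hg i)
      ((h i).comp hσ.tendsto_atTop)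
    refine ⟨σ ∘ τ, hσ.comp hτ, fun j hj => ?_⟩
    rcases Finset.mem_insert.1 hj with rfl | hj
    · exact h2
    · exact (h1 j hj).mono fun x hx => hx.comp hτ.tendsto_atTop

lemma continuous_lzSymbol (x : E d) : Continuous (lzSymbol x) := by
  unfold lzSymbol
  split_ifs <;> fun_prop

lemma continuous_actionDensity {p : ℝ} (hp : 1 < p) (β : ℝ) (V : E d → ℝ) (Ω ω : ℝ) (x : E d) :
    Continuous fun ab : ℂ × (Fin d → ℂ) => actionDensity p β V Ω ω x ab.1 ab.2 := by
  have h1 : Continuous fun ab : ℂ × (Fin d → ℂ) => lzSymbol x ab.2 :=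
    (continuous_lzSymbol x).comp continuous_snd
  have h2 : Continuous fun ab : ℂ × (Fin d → ℂ) => ‖ab.1‖ ^ (p + 1) :=
    continuous_fst.norm.rpow_const fun _ => Or.inr (by linarith)
  have h3 : Continuous fun ab : ℂ × (Fin d → ℂ) => conj ab.1 :=
    Complex.continuous_conj.comp continuous_fst
  unfold actionDensity quadDensity rotDensity
  fun_prop

lemma tendsto_of_continuous_prod {β : Type*} [TopologicalSpace β] {F : ℂ → β → ℝ}
    (hF : Continuous fun ab : ℂ × β => F ab.1 ab.2) {a : ℕ → ℂ} {b : ℕ → β} {a' : ℂ} {b' : β}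
    (ha : Tendsto a atTop (𝓝 a')) (hb : Tendsto b atTop (𝓝 b')) :
    Tendsto (fun n => F (a n) (b n)) atTop (𝓝 (F a' b')) :=
  (hF.tendsto (a', b')).comp (ha.prodMk_nhds hb)

lemma tendsto_actionDensity {p : ℝ} (hp : 1 < p) (β : ℝ) (V : E d → ℝ) (Ω ω : ℝ) (x : E d)
    {a : ℕ → ℂ} {b : ℕ → Fin d → ℂ} {a' : ℂ} {b' : Fin d → ℂ} (ha : Tendsto a atTop (𝓝 a'))
    (hb : Tendsto b atTop (𝓝 b')) :
    Tendsto (fun n => actionDensity p β V Ω ω x (a n) (b n)) atTop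
      (𝓝 (actionDensity p β V Ω ω x a' b')) :=
  tendsto_of_continuous_prod (F := actionDensity p β V Ω ω x)
    (continuous_actionDensity hp β V Ω ω x) ha hb

/-- `f` is a minimizing sequence of `S_{Ω,ω}` on `X`. -/
def IsMinimizingSeq (p β : ℝ) (V : E d → ℝ) (Ω ω : ℝ) (f : ℕ → E d → ℂ) : Prop :=
  (∀ n, MemX V (f n)) ∧ ∀ φ, MemX V φ → ∀ ε > 0, ∀ᶠ n in atTop,
    action p β V Ω ω (f n) ≤ action p β V Ω ω φ + ε

/-- `φ` is a global minimizer of `S_{Ω,ω}` on `X`. -/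
def IsMinimizer (p β : ℝ) (V : E d → ℝ) (Ω ω : ℝ) (φ : E d → ℂ) : Prop :=
  MemX V φ ∧ ∀ ψ, MemX V ψ → action p β V Ω ω φ ≤ action p β V Ω ω ψ

lemma action_shift (p β : ℝ) (V : E d → ℝ) (Ω ω ω' : ℝ) (φ : E d → ℂ) :
    action p β V Ω ω' φ = action p β V Ω ω φ + (ω' - ω) * mass φ := by
  simp only [action]; ring

namespace Admissible

variable {p β : ℝ} {V : E d → ℝ} {Ω θ C : ℝ}

lemma exists_actionDensity_ge (H : Admissible p β V Ω θ C) (ω : ℝ) :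
    ∃ κ : ℝ, 0 < κ ∧ ∃ K R : ℝ, ∀ (x : E d) (a : ℂ) (b : Fin d → ℂ),
      κ * (∑ j, ‖b j‖ ^ 2 + V x * ‖a‖ ^ 2 + ‖a‖ ^ 2)
        - (Metric.ball (0 : E d) R).indicator (fun _ => K) x ≤ actionDensity p β V Ω ω x a b := by
  set κ := (1 - θ) / 2
  have hκ : 0 < κ := by have := H.θ_lt_one; simp only [κ]; linarith
  set D := C - ω + κ
  obtain ⟨K, hK0, hK⟩ := exists_mul_sq_le_rpow H.one_lt_p H.c0_pos D
  obtain ⟨R, hR⟩ := exists_forall_weight_ge H.tendsto (D / κ)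
  refine ⟨κ, hκ, K, R, fun x a b => ?_⟩
  have h1 := H.quadDensity_ge x a b
  have h2 : (1 - θ) = 2 * κ := by simp only [κ]; ring
  rw [h2] at h1
  have h3 : 0 ≤ V x * ‖a‖ ^ 2 := mul_nonneg (H.nonneg x) (by positivity)
  have h4 : 0 ≤ 2 * β / (p + 1) * ‖a‖ ^ (p + 1) := mul_nonneg H.c0_pos.le (by positivity)
  have key : D * ‖a‖ ^ 2 ≤ κ * (V x * ‖a‖ ^ 2) + 2 * β / (p + 1) * ‖a‖ ^ (p + 1)
      + (Metric.ball (0 : E d) R).indicator (fun _ => K) x := by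
    -- inside the ball the power absorbs the negative multiple of `|a|²`, outside the potential does
    by_cases hx : x ∈ Metric.ball (0 : E d) R
    · rw [Set.indicator_of_mem hx]
      have := hK ‖a‖ (norm_nonneg a)
      have : 0 ≤ κ * (V x * ‖a‖ ^ 2) := by positivity
      linarith
    · rw [Set.indicator_of_notMem hx]
      have h5 := hR x hx
      rw [div_le_iff₀ hκ] at h5
      have := mul_le_mul_of_nonneg_right h5 (sq_nonneg ‖a‖)
      linarith
  simp only [actionDensity]
  simp only [D] at key
  linarith

/-- The action controls the norm of `X`. -/
lemma exists_action_ge (H : Admissible p β V Ω θ C) (ω : ℝ) :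
    ∃ κ : ℝ, 0 < κ ∧ ∃ K : ℝ, ∀ φ : E d → ℂ, MemX V φ →
      κ * (∑ j, mass (weakPartial j φ) + (∫ x, V x * ‖φ x‖ ^ 2) + mass φ) - K
        ≤ action p β V Ω ω φ := by
  obtain ⟨κ, hκ, K, R, h⟩ := H.exists_actionDensity_ge ω
  refine ⟨κ, hκ, ∫ x, (Metric.ball (0 : E d) R).indicator (fun _ => K) x, fun φ hφ => ?_⟩
  have i0 : Integrable ((Metric.ball (0 : E d) R).indicator fun _ => K) volume :=
    (integrable_indicator_iff measurableSet_ball).2 (integrableOn_const (volume_ball_ne_top R))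
  have i1 : Integrable (fun x => ∑ j, ‖grad φ x j‖ ^ 2 + V x * ‖φ x‖ ^ 2) volume :=
    (integrable_gradSq hφ.1).add hφ.2
  have i2 : Integrable (fun x => ∑ j, ‖grad φ x j‖ ^ 2 + V x * ‖φ x‖ ^ 2 + ‖φ x‖ ^ 2) volume :=
    i1.add (integrable_normSq hφ.1.1)
  rw [H.action_eq ω hφ, ← integral_gradSq hφ.1, mass, ← integral_add (integrable_gradSq hφ.1) hφ.2,
    ← integral_add i1 (integrable_normSq hφ.1.1), ← integral_const_mul,
    ← integral_sub (i2.const_mul κ) i0]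
  exact integral_mono ((i2.const_mul κ).sub i0) (H.integrable_actionDensity ω hφ) fun x =>
    h x (φ x) (grad φ x)

lemma bddBelow_action (H : Admissible p β V Ω θ C) (ω : ℝ) :
    BddBelow (action p β V Ω ω '' {φ | MemX V φ}) := by
  obtain ⟨κ, hκ, K, hK⟩ := H.exists_action_ge ω
  refine ⟨-K, ?_⟩
  rintro _ ⟨φ, hφ, rfl⟩
  have h1 := hK φ hφ
  have h2 : 0 ≤ ∑ j, mass (weakPartial j φ) := Finset.sum_nonneg fun j _ => mass_nonneg _
  have h3 : 0 ≤ ∫ x, V x * ‖φ x‖ ^ 2 :=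
    integral_nonneg fun x => mul_nonneg (H.nonneg x) (by positivity)
  have := mul_nonneg hκ.le (add_nonneg (add_nonneg h2 h3) (mass_nonneg φ))
  linarith

/-- Convexity of the action up to the mass: the parallelogram identity for the quadratic part and
the convexity of the power. -/
lemma action_midpoint_le (H : Admissible p β V Ω θ C) (ω : ℝ) {φ ψ : E d → ℂ} (hφ : MemX V φ)
    (hψ : MemX V ψ) :
    action p β V Ω ω ((1 / 2 : ℂ) • (φ + ψ)) + (quadEnergy V Ω ((1 / 2 : ℂ) • (φ - ψ))
      + ω * mass ((1 / 2 : ℂ) • (φ - ψ)))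
      ≤ 1 / 2 * action p β V Ω ω φ + 1 / 2 * action p β V Ω ω ψ := by
  have hs : MemX V (φ + ψ) := hφ.add H.aemeasurable H.nonneg hψ
  have ht : MemX V (φ - ψ) := hφ.sub H.aemeasurable H.nonneg hψ
  have hs' := hs.const_smul (1 / 2)
  have ht' := ht.const_smul (1 / 2)
  have i1 := H.integrable_actionDensity ω hs'
  have i2 := H.integrable_quadDensity ht'
  have i3 := (integrable_normSq ht'.1.1).const_mul ω
  have i23 : Integrable (fun x => quadDensity V Ω x (((1 / 2 : ℂ) • (φ - ψ)) x)
      (grad ((1 / 2 : ℂ) • (φ - ψ)) x) + ω * ‖((1 / 2 : ℂ) • (φ - ψ)) x‖ ^ 2) volume := i2.add i3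
  have i4 := (H.integrable_actionDensity ω hφ).const_mul (1 / 2)
  have i5 := (H.integrable_actionDensity ω hψ).const_mul (1 / 2)
  rw [H.action_eq ω hφ, H.action_eq ω hψ, H.action_eq ω hs', H.quadEnergy_eq ht', mass,
    ← integral_const_mul, ← integral_const_mul, ← integral_const_mul, ← integral_add i2 i3,
    ← integral_add i1 i23, ← integral_add i4 i5]
  refine integral_mono_ae (i1.add i23) (i4.add i5) ?_
  filter_upwards [grad_ae_smul hs.1 (1 / 2), grad_ae_smul ht.1 (1 / 2), grad_ae_add hφ.1 hψ.1,
    grad_ae_sub hφ.1 hψ.1] with x h1 h2 h3 h4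
  rw [h3] at h1
  rw [h4] at h2
  have q := quadDensity_parallelogram V Ω x (φ x) (ψ x) (grad φ x) (grad ψ x)
  have m := parallelogram_complex (φ x) (ψ x)
  have w := mul_le_mul_of_nonneg_left (norm_half_add_rpow_le (by linarith [H.one_lt_p] :
    1 ≤ p + 1) (φ x) (ψ x)) H.c0_pos.le
  simp only [Pi.add_apply, Pi.smul_apply, Pi.sub_apply, smul_eq_mul, h1, h2, actionDensity]
  linear_combination q + w + ω * m

lemma actionDensity_nonneg (H : Admissible p β V Ω θ C) (x : E d) (a : ℂ) (b : Fin d → ℂ) :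
    0 ≤ actionDensity p β V Ω C x a b := by
  have h1 := H.quadDensity_ge x a b
  have h2 : 0 ≤ (1 - θ) * ((1 / 2) * ∑ j, ‖b j‖ ^ 2 + V x * ‖a‖ ^ 2) :=
    mul_nonneg (by linarith [H.θ_lt_one]) (add_nonneg (by positivity)
      (mul_nonneg (H.nonneg x) (by positivity)))
  have h4 : 0 ≤ 2 * β / (p + 1) * ‖a‖ ^ (p + 1) := mul_nonneg H.c0_pos.le (by positivity)
  simp only [actionDensity]
  linarith

/-- Lower semicontinuity of the action under strong convergence in `H¹`. -/
lemma memX_and_action_le (H : Admissible p β V Ω θ C) (ω : ℝ) {f : ℕ → E d → ℂ} {φ : E d → ℂ}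
    {g : Fin d → E d → ℂ} (hf : ∀ n, MemX V (f n)) (hφ : MemLp φ 2 volume)
    (hg : ∀ j, MemLp (g j) 2 volume) (h1 : Tendsto (fun n => mass (f n - φ)) atTop (𝓝 0))
    (h2 : ∀ j, Tendsto (fun n => mass (weakPartial j (f n) - g j)) atTop (𝓝 0)) {M : ℝ}
    (hM : ∀ n, ∫ x, V x * ‖f n x‖ ^ 2 ≤ M) :
    MemX V φ ∧ ∀ L, (∀ ε > 0, ∀ᶠ n in atTop, action p β V Ω ω (f n) ≤ L + ε) →
      action p β V Ω ω φ ≤ L := by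
  have hw : ∀ j, HasWeakPartial j φ (g j) := fun j =>
    HasWeakPartial.of_tendsto (fun n => (hf n).1.1) (fun n => (hf n).1.memLp_weakPartial j) hφ
      (hg j) (fun n => (hf n).1.hasWeakPartial j) h1 (h2 j)
  have hH : MemH1 φ := ⟨hφ, fun j => ⟨g j, hg j, hw j⟩⟩
  obtain ⟨σ, hσ, a1⟩ := exists_subseq_forall_ae
    (fun j n => (hf n).1.memLp_weakPartial j) hg h2 Finset.univ
  obtain ⟨τ, hτ, a2⟩ := exists_subseq_tendsto_ae (fun n => (hf (σ n)).1.1) hφ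
    (h1.comp hσ.tendsto_atTop)
  have hστ : Tendsto (fun n => σ (τ n)) atTop atTop := (hσ.comp hτ).tendsto_atTop
  have hX : MemX V φ := by
    refine ⟨hH, (integrable_and_integral_le_of_tendsto (fun n => (hf (σ (τ n))).2)
      (fun n x => mul_nonneg (H.nonneg x) (by positivity)) ?_
      (Eventually.of_forall fun n => hM (σ (τ n)))).1⟩
    filter_upwards [a2] with x hx
    exact (hx.norm.pow 2).const_mul (V x)
  refine ⟨hX, fun L hL => le_of_forall_pos_le_add fun ε hε => ?_⟩
  -- Fatou's lemma is applied at frequency `C`, where the density is nonnegative; the masses converge,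
  -- so that this is enough for every `ω`
  have hmass := (tendsto_mass (fun n => (hf n).1.1) hφ h1).comp hστ
  have hmass' : ∀ᶠ n in atTop, (C - ω) * mass (f (σ (τ n))) ≤ (C - ω) * mass φ + ε / 2 := by
    have := hmass.const_mul (C - ω)
    exact (this.eventually_lt_const (lt_add_of_pos_right _ (half_pos hε))).mono fun n hn => hn.le
  have hlim : ∀ᵐ x, Tendsto (fun n => actionDensity p β V Ω C x (f (σ (τ n)) x)
      (grad (f (σ (τ n))) x)) atTop (𝓝 (actionDensity p β V Ω C x (φ x) (grad φ x))) := by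
    filter_upwards [a2, ae_all_iff.2 fun j => a1 j (Finset.mem_univ j),
      ae_all_iff.2 fun j => (hw j).weakPartial_ae_eq] with x b1 b2 b3
    refine tendsto_actionDensity H.one_lt_p β V Ω C x b1 (tendsto_pi_nhds.2 fun j => ?_)
    have b4 : grad φ x j = g j x := b3 j
    rw [b4]
    exact (b2 j).comp hτ.tendsto_atTop
  have key := (integrable_and_integral_le_of_tendsto (L := L + ε + (C - ω) * mass φ)
    (fun n => H.integrable_actionDensity C (hf (σ (τ n))))
    (fun n x => H.actionDensity_nonneg x _ _) hlim ?_).2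
  · rw [← H.action_eq C hX, action_shift p β V Ω ω C] at key
    linarith
  · filter_upwards [hmass', hστ.eventually (hL (ε / 2) (half_pos hε))] with n c1 c2
    rw [← H.action_eq C (hf _), action_shift p β V Ω ω C]
    linarith

/-- Minimizing sequences of the action converge, along a subsequence, to a minimizer, and the
masses converge. -/
lemma exists_minimizer_of_seq (H : Admissible p β V Ω θ C) {ω : ℝ} {f : ℕ → E d → ℂ}
    (hf : IsMinimizingSeq p β V Ω ω f) :
    ∃ φ, IsMinimizer p β V Ω ω φ ∧ ∃ σ : ℕ → ℕ, StrictMono σ ∧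
      Tendsto (fun n => mass (f (σ n))) atTop (𝓝 (mass φ)) := by
  obtain ⟨κ, hκ, K, hK⟩ := H.exists_action_ge ω
  have hnn : ∀ φ, MemX V φ → 0 ≤ ∑ j, mass (weakPartial j φ) ∧ 0 ≤ ∫ x, V x * ‖φ x‖ ^ 2 :=
    fun φ hφ => ⟨Finset.sum_nonneg fun j _ => mass_nonneg _,
      integral_nonneg fun x => mul_nonneg (H.nonneg x) (by positivity)⟩
  -- the infimum of the action
  set A : Set ℝ := action p β V Ω ω '' {φ | MemX V φ}
  have hAb : BddBelow A := H.bddBelow_action ω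
  have hAne : A.Nonempty := ⟨_, f 0, hf.1 0, rfl⟩
  have hinf : ∀ φ, MemX V φ → sInf A ≤ action p β V Ω ω φ := fun φ hφ =>
    csInf_le hAb ⟨φ, hφ, rfl⟩
  have hmin : ∀ ε > 0, ∀ᶠ n in atTop, action p β V Ω ω (f n) ≤ sInf A + ε := fun ε hε => by
    obtain ⟨_, ⟨φ, hφ, rfl⟩, h1⟩ := Real.lt_sInf_add_pos hAne (half_pos hε)
    filter_upwards [hf.2 φ hφ (ε / 2) (half_pos hε)] with n hn
    linarith
  obtain ⟨N₀, hN₀⟩ := eventually_atTop.1 (hmin 1 one_pos)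
  set M := (sInf A + 1 + K) / κ
  have hbound : ∀ n, ∑ j, mass (weakPartial j (f (n + N₀)))
      + (∫ x, V x * ‖f (n + N₀) x‖ ^ 2) + mass (f (n + N₀)) ≤ M := fun n => by
    have h1 := hK _ (hf.1 (n + N₀))
    have h2 := hN₀ (n + N₀) (by omega)
    rw [le_div_iff₀ hκ]
    linarith
  -- the shift by `N₀` makes the bound hold along the whole sequence
  obtain ⟨σ, hσ, hcauchy⟩ := exists_subseq_cauchy H.aemeasurable H.nonneg H.tendsto
    (f := fun n => f (n + N₀)) (M := M) (fun n => hf.1 _)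
    (fun n => by have := hbound n; have := hnn _ (hf.1 (n + N₀)); linarith)
    (fun n => by
      have := hbound n; have := hnn _ (hf.1 (n + N₀)); have := mass_nonneg (f (n + N₀)); linarith)
    (fun n => by
      have := hbound n; have := hnn _ (hf.1 (n + N₀)); have := mass_nonneg (f (n + N₀)); linarith)
  set g : ℕ → E d → ℂ := fun n => f (σ n + N₀)
  have hgX : ∀ n, MemX V (g n) := fun n => hf.1 _
  have hmono : StrictMono fun n => σ n + N₀ := fun a b hab => by
    have := hσ hab
    simp only
    omega
  have hgmin : ∀ ε > 0, ∀ᶠ n in atTop, action p β V Ω ω (g n) ≤ sInf A + ε := fun ε hε =>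
    hmono.tendsto_atTop.eventually (hmin ε hε)
  obtain ⟨φ, hφ, hlim⟩ := exists_tendsto_of_cauchy (fun n => (hgX n).1.1) hcauchy
  -- strong convergence of the gradients, by the parallelogram identity
  have hgrad : ∀ j, ∀ ε > 0, ∃ N, ∀ m ≥ N, ∀ n ≥ N,
      mass (weakPartial j (g m) - weakPartial j (g n)) < ε := by
    intro j ε hε
    set B := |C| + |ω| + 1
    have hB : 0 < B := by positivity
    have hθ : 0 < 1 - θ := by linarith [H.θ_lt_one]
    set ε' := (1 - θ) * ε / 32
    have hε' : 0 < ε' := by positivity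
    obtain ⟨N₁, hN₁⟩ := eventually_atTop.1 (hgmin ε' hε')
    obtain ⟨N₂, hN₂⟩ := hcauchy (ε' / B) (by positivity)
    refine ⟨max N₁ N₂, fun m hm n hn => ?_⟩
    have b1 := hN₁ m ((le_max_left _ _).trans hm)
    have b2 := hN₁ n ((le_max_left _ _).trans hn)
    have b3 := hN₂ m ((le_max_right _ _).trans hm) n ((le_max_right _ _).trans hn)
    change mass (g m - g n) < ε' / B at b3
    rw [lt_div_iff₀ hB] at b3
    have hD : MemX V ((1 / 2 : ℂ) • (g m - g n)) :=
      ((hgX m).sub H.aemeasurable H.nonneg (hgX n)).const_smul _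
    -- the midpoint has action at least `sInf A`, which bounds the energy of the half difference
    have b4 := H.action_midpoint_le ω (hgX m) (hgX n)
    have b5 := hinf _ (((hgX m).add H.aemeasurable H.nonneg (hgX n)).const_smul (1 / 2))
    have b6 := H.quadEnergy_ge hD
    have b7 : mass ((1 / 2 : ℂ) • (g m - g n)) = 1 / 4 * mass (g m - g n) := by
      rw [mass_const_smul]; norm_num
    have b8 : mass (weakPartial j ((1 / 2 : ℂ) • (g m - g n)))
        ≤ ∑ j, mass (weakPartial j ((1 / 2 : ℂ) • (g m - g n))) :=
      Finset.single_le_sum (f := fun j => mass (weakPartial j ((1 / 2 : ℂ) • (g m - g n))))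
        (fun j _ => mass_nonneg _) (Finset.mem_univ j)
    rw [mass_weakPartial_half_sub (hgX m).1 (hgX n).1] at b8
    have b9 := (hnn _ hD).2
    rw [b7] at b4 b6
    set μ := mass (g m - g n)
    have hμ : 0 ≤ μ := mass_nonneg _
    set S := ∑ j, mass (weakPartial j ((1 / 2 : ℂ) • (g m - g n)))
    have b10 : C * μ - ω * μ ≤ μ * B := by
      have := le_abs_self C
      have := neg_abs_le ω
      simp only [B]
      nlinarith
    have b11 : 0 ≤ (1 - θ) * ∫ x, V x * ‖((1 / 2 : ℂ) • (g m - g n)) x‖ ^ 2 :=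
      mul_nonneg hθ.le b9
    have b12 : (1 - θ) * (1 / 2 * S) ≤ ε' + 1 / 4 * ε' := by linarith
    have b13 : (1 - θ) * (1 / 8 * mass (weakPartial j (g m) - weakPartial j (g n)))
        ≤ (1 - θ) * (1 / 2 * S) := mul_le_mul_of_nonneg_left (by linarith) hθ.le
    have b14 : (1 - θ) * mass (weakPartial j (g m) - weakPartial j (g n)) < (1 - θ) * ε := by
      simp only [ε'] at b12
      nlinarith
    exact lt_of_mul_lt_mul_left b14 hθ.le
  choose G hG hGlim using fun j =>
    exists_tendsto_of_cauchy (fun n => (hgX n).1.memLp_weakPartial j) (hgrad j)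
  obtain ⟨hX, hle⟩ := H.memX_and_action_le ω hgX hφ hG hlim hGlim (M := M) fun n => by
    have := hbound (σ n)
    have := hnn _ (hgX n)
    have := mass_nonneg (g n)
    change ∫ x, V x * ‖f (σ n + N₀) x‖ ^ 2 ≤ M
    linarith
  refine ⟨φ, ⟨hX, fun ψ hψ => (hle _ hgmin).trans (hinf ψ hψ)⟩, fun n => σ n + N₀, hmono, ?_⟩
  exact tendsto_mass (fun n => (hgX n).1.1) hφ hlim

/-- Minimizers of the action exist. -/
lemma exists_minimizer (H : Admissible p β V Ω θ C) (hX : ∃ φ, MemX V φ) (ω : ℝ) :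
    ∃ φ, IsMinimizer p β V Ω ω φ := by
  set A : Set ℝ := action p β V Ω ω '' {φ | MemX V φ}
  have hAb : BddBelow A := H.bddBelow_action ω
  obtain ⟨φ₀, hφ₀⟩ := hX
  have hAne : A.Nonempty := ⟨_, φ₀, hφ₀, rfl⟩
  have hseq : ∀ n : ℕ, ∃ φ, MemX V φ ∧ action p β V Ω ω φ < sInf A + 1 / ((n : ℝ) + 1) :=
    fun n => by
      obtain ⟨_, ⟨φ, hφ, rfl⟩, h1⟩ := Real.lt_sInf_add_pos hAne
        (show (0 : ℝ) < 1 / ((n : ℝ) + 1) by positivity)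
      exact ⟨φ, hφ, h1⟩
  choose f hf1 hf2 using hseq
  obtain ⟨φ, hφ, -⟩ := H.exists_minimizer_of_seq (ω := ω) (f := f) ⟨hf1, fun ψ hψ ε hε => by
    filter_upwards [tendsto_one_div_add_atTop_nhds_zero_nat.eventually_lt_const hε] with n hn
    have h1 := csInf_le hAb ⟨ψ, hψ, rfl⟩
    have h2 := hf2 n
    linarith⟩
  exact ⟨φ, hφ⟩

end Admissible

/-! ### Symmetry of `L_z` -/

lemma HasWeakPartial.conj {j : Fin d} {φ g : E d → ℂ} (h : HasWeakPartial j φ g) :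
    HasWeakPartial j (fun x => conj (φ x)) (fun x => conj (g x)) := by
  refine ⟨fun x => ?_, fun η hη hc => ?_⟩
  · obtain ⟨s, hs, hi⟩ := h.1 x
    exact ⟨s, hs, (LinearIsometryEquiv.integrable_comp_iff Complex.conjLIE).2 hi⟩
  · have := congrArg (starRingEnd ℂ) (h.2 η hη hc)
    rw [map_neg, ← integral_conj, ← integral_conj] at this
    simpa using this

lemma MemH1.conj {φ : E d → ℂ} (hφ : MemH1 φ) : MemH1 (fun x => conj (φ x)) :=
  ⟨hφ.1.star, fun j => ⟨_, (hφ.memLp_weakPartial j).star, (hφ.hasWeakPartial j).conj⟩⟩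

/-- Integration by parts against a weight. -/
lemma integral_weight_mul_weakPartial {φ v : E d → ℂ} (hφ : MemH1 φ) (hv : MemH1 v) {w : E d → ℝ}
    (hw : ContDiff ℝ (⊤ : ℕ∞) w) (hwc : HasCompactSupport w) (j : Fin d) :
    ∫ x, (w x : ℂ) * conj (v x) * weakPartial j φ x
      = - ∫ x, ((w x : ℂ) * conj (weakPartial j v x)
        + (fderiv ℝ w x (EuclideanSpace.single j 1) : ℂ) * conj (v x)) * φ x := by
  have h := hφ.integral_mul_weakPartial (hv.conj.mul_test hw hwc) j
  refine h.trans (congrArg Neg.neg (integral_congr_ae ?_))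
  have h1 := (hv.conj.hasWeakPartial_mul hw hwc j).weakPartial_ae_eq
  have h2 := (hv.hasWeakPartial j).conj.weakPartial_ae_eq
  filter_upwards [h1, h2] with x h1 h2
  rw [h1, h2]
  simp

/-- A radial cutoff, equal to `1` on the ball of radius `n + 1`. -/
def radialCutoff (n : ℕ) (x : E d) : ℝ := Real.smoothTransition (2 - ‖x‖ ^ 2 / ((n : ℝ) + 1) ^ 2)

lemma contDiff_radialCutoff (n : ℕ) : ContDiff ℝ (⊤ : ℕ∞) (radialCutoff (d := d) n) :=
  Real.smoothTransition.contDiff.comp (contDiff_const.sub ((contDiff_norm_sq ℝ).div_const _))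

lemma hasCompactSupport_radialCutoff (n : ℕ) : HasCompactSupport (radialCutoff (d := d) n) := by
  refine HasCompactSupport.of_support_subset_isCompact
    (isCompact_closedBall (0 : E d) (2 * ((n : ℝ) + 1))) fun x hx => ?_
  rw [mem_closedBall_zero_iff]
  by_contra hcon
  rw [not_le] at hcon
  refine hx (Real.smoothTransition.zero_of_nonpos ?_)
  have h1 : (2 * ((n : ℝ) + 1)) ^ 2 ≤ ‖x‖ ^ 2 := by gcongr
  rw [sub_nonpos, le_div_iff₀ (by positivity)]
  nlinarith [sq_nonneg ((n : ℝ) + 1)]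

lemma abs_radialCutoff_le (n : ℕ) (x : E d) : |radialCutoff n x| ≤ 1 := by
  unfold radialCutoff
  rw [abs_of_nonneg (Real.smoothTransition.nonneg _)]
  exact Real.smoothTransition.le_one _

lemma tendsto_radialCutoff (x : E d) :
    Tendsto (fun n => radialCutoff n x) atTop (𝓝 1) := by
  refine tendsto_const_nhds.congr' ?_
  obtain ⟨N, hN⟩ := exists_nat_ge ‖x‖
  filter_upwards [eventually_ge_atTop N] with n hn
  refine (Real.smoothTransition.one_of_one_le ?_).symm
  have h1 : ‖x‖ ≤ (n : ℝ) + 1 := by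
    have : (N : ℝ) ≤ n := by exact_mod_cast hn
    linarith
  have : ‖x‖ ^ 2 / ((n : ℝ) + 1) ^ 2 ≤ 1 := by
    rw [div_le_one (by positivity)]
    gcongr
  linarith

lemma exists_fderiv_radialCutoff (n : ℕ) (x : E d) :
    ∃ ρ : ℝ, ∀ j, fderiv ℝ (radialCutoff n) x (EuclideanSpace.single j 1) = ρ * x j := by
  have h1 : HasFDerivAt (fun x : E d => 2 - ‖x‖ ^ 2 / ((n : ℝ) + 1) ^ 2)
      (-((((n : ℝ) + 1) ^ 2)⁻¹ • (2 • innerSL ℝ x))) x := by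
    have := ((hasStrictFDerivAt_norm_sq x).hasFDerivAt.const_mul (((n : ℝ) + 1) ^ 2)⁻¹).const_sub 2
    simpa only [div_eq_inv_mul] using this
  have h2 : HasDerivAt Real.smoothTransition _ (2 - ‖x‖ ^ 2 / ((n : ℝ) + 1) ^ 2) :=
    (Real.smoothTransition.contDiff (n := 1)).differentiable (by simp) _ |>.hasDerivAt
  have h3 : HasFDerivAt (radialCutoff n) _ x := h2.comp_hasFDerivAt x h1
  refine ⟨deriv Real.smoothTransition (2 - ‖x‖ ^ 2 / ((n : ℝ) + 1) ^ 2)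
    * -((((n : ℝ) + 1) ^ 2)⁻¹ * 2), fun j => ?_⟩
  rw [h3.fderiv]
  simp [EuclideanSpace.inner_single_right]
  ring

lemma fderiv_cutoff_mul_coord (n : ℕ) (x : E d) {i j : Fin d} (hij : i ≠ j) :
    fderiv ℝ (fun x : E d => radialCutoff n x * x i) x (EuclideanSpace.single j 1)
      = x i * fderiv ℝ (radialCutoff n) x (EuclideanSpace.single j 1) := by
  have h1 : HasFDerivAt (fun x : E d => x i) (EuclideanSpace.proj (𝕜 := ℝ) i) x :=
    (EuclideanSpace.proj (𝕜 := ℝ) i).hasFDerivAt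
  have h2 := ((contDiff_radialCutoff (d := d) n).differentiable (by simp) x).hasFDerivAt
  have h3 : fderiv ℝ (fun x : E d => radialCutoff n x * x i) x = _ := (h2.mul h1).fderiv
  rw [h3]
  simp [hij]

lemma contDiff_coord (i : Fin d) : ContDiff ℝ (⊤ : ℕ∞) fun x : E d => x i :=
  (EuclideanSpace.proj (𝕜 := ℝ) i).contDiff

/-- Symmetry of `L_z` against a radial cutoff. There is no error term, as `L_z` annihilates radial
functions. -/
lemma integral_cutoff_Lz {φ v : E d → ℂ} (hφ : MemH1 φ) (hv : MemH1 v) (n : ℕ) :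
    ∫ x, (radialCutoff n x : ℂ) * (Lz φ x * conj (v x))
      = ∫ x, (radialCutoff n x : ℂ) * (φ x * conj (Lz v x)) := by
  by_cases h2 : 2 ≤ d
  · set i : Fin d := ⟨0, by omega⟩
    set j : Fin d := ⟨1, by omega⟩
    have hij : i ≠ j := by simp [i, j]
    have hL : ∀ (f : E d → ℂ) x, Lz f x
        = Complex.I * ((x j : ℂ) * weakPartial i f x - (x i : ℂ) * weakPartial j f x) :=
      fun f x => by simp only [Lz, dif_pos h2, i, j]
    have hw : ∀ k : Fin d, ContDiff ℝ (⊤ : ℕ∞) fun x : E d => radialCutoff n x * x k :=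
      fun k => (contDiff_radialCutoff n).mul (contDiff_coord k)
    have hwc : ∀ k : Fin d, HasCompactSupport fun x : E d => radialCutoff n x * x k :=
      fun k => (hasCompactSupport_radialCutoff n).mul_right
    have hi : ∀ (k : Fin d) (f g : E d → ℂ), MemLp f 2 volume → MemLp g 2 volume →
        Integrable (fun x => ((radialCutoff n x * x k : ℝ) : ℂ) * (f x * g x)) volume :=
      fun k f g hf hg => integrable_test_smul (hf.integrable_mul hg).locallyIntegrable
        (hw k).continuous (hwc k)
    have e1 := integral_weight_mul_weakPartial hφ hv (hw j) (hwc j) i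
    have e2 := integral_weight_mul_weakPartial hφ hv (hw i) (hwc i) j
    have lhs : ∫ x, (radialCutoff n x : ℂ) * (Lz φ x * conj (v x))
        = Complex.I * ((∫ x, ((radialCutoff n x * x j : ℝ) : ℂ) * conj (v x) * weakPartial i φ x)
          - ∫ x, ((radialCutoff n x * x i : ℝ) : ℂ) * conj (v x) * weakPartial j φ x) := by
      rw [← integral_sub, ← integral_const_mul]
      · refine integral_congr_ae (ae_of_all _ fun x => ?_)
        simp only [hL]
        push_cast
        ring
      · simpa only [mul_assoc] using hi j _ _ hv.conj.1 (hφ.memLp_weakPartial i)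
      · simpa only [mul_assoc] using hi i _ _ hv.conj.1 (hφ.memLp_weakPartial j)
    have hsing : ∀ (k l : Fin d), Integrable (fun x => (((radialCutoff n x * x k : ℝ) : ℂ)
        * conj (weakPartial l v x) + (fderiv ℝ (fun x : E d => radialCutoff n x * x k) x
          (EuclideanSpace.single l 1) : ℂ) * conj (v x)) * φ x) volume := fun k l => by
      have a1 := hi k _ _ (hv.memLp_weakPartial l).star hφ.1
      have a2 := integrable_test_smul (hv.conj.1.integrable_mul hφ.1).locallyIntegrable
        (continuous_fderiv_apply (hw k) (EuclideanSpace.single l 1))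
        (hasCompactSupport_fderiv_apply (hwc k) (EuclideanSpace.single l 1))
      refine (a1.add a2).congr (ae_of_all _ fun x => ?_)
      simp
      ring
    rw [lhs, e1, e2, neg_sub_neg, ← integral_sub (hsing i j) (hsing j i), ← integral_const_mul]
    refine integral_congr_ae (ae_of_all _ fun x => ?_)
    obtain ⟨ρ, hρ⟩ := exists_fderiv_radialCutoff n x
    simp only [fderiv_cutoff_mul_coord n x hij, fderiv_cutoff_mul_coord n x hij.symm, hρ, hL]
    simp only [map_mul, map_sub, Complex.conj_I, Complex.conj_ofReal]
    push_cast
    ring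
  · have hL : ∀ (f : E d → ℂ) x, Lz f x = 0 := fun f x => by simp only [Lz, dif_neg h2]
    simp [hL]

namespace Admissible

variable {p β : ℝ} {V : E d → ℝ} {Ω θ C : ℝ}

/-- `L_z` is symmetric on `X`. -/
lemma integral_Lz_symm (H : Admissible p β V Ω θ C) {φ v : E d → ℂ} (hφ : MemX V φ)
    (hv : MemX V v) :
    ∫ x, (Ω : ℂ) * (Lz φ x * conj (v x)) = ∫ x, (Ω : ℂ) * (φ x * conj (Lz v x)) := by
  have i1 : Integrable (fun x => (Ω : ℂ) * (Lz φ x * conj (v x))) volume := by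
    simpa only [mul_comm (conj (v _))] using H.integrable_rot hv hφ.1
  have i2 : Integrable (fun x => (Ω : ℂ) * (φ x * conj (Lz v x))) volume := by
    have := (LinearIsometryEquiv.integrable_comp_iff Complex.conjLIE).2 (H.integrable_rot hφ hv.1)
    simpa using this
  have lim : ∀ F : E d → ℂ, Integrable F volume →
      Tendsto (fun n => ∫ x, (radialCutoff n x : ℂ) * F x) atTop (𝓝 (∫ x, F x)) := by
    intro F hF
    refine tendsto_integral_of_dominated_convergence (fun x => ‖F x‖) (fun n => ?_) hF.norm
      (fun n => ae_of_all _ fun x => ?_) (ae_of_all _ fun x => ?_)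
    · exact (Complex.continuous_ofReal.comp
        (contDiff_radialCutoff n).continuous).aestronglyMeasurable.mul hF.1
    · rw [norm_mul, Complex.norm_real]
      exact mul_le_of_le_one_left (norm_nonneg _) (abs_radialCutoff_le n x)
    · have : Tendsto (fun n => (radialCutoff n x : ℂ)) atTop (𝓝 ((1 : ℝ) : ℂ)) :=
        (Complex.continuous_ofReal.tendsto _).comp (tendsto_radialCutoff x)
      simpa using this.mul_const (F x)
  refine tendsto_nhds_unique (lim _ i1) ((lim _ i2).congr fun n => ?_)
  simp only [mul_left_comm _ (Ω : ℂ), integral_const_mul]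
  rw [integral_cutoff_Lz hφ.1 hv.1]

end Admissible

/-! ### The Euler–Lagrange equation -/

/-- The weak form of the stationary equation, tested against `v`. -/
def weakForm (p β : ℝ) (V : E d → ℝ) (Ω ω : ℝ) (φ v : E d → ℂ) : ℂ :=
  (1 / 2 : ℂ) * (∫ x, ∑ j : Fin d, weakPartial j φ x * conj (weakPartial j v x))
    + (∫ x, (V x : ℂ) * φ x * conj (v x))
    + (β : ℂ) * (∫ x, ((‖φ x‖ ^ (p - 1) : ℝ) : ℂ) * φ x * conj (v x))
    - (Ω : ℂ) * (∫ x, Lz φ x * conj (v x))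
    + (ω : ℂ) * (∫ x, φ x * conj (v x))

lemma weakForm_smul (p β : ℝ) (V : E d → ℝ) (Ω ω : ℝ) (φ : E d → ℂ) {v : E d → ℂ} (hv : MemH1 v)
    (c : ℂ) : weakForm p β V Ω ω φ (c • v) = conj c * weakForm p β V Ω ω φ v := by
  have e1 : ∫ x, ∑ j : Fin d, weakPartial j φ x * conj (weakPartial j (c • v) x)
      = conj c * ∫ x, ∑ j : Fin d, weakPartial j φ x * conj (weakPartial j v x) := by
    rw [← integral_const_mul]
    refine integral_congr_ae ?_
    filter_upwards [ae_all_iff.2 fun j => weakPartial_const_smul hv c j] with x hx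
    rw [Finset.mul_sum]
    refine Finset.sum_congr rfl fun j _ => ?_
    rw [hx j, Pi.smul_apply, smul_eq_mul, map_mul]
    ring
  have e2 : ∀ F : E d → ℂ, ∫ x, F x * conj ((c • v) x) = conj c * ∫ x, F x * conj (v x) :=
    fun F => by
      rw [← integral_const_mul]
      refine integral_congr_ae (ae_of_all _ fun x => ?_)
      simp only [Pi.smul_apply, smul_eq_mul, map_mul]
      ring
  simp only [weakForm, e1, e2]
  ring

/-- The polarization of the density of the quadratic part of the energy. -/
def crossDensity (V : E d → ℝ) (Ω : ℝ) (x : E d) (a a' : ℂ) (b b' : Fin d → ℂ) : ℝ :=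
  ∑ j, (b j * conj (b' j)).re + 2 * V x * (a * conj a').re
    - (rotDensity Ω x a' b + rotDensity Ω x a b')

lemma norm_add_ofReal_mul_sq (a b : ℂ) (t : ℝ) :
    ‖a + (t : ℂ) * b‖ ^ 2 = ‖a‖ ^ 2 + t * (2 * (a * conj b).re) + t ^ 2 * ‖b‖ ^ 2 := by
  simp only [Complex.sq_norm, Complex.normSq_apply]
  simp
  ring

lemma quadDensity_add_smul (V : E d → ℝ) (Ω : ℝ) (x : E d) (a a' : ℂ) (b b' : Fin d → ℂ) (t : ℝ) :
    quadDensity V Ω x (a + (t : ℂ) * a') (b + (t : ℂ) • b')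
      = quadDensity V Ω x a b + t * crossDensity V Ω x a a' b b'
        + t ^ 2 * quadDensity V Ω x a' b' := by
  have hs : ∑ j, ‖(b + (t : ℂ) • b') j‖ ^ 2 = ∑ j, ‖b j‖ ^ 2
      + t * (2 * ∑ j, (b j * conj (b' j)).re) + t ^ 2 * ∑ j, ‖b' j‖ ^ 2 := by
    rw [Finset.mul_sum, Finset.mul_sum, Finset.mul_sum, ← Finset.sum_add_distrib,
      ← Finset.sum_add_distrib]
    exact Finset.sum_congr rfl fun j _ => norm_add_ofReal_mul_sq (b j) (b' j) t
  have ha := norm_add_ofReal_mul_sq a a' t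
  have hr : rotDensity Ω x (a + (t : ℂ) * a') (b + (t : ℂ) • b')
      = rotDensity Ω x a b + t * (rotDensity Ω x a' b + rotDensity Ω x a b')
        + t ^ 2 * rotDensity Ω x a' b' := by
    simp only [rotDensity, lzSymbol_add, lzSymbol_smul, map_add, map_mul, Complex.conj_ofReal]
    simp
    ring
  simp only [quadDensity, crossDensity]
  linear_combination (1 / 2) * hs + V x * ha - hr

lemma hasDerivAt_norm_add_rpow {q : ℝ} (hq : 1 < q) (a b : ℂ) (t : ℝ) :
    HasDerivAt (fun t : ℝ => ‖a + (t : ℂ) * b‖ ^ q)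
      (q * ‖a + (t : ℂ) * b‖ ^ (q - 2) * ((a + (t : ℂ) * b) * conj b).re) t := by
  have h1 : HasDerivAt (fun t : ℝ => a + (t : ℂ) * b) b t := by
    simpa using ((Complex.ofRealCLM.hasDerivAt (x := t)).mul_const b).const_add a
  have h2 := (hasFDerivAt_norm_rpow (a + (t : ℂ) * b) hq).comp_hasDerivAt t h1
  refine h2.congr_deriv ?_
  simp only [smul_apply, innerSL_apply_apply, Complex.inner, smul_eq_mul]
  congr 1
  simp
  ring

lemma norm_rpow_mul_re_le {q : ℝ} (hq : 2 < q) {a b c : ℂ} (h : ‖c‖ ≤ ‖a‖ + ‖b‖) :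
    ‖c‖ ^ (q - 2) * ‖c * conj b‖ ≤ (‖a‖ + ‖b‖) ^ q := by
  rcases (norm_nonneg c).eq_or_lt with h0 | h0
  · rw [norm_mul, ← h0]
    simp only [zero_mul, mul_zero]
    positivity
  · have hs : 0 < ‖a‖ + ‖b‖ := h0.trans_le h
    rw [norm_mul, RCLike.norm_conj]
    have hb : ‖b‖ ≤ ‖a‖ + ‖b‖ := by linarith [norm_nonneg a]
    calc ‖c‖ ^ (q - 2) * (‖c‖ * ‖b‖)
        ≤ (‖a‖ + ‖b‖) ^ (q - 2) * ((‖a‖ + ‖b‖) * (‖a‖ + ‖b‖)) := by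
          gcongr
      _ = (‖a‖ + ‖b‖) ^ q := by
          rw [← sq, ← Real.rpow_natCast _ 2, ← Real.rpow_add hs]
          congr 1
          push_cast
          ring

lemma integrable_pairing {f g : E d → ℂ} (hf : MemLp f 2 volume) (hg : MemLp g 2 volume) :
    Integrable (fun x => f x * conj (g x)) volume := integrable_mul_of_memLp hf hg.star

lemma mass_add_smul {φ v : E d → ℂ} (hφ : MemLp φ 2 volume) (hv : MemLp v 2 volume) (t : ℝ) :
    mass (φ + (t : ℂ) • v)
      = mass φ + t * (2 * (∫ x, φ x * conj (v x)).re) + t ^ 2 * mass v := by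
  have i1 := integrable_normSq hφ
  have i2' : Integrable (fun x => (φ x * conj (v x)).re) volume := (integrable_pairing hφ hv).re
  have i2 := (i2'.const_mul 2).const_mul t
  have i3 := (integrable_normSq hv).const_mul (t ^ 2)
  have i12 : Integrable (fun x => ‖φ x‖ ^ 2 + t * (2 * (φ x * conj (v x)).re)) volume := i1.add i2
  have e : (∫ x, φ x * conj (v x)).re = ∫ x, (φ x * conj (v x)).re :=
    (integral_re (integrable_pairing hφ hv)).symm
  rw [e, mass, mass, mass, ← integral_const_mul, ← integral_const_mul, ← integral_const_mul,
    ← integral_add i1 i2, ← integral_add i12 i3]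
  exact integral_congr_ae (ae_of_all _ fun x => norm_add_ofReal_mul_sq (φ x) (v x) t)

namespace Admissible

variable {p β : ℝ} {V : E d → ℝ} {Ω θ C : ℝ}

lemma integrable_normAdd_rpow (H : Admissible p β V Ω θ C) {φ v : E d → ℂ} (hφ : MemH1 φ)
    (hv : MemH1 v) : Integrable (fun x => (‖φ x‖ + ‖v x‖) ^ (p + 1)) volume := by
  have hp : 0 < p + 1 := by linarith [H.one_lt_p]
  have h := ((H.memLp_power hφ).norm.add (H.memLp_power hv).norm).integrable_norm_rpow
    (by simpa using hp) (by simp)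
  rw [ENNReal.toReal_ofReal hp.le] at h
  refine h.congr (ae_of_all _ fun x => ?_)
  simp only [Pi.add_apply]
  rw [Real.norm_of_nonneg (by positivity)]

lemma aestronglyMeasurable_power (H : Admissible p β V Ω θ C) {φ v : E d → ℂ} (hφ : MemH1 φ)
    (hv : MemH1 v) : AEStronglyMeasurable
      (fun x => ((‖φ x‖ ^ (p - 1) : ℝ) : ℂ) * (φ x * conj (v x))) volume := by
  have h1 : AEStronglyMeasurable (fun x => ‖φ x‖ ^ (p - 1)) volume :=
    (Real.continuous_rpow_const (by linarith [H.one_lt_p])).comp_aestronglyMeasurable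
      hφ.1.1.norm
  exact (Complex.continuous_ofReal.comp_aestronglyMeasurable h1).mul (hφ.1.1.mul hv.1.star.1)

lemma integrable_power_pairing (H : Admissible p β V Ω θ C) {φ v : E d → ℂ} (hφ : MemH1 φ)
    (hv : MemH1 v) :
    Integrable (fun x => ((‖φ x‖ ^ (p - 1) : ℝ) : ℂ) * (φ x * conj (v x))) volume := by
  refine (H.integrable_normAdd_rpow hφ hv).mono' (H.aestronglyMeasurable_power hφ hv)
    (ae_of_all _ fun x => ?_)
  rw [norm_mul, Complex.norm_real, Real.norm_of_nonneg (by positivity)]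
  have := norm_rpow_mul_re_le (q := p + 1) (by linarith [H.one_lt_p])
    (le_add_of_nonneg_right (norm_nonneg (v x)) : ‖φ x‖ ≤ ‖φ x‖ + ‖v x‖)
  rwa [show p + 1 - 2 = p - 1 by ring] at this

/-- The derivative of the interaction energy. -/
lemma hasDerivAt_power (H : Admissible p β V Ω θ C) {φ v : E d → ℂ} (hφ : MemH1 φ)
    (hv : MemH1 v) :
    HasDerivAt (fun t : ℝ => ∫ x, ‖(φ + (t : ℂ) • v) x‖ ^ (p + 1))
      ((p + 1) * (∫ x, ((‖φ x‖ ^ (p - 1) : ℝ) : ℂ) * (φ x * conj (v x))).re) 0 := by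
  have hp : 1 < p + 1 := by linarith [H.one_lt_p]
  have h := hasDerivAt_integral_of_dominated_loc_of_deriv_le
    (F := fun (t : ℝ) x => ‖φ x + (t : ℂ) * v x‖ ^ (p + 1))
    (F' := fun (t : ℝ) x => (p + 1) * ‖φ x + (t : ℂ) * v x‖ ^ (p + 1 - 2)
      * ((φ x + (t : ℂ) * v x) * conj (v x)).re)
    (bound := fun x => (p + 1) * (‖φ x‖ + ‖v x‖) ^ (p + 1)) (x₀ := (0 : ℝ))
    (μ := (volume : Measure (E d)))
    (Metric.ball_mem_nhds (0 : ℝ) one_pos) ?_ ?_ ?_ ?_ ?_ ?_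
  · refine h.2.congr_deriv ?_
    have e : (∫ x, ((‖φ x‖ ^ (p - 1) : ℝ) : ℂ) * (φ x * conj (v x))).re
        = ∫ x, (((‖φ x‖ ^ (p - 1) : ℝ) : ℂ) * (φ x * conj (v x))).re :=
      (integral_re (H.integrable_power_pairing hφ hv)).symm
    rw [e, ← integral_const_mul]
    refine integral_congr_ae (ae_of_all _ fun x => ?_)
    simp only [Complex.re_ofReal_mul, Complex.ofReal_zero, zero_mul, add_zero]
    rw [show p + 1 - 2 = p - 1 by ring]
    ring
  · exact Eventually.of_forall fun t => (H.integrable_power (hφ.add (hv.const_smul (t : ℂ)))).1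
  · simpa using H.integrable_power hφ
  · have := Complex.continuous_re.comp_aestronglyMeasurable (H.aestronglyMeasurable_power hφ hv)
    refine (this.const_mul (p + 1)).congr (ae_of_all _ fun x => ?_)
    simp only [Complex.re_ofReal_mul, Complex.ofReal_zero, zero_mul, add_zero]
    rw [show p + 1 - 2 = p - 1 by ring]
    ring
  · refine ae_of_all _ fun x t ht => ?_
    have h1 : ‖φ x + (t : ℂ) * v x‖ ≤ ‖φ x‖ + ‖v x‖ := by
      refine (norm_add_le _ _).trans ?_
      rw [norm_mul, Complex.norm_real]
      have ht' : ‖t‖ ≤ 1 := (mem_ball_zero_iff.1 ht).le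
      have := mul_le_mul_of_nonneg_right ht' (norm_nonneg (v x))
      linarith
    have h2 := norm_rpow_mul_re_le (q := p + 1) (by linarith [H.one_lt_p]) h1
    rw [norm_mul, norm_mul, Real.norm_of_nonneg (by linarith : (0 : ℝ) ≤ p + 1),
      Real.norm_of_nonneg (by positivity), mul_assoc]
    refine mul_le_mul_of_nonneg_left (le_trans ?_ h2) (by linarith)
    gcongr
    exact Complex.abs_re_le_norm _
  · exact (H.integrable_normAdd_rpow hφ hv).const_mul _
  · exact ae_of_all _ fun x t _ => hasDerivAt_norm_add_rpow hp (φ x) (v x) t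

lemma integrable_weight_pairing (H : Admissible p β V Ω θ C) {φ v : E d → ℂ} (hφ : MemX V φ)
    (hv : MemX V v) : Integrable (fun x => (V x : ℂ) * (φ x * conj (v x))) volume := by
  refine (hφ.2.add hv.2).mono' ((Complex.continuous_ofReal.comp_aestronglyMeasurable
    H.aemeasurable.aestronglyMeasurable).mul (hφ.1.1.1.mul hv.1.1.star.1)) (ae_of_all _ fun x => ?_)
  rw [norm_mul, norm_mul, RCLike.norm_conj, Complex.norm_real,
    Real.norm_of_nonneg (H.nonneg x)]
  have h1 : ‖φ x‖ * ‖v x‖ ≤ ‖φ x‖ ^ 2 + ‖v x‖ ^ 2 := by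
    nlinarith [sq_nonneg (‖φ x‖ - ‖v x‖), sq_nonneg ‖φ x‖, sq_nonneg ‖v x‖]
  have := mul_le_mul_of_nonneg_left h1 (H.nonneg x)
  simp only [Pi.add_apply]
  linarith

lemma integrable_Lz_pairing (H : Admissible p β V Ω θ C) {φ v : E d → ℂ} (hφ : MemX V φ)
    (hv : MemX V v) : Integrable (fun x => (Ω : ℂ) * (Lz φ x * conj (v x))) volume := by
  simpa only [mul_comm (conj (v _))] using H.integrable_rot hv hφ.1

/-- The polarization of the quadratic part of the energy. The two rotational terms agree because
`L_z` is symmetric. -/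
lemma integrable_and_integral_crossDensity (H : Admissible p β V Ω θ C) {φ v : E d → ℂ}
    (hφ : MemX V φ) (hv : MemX V v) :
    Integrable (fun x => crossDensity V Ω x (φ x) (v x) (grad φ x) (grad v x)) volume ∧
    ∫ x, crossDensity V Ω x (φ x) (v x) (grad φ x) (grad v x)
      = (∫ x, ∑ j, weakPartial j φ x * conj (weakPartial j v x)).re
        + 2 * (∫ x, (V x : ℂ) * (φ x * conj (v x))).re
        - 2 * (∫ x, (Ω : ℂ) * (Lz φ x * conj (v x))).re := by
  have i1 : Integrable (fun x => ∑ j, weakPartial j φ x * conj (weakPartial j v x)) volume :=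
    integrable_finsetSum _ fun j _ =>
      integrable_pairing (hφ.1.memLp_weakPartial j) (hv.1.memLp_weakPartial j)
  have i2 := (H.integrable_weight_pairing hφ hv)
  have i3 := H.integrable_rot hv hφ.1
  have i4 := H.integrable_rot hφ hv.1
  have i3' : Integrable (fun x => ((Ω : ℂ) * (conj (v x) * Lz φ x)).re) volume := i3.re
  have i4' : Integrable (fun x => ((Ω : ℂ) * (conj (φ x) * Lz v x)).re) volume := i4.re
  have i1' : Integrable (fun x => (∑ j, weakPartial j φ x * conj (weakPartial j v x)).re) volume :=
    i1.re
  have i2' : Integrable (fun x => 2 * ((V x : ℂ) * (φ x * conj (v x))).re) volume :=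
    i2.re.const_mul 2
  have e : ∀ x, crossDensity V Ω x (φ x) (v x) (grad φ x) (grad v x)
      = (∑ j, weakPartial j φ x * conj (weakPartial j v x)).re
        + 2 * ((V x : ℂ) * (φ x * conj (v x))).re
        - (((Ω : ℂ) * (conj (v x) * Lz φ x)).re + ((Ω : ℂ) * (conj (φ x) * Lz v x)).re) :=
    fun x => by
      simp only [crossDensity, rotDensity, Complex.re_ofReal_mul, Complex.re_sum, Lz_eq, grad]
      ring
  have i12 : Integrable (fun x => (∑ j, weakPartial j φ x * conj (weakPartial j v x)).re
        + 2 * ((V x : ℂ) * (φ x * conj (v x))).re) volume := i1'.add i2'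
  have i34 : Integrable (fun x => ((Ω : ℂ) * (conj (v x) * Lz φ x)).re
      + ((Ω : ℂ) * (conj (φ x) * Lz v x)).re) volume := i3'.add i4'
  simp only [e]
  refine ⟨i12.sub i34, ?_⟩
  rw [integral_sub i12 i34, integral_add i1' i2', integral_add i3' i4', integral_const_mul]
  have r1 : ∫ x, (∑ j, weakPartial j φ x * conj (weakPartial j v x)).re = _ := integral_re i1
  have r2 : ∫ x, ((V x : ℂ) * (φ x * conj (v x))).re = _ := integral_re i2
  have r3 : ∫ x, ((Ω : ℂ) * (conj (v x) * Lz φ x)).re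
      = (∫ x, (Ω : ℂ) * (Lz φ x * conj (v x))).re := by
    simp only [mul_comm (conj (v _))]
    exact integral_re (H.integrable_Lz_pairing hφ hv)
  have r4 : ∫ x, ((Ω : ℂ) * (conj (φ x) * Lz v x)).re
      = (∫ x, (Ω : ℂ) * (Lz φ x * conj (v x))).re := by
    rw [H.integral_Lz_symm hφ hv]
    have : ∫ x, ((Ω : ℂ) * (conj (φ x) * Lz v x)).re
        = (∫ x, (Ω : ℂ) * (conj (φ x) * Lz v x)).re := integral_re i4
    rw [this, ← Complex.conj_re, ← integral_conj]
    simp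
  rw [r1, r2, r3, r4]
  simp only [RCLike.re_eq_complex_re]
  ring

lemma quadEnergy_add_smul (H : Admissible p β V Ω θ C) {φ v : E d → ℂ} (hφ : MemX V φ)
    (hv : MemX V v) (t : ℝ) :
    quadEnergy V Ω (φ + (t : ℂ) • v) = quadEnergy V Ω φ
      + t * (∫ x, crossDensity V Ω x (φ x) (v x) (grad φ x) (grad v x))
      + t ^ 2 * quadEnergy V Ω v := by
  have hs := hv.const_smul (t : ℂ)
  have i1 := H.integrable_quadDensity hφ
  have i2 := (H.integrable_and_integral_crossDensity hφ hv).1.const_mul t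
  have i3 := (H.integrable_quadDensity hv).const_mul (t ^ 2)
  have i12 : Integrable (fun x => quadDensity V Ω x (φ x) (grad φ x)
      + t * crossDensity V Ω x (φ x) (v x) (grad φ x) (grad v x)) volume := i1.add i2
  rw [H.quadEnergy_eq hφ, H.quadEnergy_eq hv, H.quadEnergy_eq
    (hφ.add H.aemeasurable H.nonneg hs), ← integral_const_mul, ← integral_const_mul,
    ← integral_add i1 i2, ← integral_add i12 i3]
  refine integral_congr_ae ?_
  filter_upwards [grad_ae_add hφ.1 hs.1, grad_ae_smul hv.1 (t : ℂ)] with x h1 h2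
  rw [h1, h2]
  exact quadDensity_add_smul V Ω x _ _ _ _ t

/-- The derivative of the action is twice the real part of the weak form. -/
lemma hasDerivAt_action (H : Admissible p β V Ω θ C) (ω : ℝ) {φ v : E d → ℂ} (hφ : MemX V φ)
    (hv : MemX V v) :
    HasDerivAt (fun t : ℝ => action p β V Ω ω (φ + (t : ℂ) • v))
      (2 * (weakForm p β V Ω ω φ v).re) 0 := by
  have hp : p + 1 ≠ 0 := by linarith [H.one_lt_p]
  have poly : ∀ A B D : ℝ, HasDerivAt (fun t : ℝ => A + t * B + t ^ 2 * D) B 0 := fun A B D => by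
    have h1 := ((hasDerivAt_id (0 : ℝ)).mul_const B).const_add A
    have h2 := ((hasDerivAt_id (0 : ℝ)).pow 2).mul_const D
    have h3 : HasDerivAt (fun t : ℝ => A + t * B + t ^ 2 * D) _ 0 := h1.add h2
    exact h3.congr_deriv (by simp)
  have h1 : HasDerivAt (fun t : ℝ => quadEnergy V Ω (φ + (t : ℂ) • v)) _ 0 :=
    (poly _ _ _).congr_of_eventuallyEq
      (Eventually.of_forall fun t => H.quadEnergy_add_smul hφ hv t)
  have h2 : HasDerivAt (fun t : ℝ => mass (φ + (t : ℂ) • v)) _ 0 :=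
    (poly _ _ _).congr_of_eventuallyEq
      (Eventually.of_forall fun t => mass_add_smul hφ.1.1 hv.1.1 t)
  have h3 := (H.hasDerivAt_power hφ.1 hv.1).const_mul (2 * β / (p + 1))
  refine ((h1.add h3).add (h2.const_mul ω)).congr_deriv ?_
  rw [(H.integrable_and_integral_crossDensity hφ hv).2, integral_const_mul, weakForm]
  simp only [mul_assoc]
  have e : (1 / 2 : ℂ) = ((1 / 2 : ℝ) : ℂ) := by norm_num
  rw [e]
  simp only [Complex.add_re, Complex.sub_re, Complex.re_ofReal_mul]
  field_simp
  ring

/-- Minimizers of the action satisfy the Euler–Lagrange equation. -/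
lemma weakForm_eq_zero (H : Admissible p β V Ω θ C) {ω : ℝ} {φ v : E d → ℂ}
    (hφ : IsMinimizer p β V Ω ω φ) (hv : MemX V v) : weakForm p β V Ω ω φ v = 0 := by
  have hre : ∀ v, MemX V v → (weakForm p β V Ω ω φ v).re = 0 := fun v hv => by
    have h1 := H.hasDerivAt_action ω hφ.1 hv
    have h2 : IsLocalMin (fun t : ℝ => action p β V Ω ω (φ + (t : ℂ) • v)) 0 :=
      Eventually.of_forall fun t => by
        simpa using hφ.2 _ (hφ.1.add H.aemeasurable H.nonneg (hv.const_smul (t : ℂ)))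
    have := h2.hasDerivAt_eq_zero h1
    linarith
  refine Complex.ext (hre v hv) ?_
  -- testing with `i v` gives the imaginary part
  have := hre _ (hv.const_smul Complex.I)
  rw [weakForm_smul p β V Ω ω φ hv.1] at this
  simpa using this

end Admissible

/-! ### Ground states as global minimizers -/

lemma quadDensity_zero (V : E d → ℝ) (Ω : ℝ) (x : E d) : quadDensity V Ω x 0 0 = 0 := by
  simp [quadDensity, rotDensity]

lemma crossDensity_zero_left (V : E d → ℝ) (Ω : ℝ) (x : E d) (a' : ℂ) (b' : Fin d → ℂ) :
    crossDensity V Ω x 0 a' 0 b' = 0 := by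
  have : lzSymbol x (0 : Fin d → ℂ) = 0 := by simpa using lzSymbol_smul x 0 (0 : Fin d → ℂ)
  simp [crossDensity, rotDensity, this]

/-- The `ω < -λ₀` for which some minimizer of the action has mass at least `m`. -/
def largeMassFrequencies (p β : ℝ) (V : E d → ℝ) (Ω m : ℝ) : Set ℝ :=
  {ω | ω < -lambda0 V Ω ∧ ∃ φ, IsMinimizer p β V Ω ω φ ∧ m ≤ mass φ}

/-- The masses of minimizers are nonincreasing in `ω`, being the slopes of the concave function
`ω ↦ min S_{Ω,ω}`. -/
lemma mass_le_of_lt {p β : ℝ} {V : E d → ℝ} {Ω ω₁ ω₂ : ℝ} {φ₁ φ₂ : E d → ℂ}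
    (h₁ : IsMinimizer p β V Ω ω₁ φ₁)
    (h₂ : IsMinimizer p β V Ω ω₂ φ₂) (h : ω₁ < ω₂) : mass φ₂ ≤ mass φ₁ := by
  have a := h₁.2 φ₂ h₂.1
  have b := h₂.2 φ₁ h₁.1
  rw [action_shift p β V Ω ω₁ ω₂ φ₁, action_shift p β V Ω ω₁ ω₂ φ₂] at b
  nlinarith

lemma bddBelow_groundMasses (p β : ℝ) (V : E d → ℝ) (Ω ω : ℝ) : BddBelow (groundMasses p β V Ω ω) :=
  ⟨0, by rintro _ ⟨φ, _, rfl⟩; exact mass_nonneg φ⟩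

namespace Admissible

variable {p β : ℝ} {V : E d → ℝ} {Ω θ C : ℝ}

lemma quadEnergy_smul (H : Admissible p β V Ω θ C) {φ : E d → ℂ} (hφ : MemX V φ) (t : ℝ) :
    quadEnergy V Ω ((t : ℂ) • φ) = t ^ 2 * quadEnergy V Ω φ := by
  rw [H.quadEnergy_eq hφ, H.quadEnergy_eq (hφ.const_smul _), ← integral_const_mul]
  refine integral_congr_ae ?_
  filter_upwards [grad_ae_smul hφ.1 (t : ℂ)] with x hx
  rw [hx]
  have := quadDensity_add_smul V Ω x 0 (φ x) 0 (grad φ x) t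
  rw [quadDensity_zero, crossDensity_zero_left] at this
  simpa using this

lemma action_smul (H : Admissible p β V Ω θ C) (ω : ℝ) {φ : E d → ℂ} (hφ : MemX V φ) {t : ℝ}
    (ht : 0 ≤ t) : action p β V Ω ω ((t : ℂ) • φ) = t ^ 2 * (quadEnergy V Ω φ + ω * mass φ)
      + t ^ (p + 1) * (2 * β / (p + 1) * ∫ x, ‖φ x‖ ^ (p + 1)) := by
  have e : ∫ x, ‖((t : ℂ) • φ) x‖ ^ (p + 1) = t ^ (p + 1) * ∫ x, ‖φ x‖ ^ (p + 1) := by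
    rw [← integral_const_mul]
    refine integral_congr_ae (ae_of_all _ fun x => ?_)
    simp only [Pi.smul_apply, smul_eq_mul, norm_mul, Complex.norm_real, Real.norm_of_nonneg ht]
    exact Real.mul_rpow ht (norm_nonneg _)
  rw [action, energy, H.quadEnergy_smul hφ, mass_const_smul, e, Complex.norm_real,
    Real.norm_of_nonneg ht]
  ring

lemma power_nonneg (H : Admissible p β V Ω θ C) (φ : E d → ℂ) :
    0 ≤ 2 * β / (p + 1) * ∫ x, ‖φ x‖ ^ (p + 1) :=
  mul_nonneg H.c0_pos.le (integral_nonneg fun x => by positivity)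

lemma neg_C_mul_mass_le (H : Admissible p β V Ω θ C) {φ : E d → ℂ} (hφ : MemX V φ) :
    -C * mass φ ≤ quadEnergy V Ω φ := by
  have h := H.quadEnergy_ge hφ
  have h1 : 0 ≤ ∑ j, mass (weakPartial j φ) := Finset.sum_nonneg fun j _ => mass_nonneg _
  have h2 : 0 ≤ ∫ x, V x * ‖φ x‖ ^ 2 :=
    integral_nonneg fun x => mul_nonneg (H.nonneg x) (by positivity)
  have h3 : 0 ≤ 1 - θ := by linarith [H.θ_lt_one]
  have : 0 ≤ (1 - θ) * ((1 / 2) * ∑ j, mass (weakPartial j φ) + ∫ x, V x * ‖φ x‖ ^ 2) := by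
    positivity
  linarith

lemma bddBelow_rayleighQuotients (H : Admissible p β V Ω θ C) :
    BddBelow (rayleighQuotients V Ω) := by
  refine ⟨-C, ?_⟩
  rintro _ ⟨φ, hφ, h0, rfl⟩
  rw [le_div_iff₀ (mass_pos hφ.1.1 h0)]
  exact H.neg_C_mul_mass_le hφ

lemma lambda0_mul_mass_le (H : Admissible p β V Ω θ C) {φ : E d → ℂ} (hφ : MemX V φ) :
    lambda0 V Ω * mass φ ≤ quadEnergy V Ω φ := by
  by_cases h0 : φ =ᵐ[volume] 0
  · have := H.neg_C_mul_mass_le hφ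
    rw [(ae_eq_zero_iff_mass hφ.1.1).1 h0] at this ⊢
    simpa using this
  · rw [← le_div_iff₀ (mass_pos hφ.1.1 h0)]
    exact csInf_le H.bddBelow_rayleighQuotients ⟨φ, hφ, h0, rfl⟩

lemma action_nonneg_of_ae_eq_zero (H : Admissible p β V Ω θ C) (ω : ℝ) {φ : E d → ℂ}
    (hφ : MemX V φ) (h0 : φ =ᵐ[volume] 0) : 0 ≤ action p β V Ω ω φ := by
  have h1 := H.neg_C_mul_mass_le hφ
  have h2 := H.power_nonneg φ
  rw [(ae_eq_zero_iff_mass hφ.1.1).1 h0] at h1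
  rw [action, energy, (ae_eq_zero_iff_mass hφ.1.1).1 h0]
  linarith

lemma exists_action_neg (H : Admissible p β V Ω θ C) (hX : ∃ φ, MemX V φ ∧ ¬ φ =ᵐ[volume] 0)
    {ω : ℝ} (hω : ω < -lambda0 V Ω) : ∃ φ, MemX V φ ∧ action p β V Ω ω φ < 0 := by
  have hne : (rayleighQuotients V Ω).Nonempty := by
    obtain ⟨φ, hφ, h0⟩ := hX
    exact ⟨_, φ, hφ, h0, rfl⟩
  obtain ⟨_, ⟨φ, hφ, h0, rfl⟩, hlt⟩ := exists_lt_of_csInf_lt hne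
    (show sInf (rayleighQuotients V Ω) < -ω by change lambda0 V Ω < -ω; linarith)
  rw [div_lt_iff₀ (mass_pos hφ.1.1 h0)] at hlt
  have hb := H.power_nonneg φ
  set b := 2 * β / (p + 1) * ∫ x, ‖φ x‖ ^ (p + 1)
  set a := -(quadEnergy V Ω φ + ω * mass φ) with ha
  have ha0 : 0 < a := by simp only [a]; linarith
  -- a small multiple of `φ`: the quadratic part dominates the power
  set t := (a / (b + 1)) ^ (1 / (p - 1))
  have hp := H.one_lt_p
  have ht : 0 < t := by positivity
  refine ⟨(t : ℂ) • φ, hφ.const_smul _, ?_⟩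
  rw [H.action_smul ω hφ ht.le]
  change t ^ 2 * (quadEnergy V Ω φ + ω * mass φ) + t ^ (p + 1) * b < 0
  have h1 : t ^ (p + 1) = t ^ 2 * (a / (b + 1)) := by
    have h2 : t ^ (p - 1) = a / (b + 1) := by
      rw [← Real.rpow_mul (by positivity), one_div_mul_cancel (by linarith), Real.rpow_one]
    rw [← h2, ← Real.rpow_natCast t 2, ← Real.rpow_add ht]
    congr 1
    push_cast
    ring
  have h3 : quadEnergy V Ω φ + ω * mass φ = -a := by rw [ha]; ring
  have h4 : a / (b + 1) * b < a := by
    rw [div_mul_eq_mul_div, div_lt_iff₀ (by positivity)]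
    nlinarith
  rw [h1, h3, mul_assoc, ← mul_add]
  exact mul_neg_of_pos_of_neg (by positivity) (by linarith)

lemma minimizer_ne_zero (H : Admissible p β V Ω θ C) (hX : ∃ φ, MemX V φ ∧ ¬ φ =ᵐ[volume] 0)
    {ω : ℝ} (hω : ω < -lambda0 V Ω) {φ : E d → ℂ} (hφ : IsMinimizer p β V Ω ω φ) :
    ¬ φ =ᵐ[volume] 0 := fun h0 => by
  obtain ⟨ψ, hψ, hneg⟩ := H.exists_action_neg hX hω
  have h1 := H.action_nonneg_of_ae_eq_zero ω hφ.1 h0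
  have h2 := hφ.2 ψ hψ
  linarith

/-- For `ω < -λ₀` the action ground states are the global minimizers of the action on `X`. -/
lemma actionGroundStates_eq (H : Admissible p β V Ω θ C)
    (hX : ∃ φ, MemX V φ ∧ ¬ φ =ᵐ[volume] 0) {ω : ℝ} (hω : ω < -lambda0 V Ω) :
    actionGroundStates p β V Ω ω = {φ | IsMinimizer p β V Ω ω φ} := by
  have stat : ∀ φ, IsMinimizer p β V Ω ω φ → IsStationary p β V Ω ω φ := fun φ hφ =>
    ⟨hφ.1, H.minimizer_ne_zero hX hω hφ, fun v hv => H.weakForm_eq_zero hφ hv⟩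
  ext φ
  constructor
  · rintro ⟨h1, h2⟩
    obtain ⟨φ₀, hφ₀, -⟩ := hX
    obtain ⟨ψ, hψ⟩ := H.exists_minimizer ⟨φ₀, hφ₀⟩ ω
    exact ⟨h1.1, fun v hv => (h2 ψ (stat ψ hψ)).trans (hψ.2 v hv)⟩
  · exact fun hφ => ⟨stat φ hφ, fun ψ hψ => hφ.2 ψ hψ.1⟩

lemma mem_groundMasses (H : Admissible p β V Ω θ C)
    (hX : ∃ φ, MemX V φ ∧ ¬ φ =ᵐ[volume] 0) {ω : ℝ} (hω : ω < -lambda0 V Ω) (m : ℝ) :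
    m ∈ groundMasses p β V Ω ω ↔ ∃ φ, IsMinimizer p β V Ω ω φ ∧ mass φ = m := by
  rw [groundMasses, H.actionGroundStates_eq hX hω]
  rfl

/-! ### Dependence of the masses on `ω` -/

/-- The masses are strictly decreasing: two minimizers of equal mass would both solve the equations
for `ω₁` and `ω₂`. -/
lemma mass_lt_of_lt (H : Admissible p β V Ω θ C) {ω₁ ω₂ : ℝ} {φ₁ φ₂ : E d → ℂ}
    (h₁ : IsMinimizer p β V Ω ω₁ φ₁) (h₂ : IsMinimizer p β V Ω ω₂ φ₂) (h : ω₁ < ω₂)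
    (h0 : ¬ φ₁ =ᵐ[volume] 0) : mass φ₂ < mass φ₁ := by
  refine (mass_le_of_lt h₁ h₂ h).lt_of_ne fun heq => ?_
  have hmin : IsMinimizer p β V Ω ω₂ φ₁ := by
    refine ⟨h₁.1, fun ψ hψ => le_trans ?_ (h₂.2 ψ hψ)⟩
    have a := h₁.2 φ₂ h₂.1
    rw [action_shift p β V Ω ω₁ ω₂ φ₁, action_shift p β V Ω ω₁ ω₂ φ₂, heq]
    linarith
  have e1 := H.weakForm_eq_zero h₁ h₁.1
  have e2 := H.weakForm_eq_zero hmin h₁.1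
  have e3 : ((ω₂ - ω₁ : ℝ) : ℂ) * ∫ x, φ₁ x * conj (φ₁ x) = 0 := by
    rw [weakForm] at e1 e2
    push_cast
    linear_combination e2 - e1
  have e4 : ∫ x, φ₁ x * conj (φ₁ x) = (mass φ₁ : ℂ) := by
    rw [mass, ← integral_complex_ofReal]
    refine integral_congr_ae (ae_of_all _ fun x => ?_)
    simp only [Complex.mul_conj, Complex.normSq_eq_norm_sq]
  rw [e4, ← Complex.ofReal_mul, Complex.ofReal_eq_zero] at e3
  have := mass_pos h₁.1.1.1 h0
  have : 0 < (ω₂ - ω₁) * mass φ₁ := mul_pos (by linarith) this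
  linarith

/-- Minimizers for convergent frequencies, with bounded masses, converge along a subsequence. -/
lemma exists_minimizer_of_tendsto (H : Admissible p β V Ω θ C) {w : ℕ → ℝ} {ω : ℝ}
    (hw : Tendsto w atTop (𝓝 ω)) {f : ℕ → E d → ℂ} (hf : ∀ n, IsMinimizer p β V Ω (w n) (f n))
    {B : ℝ} (hB : ∀ n, mass (f n) ≤ B) :
    ∃ φ, IsMinimizer p β V Ω ω φ ∧ ∃ σ : ℕ → ℕ, StrictMono σ ∧
      Tendsto (fun n => mass (f (σ n))) atTop (𝓝 (mass φ)) := by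
  refine H.exists_minimizer_of_seq ⟨fun n => (hf n).1, fun φ hφ ε hε => ?_⟩
  have h1 : Tendsto (fun n => |ω - w n| * (B + mass φ)) atTop (𝓝 0) := by
    have : Tendsto (fun n => |ω - w n| * (B + mass φ)) atTop (𝓝 (|ω - ω| * (B + mass φ))) :=
      ((tendsto_const_nhds.sub hw).abs).mul_const _
    simpa using this
  filter_upwards [h1.eventually_lt_const hε] with n hn
  have h2 := (hf n).2 φ hφ
  rw [action_shift p β V Ω (w n) ω (f n), action_shift p β V Ω (w n) ω φ]
  have h3 : (ω - w n) * (mass (f n) - mass φ) ≤ |ω - w n| * (B + mass φ) := by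
    refine (le_abs_self _).trans ?_
    rw [abs_mul]
    gcongr
    rw [abs_le]
    have := mass_nonneg (f n)
    have := mass_nonneg φ
    have := hB n
    constructor <;> linarith
  linarith

lemma exists_mass_bound (H : Admissible p β V Ω θ C) (hX : ∃ φ, MemX V φ) (a : ℝ) :
    ∃ B, ∀ ω, a ≤ ω → ∀ φ, IsMinimizer p β V Ω ω φ → mass φ ≤ B := by
  obtain ⟨ψ, hψ⟩ := H.exists_minimizer hX (a - 1)
  exact ⟨mass ψ, fun ω hω φ hφ => mass_le_of_lt hψ hφ (by linarith)⟩

lemma bddAbove_groundMasses (H : Admissible p β V Ω θ C)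
    (hX : ∃ φ, MemX V φ ∧ ¬ φ =ᵐ[volume] 0) {ω : ℝ} (hω : ω < -lambda0 V Ω) :
    BddAbove (groundMasses p β V Ω ω) := by
  obtain ⟨B, hB⟩ := H.exists_mass_bound (hX.imp fun _ h => h.1) ω
  refine ⟨B, fun m hm => ?_⟩
  obtain ⟨φ, hφ, rfl⟩ := (H.mem_groundMasses hX hω m).1 hm
  exact hB ω le_rfl φ hφ

lemma nonempty_groundMasses (H : Admissible p β V Ω θ C)
    (hX : ∃ φ, MemX V φ ∧ ¬ φ =ᵐ[volume] 0) {ω : ℝ} (hω : ω < -lambda0 V Ω) :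
    (groundMasses p β V Ω ω).Nonempty := by
  obtain ⟨φ, hφ⟩ := H.exists_minimizer (hX.imp fun _ h => h.1) ω
  exact ⟨mass φ, (H.mem_groundMasses hX hω _).2 ⟨φ, hφ, rfl⟩⟩

/-- The set of masses of the ground states is closed. -/
lemma mem_groundMasses_of_tendsto (H : Admissible p β V Ω θ C)
    (hX : ∃ φ, MemX V φ ∧ ¬ φ =ᵐ[volume] 0) {ω : ℝ} (hω : ω < -lambda0 V Ω) {u : ℕ → ℝ} {m : ℝ}
    (hu : ∀ n, u n ∈ groundMasses p β V Ω ω) (hm : Tendsto u atTop (𝓝 m)) :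
    m ∈ groundMasses p β V Ω ω := by
  obtain ⟨B, hB⟩ := H.bddAbove_groundMasses hX hω
  choose f hf hfu using fun n => (H.mem_groundMasses hX hω (u n)).1 (hu n)
  obtain ⟨φ, hφ, σ, hσ, hlim⟩ := H.exists_minimizer_of_tendsto (tendsto_const_nhds (x := ω)) hf
    (B := B) fun n => by rw [hfu]; exact hB (hu n)
  refine (H.mem_groundMasses hX hω m).2 ⟨φ, hφ, tendsto_nhds_unique hlim ?_⟩
  simp only [hfu]
  exact hm.comp hσ.tendsto_atTop

lemma mUpper_mem (H : Admissible p β V Ω θ C) (hX : ∃ φ, MemX V φ ∧ ¬ φ =ᵐ[volume] 0) {ω : ℝ}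
    (hω : ω < -lambda0 V Ω) : mUpper p β V Ω ω ∈ groundMasses p β V Ω ω := by
  obtain ⟨u, -, hu, hmem⟩ := exists_seq_tendsto_sSup (H.nonempty_groundMasses hX hω)
    (H.bddAbove_groundMasses hX hω)
  exact H.mem_groundMasses_of_tendsto hX hω hmem hu

lemma mLower_mem (H : Admissible p β V Ω θ C) (hX : ∃ φ, MemX V φ ∧ ¬ φ =ᵐ[volume] 0) {ω : ℝ}
    (hω : ω < -lambda0 V Ω) : mLower p β V Ω ω ∈ groundMasses p β V Ω ω := by
  obtain ⟨u, -, hu, hmem⟩ := exists_seq_tendsto_sInf (H.nonempty_groundMasses hX hω)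
    (bddBelow_groundMasses p β V Ω ω)
  exact H.mem_groundMasses_of_tendsto hX hω hmem hu

lemma mUpper_lt_mLower (H : Admissible p β V Ω θ C) (hX : ∃ φ, MemX V φ ∧ ¬ φ =ᵐ[volume] 0)
    {ω₁ ω₂ : ℝ} (h₂ : ω₂ < -lambda0 V Ω) (h : ω₁ < ω₂) :
    mUpper p β V Ω ω₂ < mLower p β V Ω ω₁ := by
  have h₁ := h.trans h₂
  obtain ⟨φ₁, m₁, e₁⟩ := (H.mem_groundMasses hX h₁ _).1 (H.mLower_mem hX h₁)
  obtain ⟨φ₂, m₂, e₂⟩ := (H.mem_groundMasses hX h₂ _).1 (H.mUpper_mem hX h₂)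
  rw [← e₁, ← e₂]
  exact H.mass_lt_of_lt m₁ m₂ h (H.minimizer_ne_zero hX h₁ m₁)

lemma mLower_pos (H : Admissible p β V Ω θ C) (hX : ∃ φ, MemX V φ ∧ ¬ φ =ᵐ[volume] 0) {ω : ℝ}
    (hω : ω < -lambda0 V Ω) : 0 < mLower p β V Ω ω := by
  obtain ⟨φ, h, e⟩ := (H.mem_groundMasses hX hω _).1 (H.mLower_mem hX hω)
  rw [← e]
  exact mass_pos h.1.1.1 (H.minimizer_ne_zero hX hω h)

/-! ### Every mass is covered -/

/-- At the threshold `ω = -λ₀` the only minimizer is zero. -/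
lemma mass_eq_zero_of_minimizer_threshold (H : Admissible p β V Ω θ C) {φ : E d → ℂ}
    (hφ : IsMinimizer p β V Ω (-lambda0 V Ω) φ) : mass φ = 0 := by
  have h1 := hφ.2 _ (hφ.1.const_smul ((0 : ℝ) : ℂ))
  have hp : p + 1 ≠ 0 := by linarith [H.one_lt_p]
  rw [H.action_smul _ hφ.1 le_rfl, Real.zero_rpow hp, action, energy] at h1
  have h2 := H.lambda0_mul_mass_le hφ.1
  have h3 : 2 * β / (p + 1) * ∫ x, ‖φ x‖ ^ (p + 1) ≤ 0 := by linarith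
  have h4 : ∫ x, ‖φ x‖ ^ (p + 1) = 0 :=
    le_antisymm (nonpos_of_mul_nonpos_right h3 H.c0_pos) (integral_nonneg fun x => by positivity)
  rw [integral_eq_zero_iff_of_nonneg (fun x => by positivity) (H.integrable_power hφ.1.1)] at h4
  refine (ae_eq_zero_iff_mass hφ.1.1.1).1 (h4.mono fun x hx => ?_)
  simpa [Real.rpow_eq_zero (norm_nonneg _) hp] using hx

/-- The masses are unbounded as `ω → -∞`. -/
lemma nonempty_largeMassFrequencies (H : Admissible p β V Ω θ C)
    (hX : ∃ φ, MemX V φ ∧ ¬ φ =ᵐ[volume] 0) {m : ℝ} (hm : 0 < m) :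
    (largeMassFrequencies p β V Ω m).Nonempty := by
  obtain ⟨φ₀, hφ₀, h0⟩ := hX
  have hM₀ := mass_pos hφ₀.1.1 h0
  set t := √((m + 1) / mass φ₀)
  set φ : E d → ℂ := (t : ℂ) • φ₀
  have hφ : MemX V φ := hφ₀.const_smul _
  have hM : mass φ = m + 1 := by
    rw [mass_const_smul, Complex.norm_real, Real.norm_of_nonneg (Real.sqrt_nonneg _),
      Real.sq_sqrt (by positivity), div_mul_cancel₀ _ hM₀.ne']
  set lam := lambda0 V Ω
  set ω := -(|lam| + 1) - (|energy p β V Ω φ| + |lam| * m + 1)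
  have hpos : 0 ≤ |lam| * m := by positivity
  have hω : ω < -lam := by
    have := le_abs_self lam
    have := abs_nonneg (energy p β V Ω φ)
    simp only [ω]
    linarith
  obtain ⟨ψ, hψ⟩ := H.exists_minimizer ⟨φ, hφ⟩ ω
  refine ⟨ω, hω, ψ, hψ, ?_⟩
  by_contra hlt
  rw [not_le] at hlt
  have h1 := hψ.2 φ hφ
  rw [action, action, hM, energy] at h1
  have h2 := H.lambda0_mul_mass_le hψ.1
  have h3 := H.power_nonneg ψ
  have h4 : -(|lam| * m) ≤ lam * mass ψ := by
    have := mul_le_mul_of_nonneg_left hlt.le (abs_nonneg lam)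
    have := mul_le_mul_of_nonneg_right (neg_abs_le lam) (mass_nonneg ψ)
    linarith
  have h5 : ω * m ≤ ω * mass ψ := by
    refine mul_le_mul_of_nonpos_left hlt.le ?_
    have := abs_nonneg (energy p β V Ω φ)
    have := abs_nonneg lam
    simp only [ω]
    linarith
  have h6 := le_abs_self (energy p β V Ω φ)
  have h7 := abs_nonneg lam
  have h8 : ω = -(|lam| + 1) - (|energy p β V Ω φ| + |lam| * m + 1) := rfl
  change lam * mass ψ ≤ _ at h2
  linarith

lemma exists_mem_massInterval (H : Admissible p β V Ω θ C)
    (hX : ∃ φ, MemX V φ ∧ ¬ φ =ᵐ[volume] 0) {m : ℝ} (hm : 0 < m) :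
    ∃ ω < -lambda0 V Ω, m ∈ massInterval p β V Ω ω := by
  set A := largeMassFrequencies p β V Ω m
  have hne : A.Nonempty := H.nonempty_largeMassFrequencies hX hm
  have hbdd : BddAbove A := ⟨-lambda0 V Ω, fun ω hω => hω.1.le⟩
  set ω₀ := sSup A
  -- a minimizer at `ω₀` of mass at least `m`, from below
  obtain ⟨φ, hφ, hmφ⟩ : ∃ φ, IsMinimizer p β V Ω ω₀ φ ∧ m ≤ mass φ := by
    obtain ⟨w, hmono, hw, hwA⟩ := exists_seq_tendsto_sSup hne hbdd
    choose f hf hfm using fun n => (hwA n).2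
    obtain ⟨B, hB⟩ := H.exists_mass_bound (hX.imp fun _ h => h.1) (w 0)
    obtain ⟨φ, hφ, σ, -, hlim⟩ := H.exists_minimizer_of_tendsto hw hf
      fun n => hB _ (hmono (Nat.zero_le n)) _ (hf n)
    exact ⟨φ, hφ, ge_of_tendsto' hlim fun n => hfm (σ n)⟩
  have hω₀ : ω₀ < -lambda0 V Ω := by
    refine (csSup_le hne fun ω hω => hω.1.le).lt_of_ne fun heq => ?_
    rw [show ω₀ = -lambda0 V Ω from heq] at hφ
    have := H.mass_eq_zero_of_minimizer_threshold hφ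
    linarith
  -- a minimizer at `ω₀` of mass at most `m`, from above
  obtain ⟨ψ, hψ, hmψ⟩ : ∃ ψ, IsMinimizer p β V Ω ω₀ ψ ∧ mass ψ ≤ m := by
    obtain ⟨w, -, hw, hlim⟩ := exists_seq_strictAnti_tendsto' hω₀
    choose f hf using fun n => H.exists_minimizer (hX.imp fun _ h => h.1) (w n)
    have hlt : ∀ n, mass (f n) ≤ m := fun n => by
      by_contra hcon
      have hmem : w n ∈ A := ⟨(hw n).2, f n, hf n, (not_le.1 hcon).le⟩
      exact absurd (le_csSup hbdd hmem) (not_le.2 (hw n).1)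
    obtain ⟨ψ, hψ, σ, -, hσ⟩ := H.exists_minimizer_of_tendsto hlim hf hlt
    exact ⟨ψ, hψ, le_of_tendsto' hσ fun n => hlt (σ n)⟩
  refine ⟨ω₀, hω₀, ?_, ?_⟩
  · exact (csInf_le (bddBelow_groundMasses p β V Ω ω₀)
      ((H.mem_groundMasses hX hω₀ _).2 ⟨ψ, hψ, rfl⟩)).trans hmψ
  · exact hmφ.trans (le_csSup (H.bddAbove_groundMasses hX hω₀)
      ((H.mem_groundMasses hX hω₀ _).2 ⟨φ, hφ, rfl⟩))

end Admissible

/-! ### The condition on the rotation -/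

/-- Below the critical speed, the centrifugal potential is dominated by the trap. -/
lemma exists_rot_le {V : E d → ℝ} (hV0 : ∀ x, 0 ≤ V x) {Ω : ℝ}
    (hΩ : Ω = 0 ∨ (0 < |Ω| ∧ ((|Ω| : ℝ) : EReal) < OmegaMax V)) :
    ∃ θ C : ℝ, 0 ≤ θ ∧ θ < 1 ∧ 0 ≤ C ∧ ∀ x, Ω ^ 2 * planeSq x ≤ 2 * θ ^ 2 * (V x + C) := by
  rcases hΩ with rfl | ⟨h0, hlt⟩
  · exact ⟨0, 0, le_rfl, one_pos, le_rfl, fun x => by simp⟩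
  · rw [OmegaMax] at hlt
    simp only [lt_iSup_iff] at hlt
    obtain ⟨γ, ⟨hγ0, hγ⟩, hΩγ⟩ := hlt
    have hΩγ : |Ω| < γ := by exact_mod_cast hΩγ
    obtain ⟨R, hR⟩ := exists_forall_weight_ge hγ 0
    refine ⟨|Ω| / γ, γ ^ 2 / 2 * R ^ 2, by positivity, (div_lt_one hγ0).2 hΩγ, by positivity,
      fun x => ?_⟩
    have key : γ ^ 2 / 2 * planeSq x ≤ V x + γ ^ 2 / 2 * R ^ 2 := by
      by_cases hx : x ∈ Metric.ball (0 : E d) R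
      · have h1 : ‖x‖ ≤ R := (mem_ball_zero_iff.1 hx).le
        have h2 : planeSq x ≤ R ^ 2 := (planeSq_le x).trans (by gcongr)
        have h3 : γ ^ 2 / 2 * planeSq x ≤ γ ^ 2 / 2 * R ^ 2 := by gcongr
        have := hV0 x
        linarith
      · have h1 := hR x hx
        have : 0 ≤ γ ^ 2 / 2 * R ^ 2 := by positivity
        linarith
    have e : Ω ^ 2 * planeSq x = 2 * (|Ω| / γ) ^ 2 * (γ ^ 2 / 2 * planeSq x) := by
      rw [div_pow, sq_abs]
      field_simp
    rw [e]
    gcongr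

lemma subcritical_of_lt (hd : 1 ≤ d) {p : ℝ} (hp : 1 < p)
    (hp' : 3 ≤ d → p < ((d : ℝ) + 2) / ((d : ℝ) - 2)) : ((d : ℝ) - 2) * (p + 1) < 2 * d := by
  have hd' : (1 : ℝ) ≤ d := by exact_mod_cast hd
  rcases le_or_gt 3 d with h | h
  · have h3 : (3 : ℝ) ≤ d := by exact_mod_cast h
    have := hp' h
    rw [lt_div_iff₀ (by linarith)] at this
    linarith
  · have h2 : (d : ℝ) ≤ 2 := by exact_mod_cast Nat.lt_succ_iff.1 h
    nlinarith

end RotNLS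

end

theorem corollary4p7 (d : ℕ) (hd : 1 ≤ d)
    (p : ℝ) (hp : 1 < p) (hp' : 3 ≤ d → p < ((d : ℝ) + 2) / ((d : ℝ) - 2))
    (β : ℝ) (hβ : 0 < β)
    (V : RotNLS.E d → ℝ) (hVm : AEMeasurable V volume) (hV0 : ∀ x, 0 ≤ V x)
    (hVinf : Tendsto V (cocompact (RotNLS.E d)) atTop)
    (hX : ∃ φ : RotNLS.E d → ℂ, RotNLS.MemX V φ ∧ ¬ φ =ᵐ[volume] 0)
    (Ω : ℝ) (hΩ : Ω = 0 ∨ (0 < |Ω| ∧ ((|Ω| : ℝ) : EReal) < RotNLS.OmegaMax V)) :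
    -- `λ₀(Ω)` is a genuine infimum, and `m_*`, `m^*` are finite
    IsGLB (RotNLS.rayleighQuotients V Ω) (RotNLS.lambda0 V Ω) ∧
    (∀ ω < -RotNLS.lambda0 V Ω,
      (RotNLS.groundMasses p β V Ω ω).Nonempty ∧ BddAbove (RotNLS.groundMasses p β V Ω ω)) ∧
    -- the intervals are pairwise disjoint
    (∀ ω₁ < -RotNLS.lambda0 V Ω, ∀ ω₂ < -RotNLS.lambda0 V Ω, ω₁ ≠ ω₂ →
      RotNLS.massInterval p β V Ω ω₁ ∩ RotNLS.massInterval p β V Ω ω₂ = ∅) ∧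
    -- and their union is `(0, ∞)`
    (⋃ ω ∈ Set.Iio (-RotNLS.lambda0 V Ω), RotNLS.massInterval p β V Ω ω) = Set.Ioi 0 := by
  obtain ⟨θ, C, hθ0, hθ1, hC, hrot⟩ := RotNLS.exists_rot_le hV0 hΩ
  have H : RotNLS.Admissible p β V Ω θ C :=
    ⟨hd, hp, RotNLS.subcritical_of_lt hd hp hp', hβ, hVm, hV0, hVinf, hθ0, hθ1, hC, hrot⟩
  have hlt : ∀ ω₁ ω₂, ω₂ < -RotNLS.lambda0 V Ω → ω₁ < ω₂ →
      RotNLS.massInterval p β V Ω ω₁ ∩ RotNLS.massInterval p β V Ω ω₂ = ∅ := by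
    intro ω₁ ω₂ h₂ h
    rw [Set.eq_empty_iff_forall_notMem]
    rintro m ⟨⟨ha, -⟩, -, hb⟩
    have := H.mUpper_lt_mLower hX h₂ h
    linarith
  refine ⟨?_, fun ω hω => ⟨H.nonempty_groundMasses hX hω, H.bddAbove_groundMasses hX hω⟩, ?_, ?_⟩
  · obtain ⟨φ, hφ, h0⟩ := hX
    exact isGLB_csInf ⟨_, φ, hφ, h0, rfl⟩ H.bddBelow_rayleighQuotients
  · intro ω₁ h₁ ω₂ h₂ hne
    rcases hne.lt_or_gt with h | h
    · exact hlt ω₁ ω₂ h₂ h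
    · rw [Set.inter_comm]
      exact hlt ω₂ ω₁ h₁ h
  · ext m
    simp only [Set.mem_iUnion, Set.mem_Iio, Set.mem_Ioi, exists_prop]
    constructor
    · rintro ⟨ω, hω, hm, -⟩
      exact (H.mLower_pos hX hω).trans_le hm
    · exact fun hm => H.exists_mem_massInterval hX hm
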